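/- All alphabets and state sets are finite. For a word $u=a_1\cdots a_k\in A^*$ let $\vdash u\dashv$ be the word with endmarkers, with $\vdash$ at position $0$, $a_i$ at position $i$ and $\dashv$ at position $k+1$. A *(deterministic) two-way transducer* $(Q,A,B,\delta,\gamma,q_0,F)$ has a transition function $\delta:Q\times(A\uplus\{\vdash,\dashv\})\to Q\times\{-1,0,+1\}$, with no move $-1$ on $\vdash$ and no move $+1$ on $\dashv$, a production function $\gamma:Q\times(A\uplus\{\vdash,\dashv\})\to B^*$, an initial state $q_0$ and a set $F$ of final states. Its run over $u$ starts in state $q_0$ at position $0$; in state $p$ at a position carrying the letter $a$, with $\delta(p,a)=(q,d)$, it goes to state $q$, moves the head by $d$ and produces $\gamma(p,a)$; the run is accepting, and stops, when it reaches a final state at the right endmarker, and the concatenation of the productions is then the image of $u$ (otherwise the image of $u$ is undefined). For $w\in A^*$ the four behaviors $\mathrm{bh}_{xy}(w)\subseteq Q\times Q$, $x,y\in\{\ell,r\}$, consist of the pairs $(p,q)$ such that the run that starts in state $p$ at the first ($x=\ell$) or last ($x=r$) position of $w$ leaves $w$ on the left ($y=\ell$) or on the right ($y=r$) in state $q$;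 for the empty word, $\mathrm{bh}_{xy}$ is the identity if $x\neq y$ and empty if $x=y$. Having the same four behaviors is a congruence on $A^*$, the quotient is the *transition monoid*, and the transducer is *aperiodic* if for some integer $n$ all elements $x$ of this monoid satisfy $x^n=x^{n+1}$. A *two-way transducer with star-free look-around* $(Q,A,B,\Delta,i,F)$ has instead a finite set $\Delta$ of transitions $(q,(L_p,a,L_s),q',v,m)$ with $q,q'\in Q$, $a\in A\uplus\{\vdash,\dashv\}$, $v\in B^*$, $m\in\{-1,0,+1\}$ and $L_p,L_s$ star-free languages over $A\uplus\{\vdash,\dashv\}$. The test $(L_p,a,L_s)$ is satisfied at a position of $\vdash u\dashv$ if the position carries $a$, the part of $\vdash u\dashv$ strictly before it is in $L_p$ and the part strictly after it is in $L_s$; the transition may then be taken in state $q$, going to $q'$, moving the head by $m$ and producing $v$. Runs, accepting runs and images are defined as above. It is *deterministic* if the tests of distinct transitions from the same state are mutually exclusive. The accepting path over a word is the sequence of pairs (state, position) of its accepting run, and $path_{vw}(vuw)$ is obtained from the accepting path over $vuw$ by keeping the pairs whose position belongs to $v$ or to $w$ and renaming these positions $1,\dots,|v|+|w|$ in order; it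 is undefined if $vuw$ is not accepted. The transducer is *aperiodic* if there is a positive integer $n$ such that for all $u,v,w\in A^*$ the context paths $path_{vw}(vu^nw)$ and $path_{vw}(vu^{n+1}w)$ are both undefined, or are both defined and equal. **Theorem.** For every deterministic aperiodic two-way transducer with star-free look-around with input alphabet $A$ and output alphabet $B$ there is an aperiodic (deterministic) two-way transducer with input alphabet $A$ and output alphabet $B$ that realizes the same partial function $A^*\rightharpoonup B^*$. -/

import Mathlib

/-- A monoid `M` is aperiodic if there is an integer `n` with `x ^ n = x ^ (n + 1)` for every
element `x` of `M`. -/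
def IsAperiodicMonoid (M : Type*) [Monoid M] : Prop :=
  ∃ n : ℕ, ∀ x : M, x ^ n = x ^ (n + 1)

/-- Star-free languages over the alphabet `α`: the least class of languages that contains the
empty language, the language of the empty word and the one-letter languages, and that is closed
under union, concatenation and complement (with respect to all words over `α`). -/
inductive IsStarFree {α : Type*} : Language α → Prop
  | empty : IsStarFree 0
  | emptyWord : IsStarFree 1
  | letter (a : α) : IsStarFree {[a]}
  | union {K L : Language α} : IsStarFree K → IsStarFree L → IsStarFree (K + L)
  | concat {K L : Language α} : IsStarFree K → IsStarFree L → IsStarFree (K * L)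
  | compl {L : Language α} : IsStarFree L → IsStarFree Lᶜ

/-- The alphabet `A` enriched with the two endmarkers. -/
inductive Marked (A : Type*)
  | leftEnd : Marked A
  | letter (a : A) : Marked A
  | rightEnd : Marked A

/-- The input tape for the word `u = a₁ ⋯ aₙ`: the left endmarker at position `0`, the letter `aᵢ`
at position `i`, and the right endmarker at position `n + 1`. -/
def markedWord {A : Type*} (u : List A) : List (Marked A) :=
  Marked.leftEnd :: (u.map Marked.letter ++ [Marked.rightEnd])

/-- A run of a machine with configurations `C` and outputs in `List B`, where `step c v c'` says
that the machine can go in one step from `c` to `c'` and produce `v`.  `Run step c π v d` says that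
there is a run from `c` to `d` whose sequence of configurations (both ends included) is `π` and
whose productions concatenate to `v`. -/
inductive Run {C B : Type*} (step : C → List B → C → Prop) :
    C → List C → List B → C → Prop
  | refl (c : C) : Run step c [c] [] c
  | cons {c c' d : C} {v v' : List B} {π : List C} :
      step c v c' → Run step c' π v' d → Run step c (c :: π) (v ++ v') d

/-! ### Two-way automata, their transition monoid, and two-way transducers -/

/-- A deterministic two-way automaton with set of states `Q` and input alphabet `A` (both assumed
finite where automata are used).  The elements `-1`, `0`, `1` of `SignType` are the moves of the
head. -/
structure TwoWayAutomaton (Q A : Type*) where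
  /-- The transition function. -/
  δ : Q → Marked A → Q × SignType
  /-- The head does not move to the left of the left endmarker. -/
  δ_leftEnd : ∀ q, (δ q Marked.leftEnd).2 ≠ -1
  /-- The head does not move to the right of the right endmarker. -/
  δ_rightEnd : ∀ q, (δ q Marked.rightEnd).2 ≠ 1
  /-- The initial state. -/
  start : Q
  /-- The set of final states. -/
  final : Set Q

/-- The two ends of a word. -/
inductive Side
  | left
  | right

/-- The position from which a word of length `n` is entered at a given end: its first or its last
position. -/
def Side.entry (n : ℕ) : Side → ℕ
  | left => 1
  | right => n

/-- The position at which a word of length `n` is left at a given end. -/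
def Side.exit (n : ℕ) : Side → ℕ
  | left => 0
  | right => n + 1

namespace TwoWayAutomaton

/-- One transition over the tape of `u`.  A configuration is a pair (state, position). -/
def Step {Q A : Type*} (M : TwoWayAutomaton Q A) (u : List A) (c c' : Q × ℕ) : Prop :=
  ∃ a, (markedWord u)[c.2]? = some a ∧ c'.1 = (M.δ c.1 a).1 ∧
    (c'.2 : ℤ) = (c.2 : ℤ) + ((M.δ c.1 a).2 : ℤ)

/-- One transition of a run inside the word `w`: it starts at a position between `1` and `|w|`. -/
def InnerStep {Q A : Type*} (M : TwoWayAutomaton Q A) (w : List A) (c c' : Q × ℕ) : Prop :=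
  1 ≤ c.2 ∧ c.2 ≤ w.length ∧ M.Step w c c'

/-- The four behaviors of a word `w`: the set of the pairs `(p, q)` such that some run which
starts in state `p` at the end `x` of `w` and stays inside `w` leaves `w` at the end `y` in
state `q`.  On the empty word this is the identity for `x ≠ y` and empty for `x = y`. -/
def behavior {Q A : Type*} (M : TwoWayAutomaton Q A) (x y : Side) (w : List A) : Set (Q × Q) :=
  {pq | Relation.ReflTransGen (M.InnerStep w)
    (pq.1, x.entry w.length) (pq.2, y.exit w.length)}

/-- Two words are equivalent if they have the same four behaviors. -/
def BehaviorEquiv {Q A : Type*} (M : TwoWayAutomaton Q A) (w w' : List A) : Prop :=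
  ∀ x y : Side, M.behavior x y w = M.behavior x y w'

section Congruence

variable {Q A : Type*} {M : TwoWayAutomaton Q A}

theorem innerStep_iff {w : List A} {c d : Q × ℕ} :
    M.InnerStep w c d ↔ ∃ k a, c.2 = k + 1 ∧ w[k]? = some a ∧
      d.1 = (M.δ c.1 (Marked.letter a)).1 ∧
      (d.2 : ℤ) = (c.2 : ℤ) + ((M.δ c.1 (Marked.letter a)).2 : ℤ) := by
  constructor
  · rintro ⟨h1, h2, a, ha, h3, h4⟩
    obtain ⟨k, hk⟩ : ∃ k, c.2 = k + 1 := ⟨c.2 - 1, by omega⟩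
    have hkl : k < w.length := by omega
    rw [hk, markedWord, List.getElem?_cons_succ,
      List.getElem?_append_left (by simpa using hkl), List.getElem?_map,
      List.getElem?_eq_getElem hkl] at ha
    simp only [Option.map_some, Option.some.injEq] at ha
    subst ha
    exact ⟨k, w[k], hk, List.getElem?_eq_getElem hkl, h3, h4⟩
  · rintro ⟨k, a, hk, ha, h3, h4⟩
    obtain ⟨hkl, rfl⟩ := List.getElem?_eq_some_iff.1 ha
    refine ⟨by omega, by omega, Marked.letter w[k], ?_, h3, h4⟩
    rw [hk, markedWord, List.getElem?_cons_succ,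
      List.getElem?_append_left (by simpa using hkl), List.getElem?_map,
      List.getElem?_eq_getElem hkl, Option.map_some]

theorem innerStep_near {w : List A} {c d : Q × ℕ} (h : M.InnerStep w c d) :
    1 ≤ c.2 ∧ c.2 ≤ w.length ∧ d.2 ≤ c.2 + 1 ∧ c.2 ≤ d.2 + 1 := by
  obtain ⟨h1, h2, a, -, -, h3⟩ := h
  generalize (M.δ c.1 a).2 = m at h3
  cases m <;> simp at h3 <;> omega

/-- Inner steps only depend on the letter below the head. -/
theorem InnerStep.transfer {w w' : List A} {c d c' d' : Q × ℕ} (h : M.InnerStep w c d)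
    (hc : c'.1 = c.1) (hd : d'.1 = d.1) (h1 : 1 ≤ c'.2)
    (hl : w'[c'.2 - 1]? = w[c.2 - 1]?) (hs : d'.2 + c.2 = d.2 + c'.2) :
    M.InnerStep w' c' d' := by
  rw [innerStep_iff] at h ⊢
  obtain ⟨k, a, hk, ha, h3, h4⟩ := h
  refine ⟨c'.2 - 1, a, by omega, ?_, by rw [hd, hc, h3], by rw [hc]; omega⟩
  rw [hl, hk, Nat.add_sub_cancel, ha]

theorem lift_run {w : List A} (x y : List A) {c d : Q × ℕ}
    (h : Relation.ReflTransGen (M.InnerStep w) c d) :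
    Relation.ReflTransGen (M.InnerStep (x ++ w ++ y))
      (c.1, x.length + c.2) (d.1, x.length + d.2) := by
  induction h with
  | refl => exact .refl
  | @tail b e _ hbe ih =>
    have hn := innerStep_near hbe
    refine ih.tail (hbe.transfer rfl rfl (by simp; omega) ?_ (by simp; omega))
    simp only
    rw [List.getElem?_append_left (by simp; omega), List.getElem?_append_right (by omega)]
    congr 1; omega

/-- Positions of `x w y` seen from the outside of `w`, and the same positions in `x w' y`. -/
inductive Corr (x w w' : List A) : Q × ℕ → Q × ℕ → Prop
  | outLeft (q : Q) (m : ℕ) (h : m ≤ x.length) : Corr x w w' (q, m) (q, m)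
  | outRight (q : Q) (m : ℕ) :
      Corr x w w' (q, x.length + (w.length + 1 + m)) (q, x.length + (w'.length + 1 + m))
  | enter (q : Q) (s : Side) :
      Corr x w w' (q, x.length + s.entry w.length) (q, x.length + s.entry w'.length)

theorem corr_run {x w w' y : List A} (hw : M.BehaviorEquiv w w') {q : Q} {s : Side}
    {c : Q × ℕ}
    (h : Relation.ReflTransGen (M.InnerStep (x ++ w ++ y)) c
      (q, s.exit (x ++ w ++ y).length)) :
    (∀ c', Corr x w w' c c' → Relation.ReflTransGen (M.InnerStep (x ++ w' ++ y)) c'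
        (q, s.exit (x ++ w' ++ y).length)) ∧
    (∀ m, m ≤ w.length + 1 → c.2 = x.length + m → ∃ e t,
      Relation.ReflTransGen (M.InnerStep w) (c.1, m) (e, Side.exit w.length t) ∧
      Relation.ReflTransGen (M.InnerStep (x ++ w' ++ y)) (e, x.length + Side.exit w'.length t)
        (q, s.exit (x ++ w' ++ y).length)) := by
  -- The first claim follows from its `outLeft` and `outRight` cases and the second claim.
  have key : ∀ c : Q × ℕ,
      (c.2 ≤ x.length → Relation.ReflTransGen (M.InnerStep (x ++ w' ++ y)) c
        (q, s.exit (x ++ w' ++ y).length)) →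
      (∀ m, c.2 = x.length + (w.length + 1 + m) →
        Relation.ReflTransGen (M.InnerStep (x ++ w' ++ y))
          (c.1, x.length + (w'.length + 1 + m)) (q, s.exit (x ++ w' ++ y).length)) →
      (∀ m, 1 ≤ m → m ≤ w.length → c.2 = x.length + m → ∃ e t,
        Relation.ReflTransGen (M.InnerStep w) (c.1, m) (e, Side.exit w.length t) ∧
        Relation.ReflTransGen (M.InnerStep (x ++ w' ++ y))
          (e, x.length + Side.exit w'.length t) (q, s.exit (x ++ w' ++ y).length)) →
      (∀ c', Corr x w w' c c' → Relation.ReflTransGen (M.InnerStep (x ++ w' ++ y)) c'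
        (q, s.exit (x ++ w' ++ y).length)) ∧
      (∀ m, m ≤ w.length + 1 → c.2 = x.length + m → ∃ e t,
        Relation.ReflTransGen (M.InnerStep w) (c.1, m) (e, Side.exit w.length t) ∧
        Relation.ReflTransGen (M.InnerStep (x ++ w' ++ y))
          (e, x.length + Side.exit w'.length t) (q, s.exit (x ++ w' ++ y).length)) := by
    intro c h1 h2 h3
    have h4 : ∀ m, m ≤ w.length + 1 → c.2 = x.length + m → ∃ e t,
        Relation.ReflTransGen (M.InnerStep w) (c.1, m) (e, Side.exit w.length t) ∧
        Relation.ReflTransGen (M.InnerStep (x ++ w' ++ y))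
          (e, x.length + Side.exit w'.length t) (q, s.exit (x ++ w' ++ y).length) := by
      intro m hm hcm
      by_cases hm0 : m = 0
      · subst hm0
        refine ⟨c.1, .left, .refl, ?_⟩
        have := h1 (by omega)
        have hc : c = (c.1, x.length + 0) := by rw [← hcm]
        rw [hc] at this
        exact this
      by_cases hm1 : m = w.length + 1
      · subst hm1
        exact ⟨c.1, .right, .refl, h2 0 hcm⟩
      exact h3 m (by omega) (by omega) hcm
    refine ⟨?_, h4⟩
    intro c' hcc'
    cases hcc' with
    | outLeft p m hm => exact h1 hm
    | outRight p m => exact h2 m rfl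
    | enter p r =>
      obtain ⟨e, t, he, hrest⟩ := h4 (r.entry w.length) (by cases r <;> simp [Side.entry]) rfl
      have hmem : (p, e) ∈ M.behavior r t w := he
      rw [hw r t] at hmem
      exact (lift_run x y hmem).trans hrest
  induction h using Relation.ReflTransGen.head_induction_on with
  | refl =>
    apply key
    · intro hle
      cases s with
      | left => exact .refl
      | right => simp [Side.exit] at hle
    · intro m hm
      cases s with
      | left => simp [Side.exit] at hm; omega
      | right =>
        have : m = y.length := by simp [Side.exit] at hm; omega
        subst this
        have : (x ++ w' ++ y).length + 1 = x.length + (w'.length + 1 + y.length) := by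
          simp; omega
        simp only [Side.exit, this]
        exact .refl
    · intro m h1 h2 hm
      cases s <;> simp [Side.exit] at hm <;> omega
  | @head c c₁ hstep _ ih =>
    obtain ⟨ih1, ih2⟩ := ih
    have hn := innerStep_near hstep
    simp only [List.length_append] at hn
    apply key
    · intro hle
      have hstep' : M.InnerStep (x ++ w' ++ y) c c₁ := by
        refine hstep.transfer rfl rfl hn.1 ?_ rfl
        simp only [List.append_assoc]
        rw [List.getElem?_append_left (by omega), List.getElem?_append_left (by omega)]
      refine .head hstep' (ih1 c₁ ?_)
      by_cases hc₁ : c₁.2 ≤ x.length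
      · exact .outLeft c₁.1 c₁.2 hc₁
      · have : c₁ = (c₁.1, x.length + 1) := Prod.ext rfl (by simp; omega)
        rw [this]
        exact .enter c₁.1 .left
    · intro m hm
      have hstep' : M.InnerStep (x ++ w' ++ y) (c.1, x.length + (w'.length + 1 + m))
          (c₁.1, x.length + w'.length + (c₁.2 - (x.length + w.length))) := by
        refine hstep.transfer rfl rfl (by simp; omega) ?_ (by simp; omega)
        simp only
        rw [List.getElem?_append_right (by simp; omega),
          List.getElem?_append_right (by simp; omega)]
        congr 1; simp; omega
      refine .head hstep' (ih1 _ ?_)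
      by_cases hc₁ : c₁.2 = x.length + w.length
      · have e1 : c₁ = (c₁.1, x.length + w.length) := Prod.ext rfl hc₁
        have e2 : x.length + w'.length + (c₁.2 - (x.length + w.length))
          = x.length + w'.length := by omega
        rw [e2]
        rw [show Corr x w w' c₁ = Corr x w w' (c₁.1, x.length + w.length) from
          congrArg _ e1]
        exact .enter c₁.1 .right
      · obtain ⟨j, hj⟩ : ∃ j, c₁.2 = x.length + (w.length + 1 + j) :=
          ⟨c₁.2 - (x.length + w.length + 1), by omega⟩
        have e1 : c₁ = (c₁.1, x.length + (w.length + 1 + j)) := Prod.ext rfl hj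
        have e2 : x.length + w'.length + (c₁.2 - (x.length + w.length))
          = x.length + (w'.length + 1 + j) := by omega
        rw [e2]
        rw [show Corr x w w' c₁ = Corr x w w' (c₁.1, x.length + (w.length + 1 + j)) from
          congrArg _ e1]
        exact .outRight c₁.1 j
    · intro m h1 h2 hm
      obtain ⟨e, t, he, hrest⟩ := ih2 (c₁.2 - x.length) (by omega) (by omega)
      refine ⟨e, t, .head ?_ he, hrest⟩
      refine hstep.transfer rfl rfl h1 ?_ (by simp; omega)
      simp only
      rw [List.getElem?_append_left (by simp; omega), List.getElem?_append_right (by omega)]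
      congr 1; omega

theorem BehaviorEquiv.context {w w' : List A} (hw : M.BehaviorEquiv w w') (x y : List A) :
    M.BehaviorEquiv (x ++ w ++ y) (x ++ w' ++ y) := by
  have main : ∀ {w w' : List A}, M.BehaviorEquiv w w' → ∀ r s,
      M.behavior r s (x ++ w ++ y) ⊆ M.behavior r s (x ++ w' ++ y) := by
    intro w w' hw r s
    rintro ⟨p, q⟩ hpq
    refine (corr_run hw hpq).1 _ ?_
    simp only
    cases r with
    | left =>
      by_cases hx : x.length = 0
      · have := Corr.enter (x := x) (w := w) (w' := w') p .left
        simpa [Side.entry, hx] using this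
      · exact .outLeft p 1 (by omega)
    | right =>
      rcases Nat.eq_zero_or_pos y.length with hy | hy
      · have := Corr.enter (x := x) (w := w) (w' := w') p .right
        simpa [Side.entry, hy] using this
      · obtain ⟨j, hj⟩ : ∃ j, y.length = j + 1 := ⟨y.length - 1, by omega⟩
        have := Corr.outRight (x := x) (w := w) (w' := w') p j
        convert this using 2 <;> simp [Side.entry, hj] <;> omega
  exact fun r s => Set.Subset.antisymm (main hw r s) (main (fun a b => (hw a b).symm) r s)

end Congruence

/-- The congruence on the free monoid over `A` that identifies words with the same behaviors. -/
def transitionCon {Q A : Type*} (M : TwoWayAutomaton Q A) : Con (FreeMonoid A) where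
  r u v := M.BehaviorEquiv u.toList v.toList
  iseqv :=
    ⟨fun _ _ _ => rfl, fun h x y => (h x y).symm, fun h h' x y => (h x y).trans (h' x y)⟩
  mul' := by
    intro u u' v v' hu hv x y
    have h1 := hu.context [] v.toList
    have h2 := hv.context u'.toList []
    simp only [List.nil_append, List.append_nil] at h1 h2
    exact (h1 x y).trans (h2 x y)

/-- The transition monoid of a two-way automaton. -/
abbrev TransitionMonoid {Q A : Type*} (M : TwoWayAutomaton Q A) : Type _ :=
  M.transitionCon.Quotient

end TwoWayAutomaton

/-- A deterministic two-way transducer with set of states `Q`, input alphabet `A` and output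
alphabet `B`: a two-way automaton, called its input automaton, with a production function. -/
structure TwoWayTransducer (Q A B : Type*) extends TwoWayAutomaton Q A where
  /-- The production function. -/
  γ : Q → Marked A → List B

namespace TwoWayTransducer

/-- A transducer is aperiodic if the transition monoid of its input automaton is aperiodic. -/
def IsAperiodic {Q A B : Type*} (T : TwoWayTransducer Q A B) : Prop :=
  IsAperiodicMonoid T.toTwoWayAutomaton.TransitionMonoid

/-- One transition over the tape of `u`, with its production `v`. -/
def Step {Q A B : Type*} (T : TwoWayTransducer Q A B) (u : List A)
    (c : Q × ℕ) (v : List B) (c' : Q × ℕ) : Prop :=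
  ∃ a, (markedWord u)[c.2]? = some a ∧ c'.1 = (T.δ c.1 a).1 ∧
    (c'.2 : ℤ) = (c.2 : ℤ) + ((T.δ c.1 a).2 : ℤ) ∧ v = T.γ c.1 a

/-- The accepting configurations over `u`: a final state on the right endmarker. -/
def IsAccepting {Q A B : Type*} (T : TwoWayTransducer Q A B) (u : List A) (c : Q × ℕ) : Prop :=
  c.1 ∈ T.final ∧ c.2 = u.length + 1

/-- `v` is the image of `u`: the production of the run that starts in the initial state on the
left endmarker and that ends, when it reaches an accepting configuration. -/
def IsImage {Q A B : Type*} (T : TwoWayTransducer Q A B) (u : List A) (v : List B) : Prop :=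
  ∃ π d, Run (fun c v c' => ¬ T.IsAccepting u c ∧ T.Step u c v c') (T.start, 0) π v d ∧
    T.IsAccepting u d

end TwoWayTransducer

/-! ### Two-way transducers with star-free look-around -/

/-- A transition `(q, (Lp, a, Ls), q', v, m)`. -/
structure LookAroundTransition (Q A B : Type*) where
  /-- The source state. -/
  source : Q
  /-- The language of the test on the prefix. -/
  pre : Language (Marked A)
  /-- The letter of the test. -/
  letter : Marked A
  /-- The language of the test on the suffix. -/
  suf : Language (Marked A)
  /-- The target state. -/
  target : Q
  /-- The production. -/
  output : List B
  /-- The move of the head. -/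
  move : SignType

/-- The test of the transition is satisfied on the tape of `u` with the head at position `i`: the
position carries the letter of the test, and the parts of the tape strictly to the left and
strictly to the right of the head belong to the two languages. -/
def LookAroundTransition.Satisfied {Q A B : Type*} (τ : LookAroundTransition Q A B)
    (u : List A) (i : ℕ) : Prop :=
  (markedWord u).take i ∈ τ.pre ∧ (markedWord u)[i]? = some τ.letter ∧
    (markedWord u).drop (i + 1) ∈ τ.suf

/-- A two-way transducer with star-free look-around, with set of states `Q`, input alphabet `A`
and output alphabet `B`. -/
structure StarFreeTransducer (Q A B : Type*) where
  /-- The set of transitions. -/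
  Δ : Set (LookAroundTransition Q A B)
  finite_Δ : Δ.Finite
  starFree_pre : ∀ τ ∈ Δ, IsStarFree τ.pre
  starFree_suf : ∀ τ ∈ Δ, IsStarFree τ.suf
  /-- The initial state. -/
  start : Q
  /-- The set of final states. -/
  final : Set Q

/-- Select in a path the pairs whose position occurs in the sequence `I`, and replace the position
by its index in `I`. -/
def projectPath {Q : Type*} (I : List ℕ) (π : List (Q × ℕ)) : List (Q × ℕ) :=
  (π.filter fun c => c.2 ∈ I).map fun c => (c.1, I.idxOf c.2)

/-- The positions of `v` and of `w` in the word `v u w`, in increasing order. -/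
def contextPositions {A : Type*} (v u w : List A) : List ℕ :=
  List.range' 1 v.length ++ List.range' (v.length + u.length + 1) w.length

/-- The word `u ^ n`. -/
def wordPow {A : Type*} (u : List A) (n : ℕ) : List A :=
  (List.replicate n u).flatten

namespace StarFreeTransducer

/-- The transducer is deterministic if the tests performed in a given state are mutually
exclusive. -/
def IsDeterministic {Q A B : Type*} (T : StarFreeTransducer Q A B) : Prop :=
  ∀ τ ∈ T.Δ, ∀ τ' ∈ T.Δ, τ.source = τ'.source → τ ≠ τ' →
    ∀ (u : List A) (i : ℕ), ¬ (τ.Satisfied u i ∧ τ'.Satisfied u i)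

/-- One transition over the tape of `u`, with its production `v`. -/
def Step {Q A B : Type*} (T : StarFreeTransducer Q A B) (u : List A)
    (c : Q × ℕ) (v : List B) (c' : Q × ℕ) : Prop :=
  ∃ τ ∈ T.Δ, τ.source = c.1 ∧ τ.Satisfied u c.2 ∧ c'.1 = τ.target ∧
    (c'.2 : ℤ) = (c.2 : ℤ) + (τ.move : ℤ) ∧ v = τ.output

/-- The accepting configurations over `u`: a final state on the right endmarker. -/
def IsAccepting {Q A B : Type*} (T : StarFreeTransducer Q A B) (u : List A) (c : Q × ℕ) : Prop :=
  c.1 ∈ T.final ∧ c.2 = u.length + 1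

/-- `π` is the path and `v` is the production of the accepting run over `u`: the run that starts
in the initial state on the left endmarker and that ends when it reaches an accepting
configuration. -/
def IsAcceptingRun {Q A B : Type*} (T : StarFreeTransducer Q A B) (u : List A)
    (π : List (Q × ℕ)) (v : List B) : Prop :=
  ∃ d, Run (fun c v c' => ¬ T.IsAccepting u c ∧ T.Step u c v c') (T.start, 0) π v d ∧
    T.IsAccepting u d

/-- `v` is the image of `u`. -/
def IsImage {Q A B : Type*} (T : StarFreeTransducer Q A B) (u : List A) (v : List B) : Prop :=
  ∃ π, T.IsAcceptingRun u π v

/-- `ρ` is the context path of `v u w`: the projection of the accepting path over `v u w` to the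
positions of `v` and `w`.  There is none if `v u w` is not accepted. -/
def IsContextPath {Q A B : Type*} (T : StarFreeTransducer Q A B) (v u w : List A)
    (ρ : List (Q × ℕ)) : Prop :=
  ∃ π o, T.IsAcceptingRun (v ++ u ++ w) π o ∧ ρ = projectPath (contextPositions v u w) π

/-- The transducer is aperiodic if, for some positive integer `n`, the words `u ^ n` and
`u ^ (n + 1)` have the same context path in every context `v`, `w` (in particular, both or none
of the two context paths exist). -/
def IsAperiodic {Q A B : Type*} (T : StarFreeTransducer Q A B) : Prop :=
  ∃ n : ℕ, 0 < n ∧ ∀ (u v w : List A) (ρ : List (Q × ℕ)),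
    T.IsContextPath v (wordPow u n) w ρ ↔ T.IsContextPath v (wordPow u (n + 1)) w ρ

end StarFreeTransducer

/-!
The look-around of a deterministic aperiodic two-way transducer `T` is removed in two stages.

**An aperiodic transducer over annotated words.** By induction on star-free expressions
(`IsStarFree.exists_invariant`), the tests of `T` depend only on the values of the two parts of the
tape under some invariant `ψ` with an aperiodic quotient monoid. It is not enough to annotate each
letter `a` of the input `v a w` with the values of `v` and `w` under `ψ`, as the resulting
transducer, run from arbitrary states, need not be aperiodic: aperiodicity of `T` only speaks of
accepting paths. Whether the accepting path over `v a w` visits `a` in state `q` is a regular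
property, recognized by a two-way automaton (`visitAutomaton`), so that it is determined by
finitely many values; and since `T` is aperiodic, powers of a word are eventually equivalent for
this property. Hence there is an aperiodic invariant `φ` with finitely many values, finer than `ψ`,
whose values on `v` and `w` determine these visits (`exists_visit_invariant`).

The transducer `guarded` reads words with the values of `φ` (`bimark`). It simulates `T`, and it
dies as soon as the configuration is not on an accepting path, or the annotations of the letters on
the two sides of a boundary disagree. It realizes the same function (`guarded_isImage`), and it is
aperiodic (`guarded_isAperiodic`): if the square of a word `z` over the extended alphabet has
annotations that disagree, no run crosses this square and it hides whatever is beyond it; otherwise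
each power of `z` is the annotation of a power of some `u` in a context `p`, `s` that does not
depend on the exponent, and its runs are pieces of accepting paths of `T`. Such a piece is
described by the order in which the accepting path visits positions in the outer copies of `u` and
next to them (`within_wordPow`), and context paths determine this order (`before_of_samePos`).

**Elimination of the annotation.** The annotation is computed by a one-way automaton with an
aperiodic monoid from left to right, followed by one from right to left. Such an automaton is a
cascade of registers (`cascade_annot`, the aperiodic case of the Krohn–Rhodes theorem). A two-way
transducer can do without a register, as it can keep the value in its state: when it moves to the
left onto a letter that sets the register, it finds the earlier value by walking to the left to the
preceding letter that sets the register, and the next letter of this kind on its way back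
tells where it came from (`TwoWayTransducer.elimReg`); this preserves aperiodicity
(`TwoWayTransducer.elimReg_isAperiodic`). Passes from right to left are treated by mirror images.
-/

universe u v w

/-! ### Deterministic runs -/

section Deterministic

open Relation

variable {C : Type*} {r : C → C → Prop}

/-- A deterministic run that stops makes the run relation well-founded below its start.  Induction
along this relation replaces counting the steps of a run. -/
theorem acc_transGen_of_stops (hr : Relator.RightUnique r) {c d : C} (hd : ∀ e, ¬ r d e)
    (h : ReflTransGen r c d) : Acc (fun y x => TransGen r x y) c := by
  induction h using ReflTransGen.head_induction_on with
  | refl =>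
    refine ⟨_, fun y hy => ?_⟩
    obtain ⟨e, he, -⟩ := TransGen.head'_iff.1 hy
    exact absurd he (hd e)
  | head hc _ ih =>
    refine ⟨_, fun y hy => ?_⟩
    obtain ⟨e, he, hey⟩ := TransGen.head'_iff.1 hy
    rw [hr he hc] at hey
    rcases reflTransGen_iff_eq_or_transGen.1 hey with h | h
    · exact h ▸ ih
    · exact ih.inv h

theorem Relation.ReflTransGen.map {C' : Type*} {r' : C' → C' → Prop} (f : C → C')
    (h : ∀ c d, r c d → r' (f c) (f d)) {c d : C} (hr : ReflTransGen r c d) :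
    ReflTransGen r' (f c) (f d) :=
  ReflTransGen.lift f (fun c d => h c d) _ _ hr

theorem reach_stop_of_reach (hr : Relator.RightUnique r) {c d e : C} (hd : ∀ e, ¬ r d e)
    (h : ReflTransGen r c d) (h' : ReflTransGen r c e) : ReflTransGen r e d := by
  rcases ReflTransGen.total_of_right_unique hr h h' with h1 | h1
  · rcases ReflTransGen.cases_head h1 with h2 | ⟨f, hf, -⟩
    · exact h2 ▸ .refl
    · exact absurd hf (hd f)
  · exact h1

theorem stop_unique (hr : Relator.RightUnique r) {c d e : C} (hd : ∀ e, ¬ r d e)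
    (he : ∀ f, ¬ r e f) (h : ReflTransGen r c d) (h' : ReflTransGen r c e) : e = d := by
  rcases ReflTransGen.cases_head (reach_stop_of_reach hr hd h h') with h2 | ⟨f, hf, -⟩
  · exact h2
  · exact absurd hf (he f)

theorem not_transGen_self_of_stops (hr : Relator.RightUnique r) {c d : C} (hd : ∀ e, ¬ r d e)
    (h : ReflTransGen r c d) : ¬ TransGen r c c := by
  have hacc := acc_transGen_of_stops hr hd h
  induction hacc with
  | intro c _ ih => exact fun hc => ih c hc h hc

end Deterministic

section Produce

open Relation

variable {C C' B : Type*} {step : C → List B → C → Prop} {step' : C' → List B → C' → Prop}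

/-- `Produces step c v d`: some run from `c` to `d` has production `v`. -/
def Produces (step : C → List B → C → Prop) (c : C) (v : List B) (d : C) : Prop :=
  ∃ π, Run step c π v d

theorem Produces.refl (c : C) : Produces step c [] c := ⟨_, .refl c⟩

theorem Produces.head {c d e : C} {v w : List B} (h : step c v d) (h' : Produces step d w e) :
    Produces step c (v ++ w) e :=
  let ⟨_, hπ⟩ := h'
  ⟨_, .cons h hπ⟩

theorem Produces.induction {e : C} {P : C → List B → Prop} (refl : P e [])
    (head : ∀ c d v w, step c v d → Produces step d w e → P d w → P c (v ++ w))
    {c : C} {v : List B} (h : Produces step c v e) : P c v := by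
  obtain ⟨π, h⟩ := h
  induction h with
  | refl => exact refl
  | cons hs hr ih => exact head _ _ _ _ hs ⟨_, hr⟩ (ih refl head)

theorem Produces.trans {c d e : C} {v w : List B} (h : Produces step c v d)
    (h' : Produces step d w e) : Produces step c (v ++ w) e := by
  revert h'
  refine h.induction (P := fun c v => Produces step d w e → Produces step c (v ++ w) e) ?_ ?_
  · exact id
  · intro c d v w' hs _ ih h'
    rw [List.append_assoc]
    exact (ih h').head hs

theorem Produces.reflTransGen {c d : C} {v : List B} (h : Produces step c v d) :
    ReflTransGen (fun c d => ∃ v, step c v d) c d :=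
  h.induction (P := fun c _ => ReflTransGen _ c d) .refl fun _ _ v _ hs _ ih => .head ⟨v, hs⟩ ih

theorem produces_nil_of_reflTransGen {r : C → C → Prop} (hr : ∀ c d, r c d → step c [] d) {c d : C}
    (h : ReflTransGen r c d) : Produces step c [] d := by
  induction h using ReflTransGen.head_induction_on with
  | refl => exact .refl _
  | head hs _ ih => exact ih.head (hr _ _ hs)

theorem Produces.simulate (R : C → C' → Prop)
    (h : ∀ c v d c', R c c' → step c v d → ∃ d', R d d' ∧ Produces step' c' v d')
    {c d : C} {v : List B} (hp : Produces step c v d) :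
    ∀ c', R c c' → ∃ d', R d d' ∧ Produces step' c' v d' := by
  refine hp.induction (P := fun c v => ∀ c', R c c' → ∃ d', R d d' ∧ Produces step' c' v d') ?_ ?_
  · exact fun c' hc => ⟨c', hc, .refl c'⟩
  · intro c d v w hs _ ih c' hc
    obtain ⟨d', hd, hp⟩ := h c v d c' hc hs
    obtain ⟨e', he, hp'⟩ := ih d' hd
    exact ⟨e', he, hp.trans hp'⟩

theorem Produces.output_unique
    (hdet : ∀ c v d v' d', step c v d → step c v' d' → v = v' ∧ d = d') {c d d' : C}
    {v v' : List B} (hd : ∀ w e, ¬ step d w e) (hd' : ∀ w e, ¬ step d' w e)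
    (h : Produces step c v d) (h' : Produces step c v' d') : v = v' := by
  revert v'
  refine h.induction (P := fun c v => ∀ {v'}, Produces step c v' d' → v = v') ?_ ?_
  · rintro v' ⟨π, h'⟩
    cases h' with
    | refl => rfl
    | cons hs => exact absurd hs (hd _ _)
  · rintro c e v w hs _ ih v' ⟨π, h'⟩
    cases h' with
    | refl => exact absurd hs (hd' _ _)
    | cons hs' hr =>
      obtain ⟨rfl, rfl⟩ := hdet _ _ _ _ _ hs hs'
      rw [ih ⟨_, hr⟩]

end Produce

/-! ### Powers of words and aperiodic automata -/

theorem wordPow_zero {A : Type*} (u : List A) : wordPow u 0 = [] := rfl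

theorem wordPow_succ {A : Type*} (u : List A) (n : ℕ) : wordPow u (n + 1) = u ++ wordPow u n := by
  simp [wordPow, List.replicate_succ]

theorem wordPow_add {A : Type*} (u : List A) (m n : ℕ) :
    wordPow u (m + n) = wordPow u m ++ wordPow u n := by
  simp only [wordPow, List.replicate_add, List.flatten_append]

theorem wordPow_one {A : Type*} (u : List A) : wordPow u 1 = u := by
  simp [wordPow]

theorem wordPow_succ' {A : Type*} (u : List A) (n : ℕ) : wordPow u (n + 1) = wordPow u n ++ u := by
  rw [wordPow_add, wordPow_one]

theorem wordPow_map {A A' : Type*} (f : A → A') (u : List A) (n : ℕ) :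
    (wordPow u n).map f = wordPow (u.map f) n := by
  simp [wordPow]

theorem wordPow_reverse {A : Type*} (u : List A) (n : ℕ) :
    (wordPow u n).reverse = wordPow u.reverse n := by
  induction n with
  | zero => rfl
  | succ n ih => rw [wordPow_succ, List.reverse_append, ih, wordPow_succ']

theorem wordPow_nil {A : Type*} (n : ℕ) : wordPow ([] : List A) n = [] := by
  simp [wordPow]

theorem mem_wordPow {A : Type*} {u : List A} {n : ℕ} {a : A} (h : a ∈ wordPow u n) : a ∈ u := by
  obtain ⟨l, hl, ha⟩ := List.mem_flatten.1 h
  rwa [List.eq_of_mem_replicate hl] at ha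

namespace TwoWayAutomaton

open Relation

variable {Q Q' A A' : Type*}

theorem BehaviorEquiv.rfl {M : TwoWayAutomaton Q A} {w : List A} : M.BehaviorEquiv w w :=
  fun _ _ => Eq.refl _

theorem BehaviorEquiv.symm {M : TwoWayAutomaton Q A} {w w' : List A} (h : M.BehaviorEquiv w w') :
    M.BehaviorEquiv w' w := fun x y => (h x y).symm

theorem innerStep_rightUnique (M : TwoWayAutomaton Q A) (w : List A) :
    Relator.RightUnique (M.InnerStep w) := by
  intro c d e hd he
  rw [innerStep_iff] at hd he
  obtain ⟨k, a, hk, ha, h1, h2⟩ := hd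
  obtain ⟨k', a', hk', ha', h1', h2'⟩ := he
  obtain rfl : k = k' := by omega
  obtain rfl : a = a' := by simpa [ha] using ha'
  exact Prod.ext (h1.trans h1'.symm) (by omega)

theorem not_innerStep_exit (M : TwoWayAutomaton Q A) (w : List A) (q : Q) (y : Side)
    (d : Q × ℕ) : ¬ M.InnerStep w (q, y.exit w.length) d := by
  rintro ⟨h1, h2, -⟩
  cases y <;> simp [Side.exit] at h1 h2

/-- Every position inside a word has a next configuration. -/
theorem exists_innerStep (M : TwoWayAutomaton Q A) {w : List A} {c : Q × ℕ} (h1 : 1 ≤ c.2)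
    (h2 : c.2 ≤ w.length) : ∃ d, M.InnerStep w c d := by
  obtain ⟨k, hk⟩ : ∃ k, c.2 = k + 1 := ⟨c.2 - 1, by omega⟩
  have hkl : k < w.length := by omega
  refine ⟨((M.δ c.1 (.letter w[k])).1, ((c.2 : ℤ) + ((M.δ c.1 (.letter w[k])).2 : ℤ)).toNat), ?_⟩
  rw [innerStep_iff]
  refine ⟨k, w[k], hk, List.getElem?_eq_getElem hkl, by simp, ?_⟩
  simp only
  cases (M.δ c.1 (.letter w[k])).2 <;> simp
  omega

/-- Aperiodicity of the transition monoid, in terms of words. -/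
theorem isAperiodicMonoid_iff (M : TwoWayAutomaton Q A) :
    IsAperiodicMonoid M.TransitionMonoid ↔
      ∃ n, ∀ w : List A, M.BehaviorEquiv (wordPow w n) (wordPow w (n + 1)) := by
  have hcoe : ∀ (w : FreeMonoid A) n,
      ((w ^ n : FreeMonoid A) : M.transitionCon.Quotient) = (w : M.transitionCon.Quotient) ^ n :=
    fun w n => map_pow M.transitionCon.mk' w n
  have hpow : ∀ (w : FreeMonoid A) n, (w ^ n).toList = wordPow w.toList n := by
    intro w n
    induction n with
    | zero => rfl
    | succ n ih => rw [pow_succ', FreeMonoid.toList_mul, ih, wordPow_succ]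
  refine exists_congr fun n => ⟨fun h w => ?_, fun h x => ?_⟩
  · have := h ((FreeMonoid.ofList w : FreeMonoid A) : M.transitionCon.Quotient)
    rw [← hcoe, ← hcoe, Con.eq] at this
    change M.BehaviorEquiv _ _ at this
    rwa [hpow, hpow] at this
  · induction x using Con.induction_on with
    | H w =>
      rw [← hcoe, ← hcoe, Con.eq]
      change M.BehaviorEquiv _ _
      rw [hpow, hpow]
      exact h w.toList

theorem behaviorEquiv_wordPow_of_le {M : TwoWayAutomaton Q A} {w : List A} {n m : ℕ} (hnm : n ≤ m)
    (h : M.BehaviorEquiv (wordPow w n) (wordPow w (n + 1))) :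
    M.BehaviorEquiv (wordPow w m) (wordPow w (m + 1)) := by
  obtain ⟨k, rfl⟩ := Nat.exists_eq_add_of_le hnm
  have := h.context [] (wordPow w k)
  rw [List.nil_append, List.nil_append, ← wordPow_add, ← wordPow_add] at this
  rwa [show n + k + 1 = n + 1 + k by omega]

end TwoWayAutomaton

/-! ### Mirror images -/

/-- Exchange the two endmarkers. -/
def Marked.mirror {A : Type*} : Marked A → Marked A
  | leftEnd => rightEnd
  | letter a => letter a
  | rightEnd => leftEnd

theorem Marked.mirror_mirror {A : Type*} (x : Marked A) : x.mirror.mirror = x := by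
  cases x <;> rfl

theorem map_mirror_reverse_markedWord {A : Type*} (u : List A) :
    ((markedWord u).map Marked.mirror).reverse = markedWord u.reverse := by
  simp [markedWord, Marked.mirror, Function.comp_def]

theorem length_markedWord {A : Type*} (u : List A) : (markedWord u).length = u.length + 2 := by
  simp [markedWord]

theorem getElem?_markedWord_reverse {A : Type*} {u : List A} {i : ℕ} {x : Marked A}
    (h : (markedWord u)[i]? = some x) :
    (markedWord u.reverse)[u.length + 1 - i]? = some x.mirror := by
  obtain ⟨hi, hx⟩ := List.getElem?_eq_some_iff.1 h
  rw [length_markedWord] at hi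
  rw [← map_mirror_reverse_markedWord, List.getElem?_reverse (by simp [length_markedWord]; omega)]
  simp only [List.length_map, length_markedWord, List.getElem?_map]
  rw [show u.length + 2 - 1 - (u.length + 1 - i) = i by omega, h]
  rfl

/-- The opposite end of a word. -/
def Side.flip : Side → Side
  | left => right
  | right => left

theorem Side.flip_flip (x : Side) : x.flip.flip = x := by
  cases x <;> rfl

namespace TwoWayAutomaton

open Relation

variable {Q A : Type*}

/-- The automaton that moves in the opposite directions, on the mirror image of the tape. -/
def mirror (M : TwoWayAutomaton Q A) : TwoWayAutomaton Q A where
  δ q x := ((M.δ q x.mirror).1, -(M.δ q x.mirror).2)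
  δ_leftEnd q h := M.δ_rightEnd q (by
    simpa [Marked.mirror] using congrArg (- ·) h)
  δ_rightEnd q h := M.δ_leftEnd q (by
    simpa [Marked.mirror] using congrArg (- ·) h)
  start := M.start
  final := M.final

theorem mirror_mirror (M : TwoWayAutomaton Q A) : M.mirror.mirror = M := by
  cases M
  simp [mirror, Marked.mirror_mirror]

theorem InnerStep.mirror {M : TwoWayAutomaton Q A} {w : List A} {c d : Q × ℕ}
    (h : M.InnerStep w c d) :
    M.mirror.InnerStep w.reverse (c.1, w.length + 1 - c.2) (d.1, w.length + 1 - d.2) := by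
  have hn := innerStep_near h
  rw [innerStep_iff] at h ⊢
  obtain ⟨k, a, hk, ha, h1, h2⟩ := h
  refine ⟨w.length - c.2, a, by simp only; omega, ?_, h1, ?_⟩
  · rw [List.getElem?_reverse (by omega), ← ha]
    congr 1
    omega
  · simp only [TwoWayAutomaton.mirror, Marked.mirror, SignType.coe_neg]
    omega

theorem behavior_subset_mirror (M : TwoWayAutomaton Q A) (x y : Side) (w : List A) :
    M.behavior x y w ⊆ M.mirror.behavior x.flip y.flip w.reverse := by
  intro pq h
  have := ReflTransGen.map (r' := M.mirror.InnerStep w.reverse)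
    (fun c : Q × ℕ => (c.1, w.length + 1 - c.2)) (fun c d hcd => hcd.mirror) h
  simp only [behavior, Set.mem_ofPred_eq, List.length_reverse]
  convert this using 2
  · cases x <;> simp [Side.entry, Side.flip]
  · cases y <;> simp [Side.exit, Side.flip]

theorem behavior_mirror (M : TwoWayAutomaton Q A) (x y : Side) (w : List A) :
    M.mirror.behavior x.flip y.flip w.reverse = M.behavior x y w := by
  refine Set.Subset.antisymm ?_ (M.behavior_subset_mirror x y w)
  have := M.mirror.behavior_subset_mirror x.flip y.flip w.reverse
  rwa [mirror_mirror, Side.flip_flip, Side.flip_flip, List.reverse_reverse] at this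

theorem isAperiodicMonoid_mirror {M : TwoWayAutomaton Q A}
    (h : IsAperiodicMonoid M.TransitionMonoid) :
    IsAperiodicMonoid M.mirror.TransitionMonoid := by
  rw [isAperiodicMonoid_iff] at h ⊢
  obtain ⟨n, hn⟩ := h
  have hb : ∀ x y (w : List A), M.mirror.behavior x y w = M.behavior x.flip y.flip w.reverse := by
    intro x y w
    rw [← M.mirror.behavior_mirror, mirror_mirror]
  refine ⟨n, fun w x y => ?_⟩
  rw [hb, hb, wordPow_reverse, wordPow_reverse]
  exact hn _ _ _

end TwoWayAutomaton

namespace TwoWayTransducer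

open Relation

variable {Q P A A' B : Type*}

/-- The mirror image of a transducer. -/
def mirror (T : TwoWayTransducer Q A B) : TwoWayTransducer Q A B where
  toTwoWayAutomaton := T.toTwoWayAutomaton.mirror
  γ q x := T.γ q x.mirror

theorem isAperiodic_mirror {T : TwoWayTransducer Q A B} (h : T.IsAperiodic) :
    T.mirror.IsAperiodic :=
  TwoWayAutomaton.isAperiodicMonoid_mirror h

theorem Step.near {T : TwoWayTransducer Q A B} {u : List A} {c d : Q × ℕ} {v : List B}
    (h : T.Step u c v d) :
    c.2 ≤ u.length + 1 ∧ d.2 ≤ u.length + 1 := by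
  obtain ⟨a, ha, -, h2, -⟩ := h
  obtain ⟨hi, hx⟩ := List.getElem?_eq_some_iff.1 ha
  rw [length_markedWord] at hi
  refine ⟨by omega, ?_⟩
  have hm : ∀ m : SignType, (d.2 : ℤ) = (c.2 : ℤ) + (m : ℤ) → d.2 ≤ c.2 + 1 := by
    intro m hm
    cases m <;> simp at hm <;> omega
  have := hm _ h2
  by_cases hc : c.2 = u.length + 1
  · have : a = .rightEnd := by
      rw [← hx]
      simp [markedWord, hc]
    have hr := T.δ_rightEnd c.1
    rw [← this] at hr
    have hm' : ∀ m : SignType, m ≠ 1 → (d.2 : ℤ) = (c.2 : ℤ) + (m : ℤ) → d.2 ≤ c.2 := by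
      intro m hm1 hm
      cases m <;> simp at hm hm1 <;> omega
    have := hm' _ hr h2
    omega
  · omega

theorem Step.mirror {T : TwoWayTransducer Q A B} {u : List A} {c d : Q × ℕ} {v : List B}
    (h : T.Step u c v d) :
    T.mirror.Step u.reverse (c.1, u.length + 1 - c.2) v (d.1, u.length + 1 - d.2) := by
  obtain ⟨h1, h2⟩ := h.near
  obtain ⟨a, ha, h3, h4, rfl⟩ := h
  refine ⟨a.mirror, getElem?_markedWord_reverse ha, ?_, ?_, ?_⟩
  · simp [TwoWayTransducer.mirror, TwoWayAutomaton.mirror, Marked.mirror_mirror, h3]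
  · simp only [TwoWayTransducer.mirror, TwoWayAutomaton.mirror, Marked.mirror_mirror,
      SignType.coe_neg]
    omega
  · simp [TwoWayTransducer.mirror, Marked.mirror_mirror]

theorem step_det {T : TwoWayTransducer Q A B} {u : List A} {c d d' : Q × ℕ} {v v' : List B}
    (h : T.Step u c v d) (h' : T.Step u c v' d') : v = v' ∧ d = d' := by
  obtain ⟨a, ha, h1, h2, h3⟩ := h
  obtain ⟨a', ha', h1', h2', h3'⟩ := h'
  obtain rfl : a = a' := by simpa [ha] using ha'
  exact ⟨h3.trans h3'.symm, Prod.ext (h1.trans h1'.symm) (by omega)⟩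

/-- A step of a run towards acceptance: such a run does not go on after acceptance. -/
def LiveStep (T : TwoWayTransducer Q A B) (u : List A) (c : Q × ℕ) (v : List B) (d : Q × ℕ) :
    Prop :=
  ¬ T.IsAccepting u c ∧ T.Step u c v d

theorem isImage_iff {T : TwoWayTransducer Q A B} {u : List A} {v : List B} :
    T.IsImage u v ↔ ∃ d, Produces (T.LiveStep u) (T.start, 0) v d ∧ T.IsAccepting u d := by
  constructor
  · rintro ⟨π, d, h, hd⟩
    exact ⟨d, ⟨π, h⟩, hd⟩
  · rintro ⟨d, ⟨π, h⟩, hd⟩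
    exact ⟨π, d, h, hd⟩

theorem liveStep_det {T : TwoWayTransducer Q A B} {u : List A} (c : Q × ℕ) (v : List B)
    (d : Q × ℕ) (v' : List B) (d' : Q × ℕ) (h : T.LiveStep u c v d) (h' : T.LiveStep u c v' d') :
    v = v' ∧ d = d' :=
  step_det h.2 h'.2

theorem liveStep_rightUnique (T : TwoWayTransducer Q A B) (u : List A) :
    Relator.RightUnique fun c d => ∃ v, T.LiveStep u c v d :=
  fun _ _ _ ⟨_, h⟩ ⟨_, h'⟩ => (step_det h.2 h'.2).2

/-- The run of a two-way transducer never gets stuck. -/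
theorem exists_step (T : TwoWayTransducer Q A B) {u : List A} {c : Q × ℕ}
    (h : c.2 ≤ u.length + 1) : ∃ v d, T.Step u c v d := by
  have hc : c.2 < (markedWord u).length := by rw [length_markedWord]; omega
  refine ⟨_, ((T.δ c.1 (markedWord u)[c.2]).1,
    ((c.2 : ℤ) + ((T.δ c.1 (markedWord u)[c.2]).2 : ℤ)).toNat),
    (markedWord u)[c.2], List.getElem?_eq_getElem hc, rfl, ?_, rfl⟩
  by_cases h0 : c.2 = 0
  · have := T.δ_leftEnd c.1
    have he : (markedWord u)[c.2] = Marked.leftEnd := by simp [markedWord, h0]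
    rw [he]
    simp only
    generalize (T.δ c.1 Marked.leftEnd).2 = m at *
    cases m <;> simp at this ⊢
  · simp only
    generalize (T.δ c.1 (markedWord u)[c.2]).2 = m at *
    cases m <;> simp
    omega

/-- Rename the letters read by a transducer. -/
def comapLetters (f : A → A') (T : TwoWayTransducer Q A' B) : TwoWayTransducer Q A B where
  δ q x := T.δ q (match x with
    | .leftEnd => .leftEnd | .letter a => .letter (f a) | .rightEnd => .rightEnd)
  δ_leftEnd q := T.δ_leftEnd q
  δ_rightEnd q := T.δ_rightEnd q
  start := T.start
  final := T.final
  γ q x := T.γ q (match x with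
    | .leftEnd => .leftEnd | .letter a => .letter (f a) | .rightEnd => .rightEnd)

theorem comapLetters_innerStep {f : A → A'} {T : TwoWayTransducer Q A' B} {w : List A}
    {c d : Q × ℕ} :
    (T.comapLetters f).InnerStep w c d ↔ T.InnerStep (w.map f) c d := by
  simp only [TwoWayAutomaton.innerStep_iff, comapLetters, List.getElem?_map,
    Option.map_eq_some_iff]
  constructor
  · rintro ⟨k, a, hk, ha, h1, h2⟩
    exact ⟨k, f a, hk, ⟨a, ha, rfl⟩, h1, h2⟩
  · rintro ⟨k, _, hk, ⟨a, ha, rfl⟩, h1, h2⟩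
    exact ⟨k, a, hk, ha, h1, h2⟩

theorem isAperiodic_comapLetters (f : A → A') {T : TwoWayTransducer Q A' B} (h : T.IsAperiodic) :
    (T.comapLetters f).IsAperiodic := by
  rw [IsAperiodic, TwoWayAutomaton.isAperiodicMonoid_iff] at h ⊢
  obtain ⟨n, hn⟩ := h
  have hb : ∀ x y (w : List A),
      (T.comapLetters f).behavior x y w = T.behavior x y (w.map f) := by
    intro x y w
    have : (T.comapLetters f).InnerStep w = T.InnerStep (w.map f) := by
      funext c d
      exact propext comapLetters_innerStep
    simp only [TwoWayAutomaton.behavior, this, List.length_map]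
  refine ⟨n, fun w x y => ?_⟩
  rw [hb, hb, wordPow_map, wordPow_map]
  exact hn _ x y

theorem comapLetters_isImage {f : A → A'} {T : TwoWayTransducer Q A' B} {u : List A}
    {v : List B} : (T.comapLetters f).IsImage u v ↔ T.IsImage (u.map f) v := by
  have hs : (T.comapLetters f).LiveStep u = T.LiveStep (u.map f) := by
    have hm : markedWord (u.map f) = (markedWord u).map fun x => (match x with
        | .leftEnd => .leftEnd | .letter a => .letter (f a) | .rightEnd => .rightEnd) := by
      simp [markedWord]
    funext c v d
    simp only [LiveStep, IsAccepting, Step, comapLetters, List.length_map, hm, List.getElem?_map,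
      Option.map_eq_some_iff, eq_iff_iff]
    refine and_congr_right fun _ => ⟨?_, ?_⟩
    · rintro ⟨a, ha, h1, h2, h3⟩
      exact ⟨_, ⟨a, ha, rfl⟩, h1, h2, h3⟩
    · rintro ⟨_, ⟨a, ha, rfl⟩, h1, h2, h3⟩
      exact ⟨a, ha, h1, h2, h3⟩
  simp only [isImage_iff, hs, IsAccepting, List.length_map]
  rfl

/-- Rename the states of a transducer. -/
def mapStates (e : Q ≃ P) (T : TwoWayTransducer Q A B) : TwoWayTransducer P A B where
  δ p x := (e (T.δ (e.symm p) x).1, (T.δ (e.symm p) x).2)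
  δ_leftEnd p := T.δ_leftEnd (e.symm p)
  δ_rightEnd p := T.δ_rightEnd (e.symm p)
  start := e T.start
  final := {p | e.symm p ∈ T.final}
  γ p x := T.γ (e.symm p) x

theorem mapStates_innerStep {e : Q ≃ P} {T : TwoWayTransducer Q A B} {w : List A}
    {c d : P × ℕ} : (T.mapStates e).InnerStep w c d ↔
      T.InnerStep w (e.symm c.1, c.2) (e.symm d.1, d.2) := by
  simp only [TwoWayAutomaton.innerStep_iff, mapStates, Equiv.symm_apply_eq]

theorem isAperiodic_mapStates (e : Q ≃ P) {T : TwoWayTransducer Q A B} (h : T.IsAperiodic) :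
    (T.mapStates e).IsAperiodic := by
  rw [IsAperiodic, TwoWayAutomaton.isAperiodicMonoid_iff] at h ⊢
  obtain ⟨n, hn⟩ := h
  have hb : ∀ x y (w : List A) p q,
      (p, q) ∈ (T.mapStates e).behavior x y w ↔ (e.symm p, e.symm q) ∈ T.behavior x y w := by
    intro x y w p q
    constructor
    · exact ReflTransGen.map (fun c : P × ℕ => (e.symm c.1, c.2))
        (fun c d => mapStates_innerStep.1)
    · intro h
      have := ReflTransGen.map (r' := (T.mapStates e).InnerStep w)
        (fun c : Q × ℕ => (e c.1, c.2)) (fun c d hcd => mapStates_innerStep.2 (by simpa)) h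
      rw [Equiv.apply_symm_apply, Equiv.apply_symm_apply] at this
      exact this
  refine ⟨n, fun w x y => Set.ext fun ⟨p, q⟩ => ?_⟩
  rw [hb, hb, hn w x y]

theorem mapStates_isImage {e : Q ≃ P} {T : TwoWayTransducer Q A B} {u : List A} {v : List B} :
    (T.mapStates e).IsImage u v ↔ T.IsImage u v := by
  have hs : ∀ c v d, (T.mapStates e).LiveStep u c v d ↔
      T.LiveStep u (e.symm c.1, c.2) v (e.symm d.1, d.2) := by
    intro c v d
    simp only [LiveStep, IsAccepting, Step, mapStates, Equiv.symm_apply_eq]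
    rfl
  simp only [isImage_iff]
  constructor
  · rintro ⟨d, h, hd⟩
    obtain ⟨d', rfl, h'⟩ := h.simulate (step' := T.LiveStep u)
      (fun c c' => c' = (e.symm c.1, c.2))
      (by
        rintro c v d _ rfl h
        have := (Produces.refl _).head ((hs _ _ _).1 h)
        exact ⟨_, rfl, by simpa using this⟩) _ rfl
    exact ⟨(e.symm d.1, d.2), by simpa [mapStates] using h', hd⟩
  · rintro ⟨d, h, hd⟩
    obtain ⟨d', rfl, h'⟩ := h.simulate (step' := (T.mapStates e).LiveStep u)
      (fun c c' => c' = (e c.1, c.2))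
      (by
        rintro c v d _ rfl h
        have := (Produces.refl _).head ((hs (e c.1, c.2) v (e d.1, d.2)).2 (by simpa using h))
        exact ⟨_, rfl, by simpa using this⟩) _ rfl
    exact ⟨_, h', by simpa [mapStates, IsAccepting] using hd⟩

end TwoWayTransducer

/-! ### Annotations of words -/

/-- The word `w`, each letter paired with the state in which a one-way automaton with transition
function `st` and initial state `s` reads this letter. -/
def annot {A S : Type*} (st : S → A → S) (s : S) : List A → List (A × S)
  | [] => []
  | a :: w => (a, s) :: annot st (st s a) w

section Annot

variable {A S : Type*} {st : S → A → S}

theorem length_annot (s : S) (w : List A) : (annot st s w).length = w.length := by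
  induction w generalizing s with
  | nil => rfl
  | cons a w ih => simp [annot, ih]

theorem annot_append (s : S) (u v : List A) :
    annot st s (u ++ v) = annot st s u ++ annot st (u.foldl st s) v := by
  induction u generalizing s with
  | nil => rfl
  | cons a u ih => simp [annot, ih]

theorem getElem?_annot (s : S) (w : List A) (k : ℕ) :
    (annot st s w)[k]? = w[k]?.map fun a => (a, (w.take k).foldl st s) := by
  induction w generalizing s k with
  | nil => simp [annot]
  | cons a w ih => cases k <;> simp [annot, ih]

theorem foldl_take_succ {s : S} {w : List A} {k : ℕ} {a : A} (h : w[k]? = some a) :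
    (w.take (k + 1)).foldl st s = st ((w.take k).foldl st s) a := by
  rw [List.take_add_one, h]
  simp

theorem annot_wordPow {s : S} {w : List A} (h : w.foldl st s = s) (n : ℕ) :
    annot st s (wordPow w n) = wordPow (annot st s w) n := by
  induction n with
  | zero => rfl
  | succ n ih => rw [wordPow_succ, annot_append, h, ih, wordPow_succ]

theorem foldl_wordPow {s : S} {w : List A} (h : w.foldl st s = s) (n : ℕ) :
    (wordPow w n).foldl st s = s := by
  induction n with
  | zero => rfl
  | succ n ih => rw [wordPow_succ, List.foldl_append, h, ih]

end Annot

/-- The transition function of a register: the letter `a` stores `s` if `r a = some s`, and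
otherwise keeps the value. -/
def regStep {A S : Type*} (r : A → Option S) (s : S) (a : A) : S := (r a).getD s

theorem foldl_regStep_of_keep {A S : Type*} {r : A → Option S} {w : List A}
    (h : ∀ a ∈ w, r a = none) (s : S) : w.foldl (regStep r) s = s := by
  induction w generalizing s with
  | nil => rfl
  | cons a w ih =>
    rw [List.foldl_cons, regStep, h a (by simp), Option.getD_none]
    exact ih (fun b hb => h b (by simp [hb])) s

/-! ### Elimination of a register -/

/-- The states of the machine that eliminates a register: `go q s` simulates state `q` where the
register has value `s`; `back q s` has just moved to the left from a position with value `s`;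
`search q` looks to the left for the letter that determines the value, and `ret q s` carries the
value found back to the right. -/
inductive RegState (Q S : Type*)
  | go (q : Q) (s : S)
  | back (q : Q) (s : S)
  | search (q : Q)
  | ret (q : Q) (s : S)

namespace RegState

/-- The states that simulate a state of the original machine. -/
def IsGo {Q S : Type*} : RegState Q S → Prop
  | go _ _ => True
  | _ => False

theorem finite {Q S : Type*} [Finite Q] [Finite S] : Finite (RegState Q S) := by
  refine Finite.of_injective (β := (Q × S) ⊕ (Q × S) ⊕ Q ⊕ (Q × S)) (fun
    | go q s => .inl (q, s)
    | back q s => .inr (.inl (q, s))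
    | search q => .inr (.inr (.inl q))
    | ret q s => .inr (.inr (.inr (q, s)))) ?_
  intro x y h
  cases x <;> cases y <;> simp_all

end RegState

/-- The tape letter `x` paired with `s`. -/
def Marked.pair {A S : Type*} (s : S) : Marked A → Marked (A × S)
  | leftEnd => leftEnd
  | letter a => letter (a, s)
  | rightEnd => rightEnd

open RegState in
/-- The transition function of the machine that eliminates a register. -/
def regδ {Q A S : Type*} (δ : Q → Marked (A × S) → Q × SignType) (r : A → Option S) (s₀ : S) :
    RegState Q S → Marked A → RegState Q S × SignType
  | go p s, x =>
    match (δ p (x.pair s)).2 with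
    | .neg => (back (δ p (x.pair s)).1 s, -1)
    | .zero => (go (δ p (x.pair s)).1 s, 0)
    | .pos => (go (δ p (x.pair s)).1 (match x with | .letter a => regStep r s a | _ => s), 1)
  | back q s, .letter a => if (r a).isSome then (search q, -1) else (go q s, 0)
  | back q s, _ => (go q s, 0)
  | search q, .leftEnd => (ret q s₀, 1)
  | search q, .letter a => match r a with
    | some s => (ret q s, 1)
    | none => (search q, -1)
  | search q, .rightEnd => (search q, -1)
  | ret q s, .letter a => if (r a).isSome then (go q s, 0) else (ret q s, 1)
  | ret q s, _ => (go q s, 0)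

namespace TwoWayTransducer

open Relation RegState

variable {Q A S B : Type*}

/-- The machine that reads words without the values of a register and simulates the machine `D`,
which reads the values.  The register has initial value `s₀` and is controlled by `r`. After a move
to the left onto a letter that sets the register, the value is found by an excursion to the
preceding letter that sets it; the first such letter on the way back ends the excursion. -/
def elimReg (D : TwoWayTransducer Q (A × S) B) (r : A → Option S) (s₀ : S) :
    TwoWayTransducer (RegState Q S) A B where
  δ := regδ D.δ r s₀
  δ_leftEnd c := by
    cases c with
    | go p s =>
      have := D.δ_leftEnd p
      simp only [regδ, Marked.pair]
      split <;> simp_all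
    | _ => simp [regδ]
  δ_rightEnd c := by
    cases c with
    | go p s =>
      have := D.δ_rightEnd p
      simp only [regδ, Marked.pair]
      split <;> simp_all
    | _ => simp [regδ]
  start := go D.start s₀
  final := {c | ∃ q s, c = go q s ∧ q ∈ D.final}
  γ
    | go p s, x => D.γ p (x.pair s)
    | _, _ => []

section Segment

variable {D : TwoWayTransducer Q (A × S) B} {r : A → Option S} {s₀ t : S} {y : List A} {i₀ : ℕ}
  {R : RegState Q S × ℕ → RegState Q S × ℕ → Prop}

/-- The configuration that simulates `(q, i)` over a segment of the tape that starts after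
position `i₀`. -/
def regEmb (r : A → Option S) (t : S) (y : List A) (i₀ : ℕ) (c : Q × ℕ) : RegState Q S × ℕ :=
  match c.2 with
  | 0 => (back c.1 t, i₀)
  | k + 1 => (go c.1 ((y.take k).foldl (regStep r) t), i₀ + (k + 1))

/-- `R` contains the steps that do not simulate a step, over the segment `y` after position
`i₀`. -/
def HasAuxSteps (D : TwoWayTransducer Q (A × S) B) (r : A → Option S) (s₀ : S) (y : List A)
    (i₀ : ℕ) (R : RegState Q S × ℕ → RegState Q S × ℕ → Prop) : Prop :=
  ∀ c d j a, y[j]? = some a → c.2 = i₀ + (j + 1) → ¬ c.1.IsGo →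
    d.1 = ((D.elimReg r s₀).δ c.1 (.letter a)).1 →
    (d.2 : ℤ) = (c.2 : ℤ) + (((D.elimReg r s₀).δ c.1 (.letter a)).2 : ℤ) → R c d

theorem search_reaches (hR : HasAuxSteps D r s₀ y i₀ R) {q : Q}
    (hs : R (search q, i₀) (ret q t, i₀ + 1)) :
    ∀ j ≤ y.length, ReflTransGen R (search q, i₀ + j)
      (ret q ((y.take j).foldl (regStep r) t), i₀ + (j + 1)) := by
  intro j
  induction j with
  | zero => exact fun _ => .single hs
  | succ j ih =>
    intro hj
    have ha : y[j]? = some y[j] := List.getElem?_eq_getElem hj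
    rw [foldl_take_succ ha]
    rcases hr : r y[j] with _ | v
    · rw [regStep, hr, Option.getD_none]
      refine .head (b := (search q, i₀ + j)) (hR _ _ j _ ha rfl (by simp [IsGo]) ?_ ?_)
        ((ih (by omega)).tail (hR _ _ j _ ha rfl (by simp [IsGo]) ?_ ?_)) <;>
      simp [elimReg, regδ, hr] <;> omega
    · rw [regStep, hr, Option.getD_some]
      refine .single (hR _ _ j _ ha rfl (by simp [IsGo]) ?_ ?_) <;>
      simp [elimReg, regδ, hr]; omega

theorem back_reaches (hR : HasAuxSteps D r s₀ y i₀ R) {q : Q}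
    (hs : (∃ a ∈ y, r a ≠ none) → R (search q, i₀) (ret q t, i₀ + 1)) {j : ℕ}
    (hj : j < y.length) :
    ReflTransGen R (back q ((y.take (j + 1)).foldl (regStep r) t), i₀ + (j + 1))
      (go q ((y.take j).foldl (regStep r) t), i₀ + (j + 1)) := by
  have ha : y[j]? = some y[j] := List.getElem?_eq_getElem hj
  rcases hr : r y[j] with _ | v
  · rw [foldl_take_succ ha, regStep, hr, Option.getD_none]
    refine .single (hR _ _ j _ ha rfl (by simp [IsGo]) ?_ ?_) <;> simp [elimReg, regδ, hr]
  · have hs' := hs ⟨y[j], List.getElem_mem hj, by simp [hr]⟩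
    refine .head (b := (search q, i₀ + j)) (hR _ _ j _ ha rfl (by simp [IsGo]) ?_ ?_)
      ((search_reaches hR hs' j hj.le).tail (hR _ _ j _ ha rfl (by simp [IsGo]) ?_ ?_)) <;>
    simp [elimReg, regδ, hr]; omega

/-- After the simulation of a step, auxiliary steps lead to the configuration that simulates the
next one. -/
theorem go_reaches (hR : HasAuxSteps D r s₀ y i₀ R)
    (hs : (∃ a ∈ y, r a ≠ none) → ∀ q, R (search q, i₀) (ret q t, i₀ + 1)) {j k : ℕ} {a : A}
    {p : Q} (ha : y[j]? = some a)
    (hk : (k : ℤ) = (j : ℤ) + 1 +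
      ((D.δ p (.letter (a, (y.take j).foldl (regStep r) t))).2 : ℤ)) :
    ReflTransGen R
      (((D.elimReg r s₀).δ (go p ((y.take j).foldl (regStep r) t)) (.letter a)).1, i₀ + k)
      (regEmb r t y i₀ ((D.δ p (.letter (a, (y.take j).foldl (regStep r) t))).1, k)) := by
  have hjl : j < y.length := (List.getElem?_eq_some_iff.1 ha).1
  simp only [elimReg, regδ, Marked.pair]
  rcases hd : (D.δ p (.letter (a, (y.take j).foldl (regStep r) t))).2 with _ | _ | _
  · obtain rfl : k = j + 1 := by rw [hd] at hk; simp at hk; omega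
    exact .refl
  · obtain rfl : k = j := by rw [hd] at hk; simp at hk; omega
    cases k with
    | zero => exact .refl
    | succ k => exact back_reaches hR (fun h => hs h _) (by omega)
  · obtain rfl : k = j + 2 := by rw [hd] at hk; simp at hk; omega
    simp only [regEmb, foldl_take_succ ha]
    exact .refl

end Segment

section Image

variable {D : TwoWayTransducer Q (A × S) B} {r : A → Option S} {s₀ : S}

/-- The configuration that simulates `c` over the whole tape. -/
def regEmbTape (r : A → Option S) (s₀ : S) (u : List A) (c : Q × ℕ) : RegState Q S × ℕ :=
  (go c.1 ((u.take (c.2 - 1)).foldl (regStep r) s₀), c.2)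

/-- The steps that do not simulate a step. -/
def RegAuxStep (D : TwoWayTransducer Q (A × S) B) (r : A → Option S) (s₀ : S) (u : List A)
    (c d : RegState Q S × ℕ) : Prop :=
  ¬ c.1.IsGo ∧ (D.elimReg r s₀).Step u c [] d

theorem getElem?_markedWord_letter {A : Type*} {u : List A} {j : ℕ} {a : A} (h : u[j]? = some a) :
    (markedWord u)[j + 1]? = some (.letter a) := by
  obtain ⟨hj, rfl⟩ := List.getElem?_eq_some_iff.1 h
  rw [markedWord, List.getElem?_cons_succ, List.getElem?_append_left (by simpa using hj)]
  simp

theorem getElem?_markedWord_last {A : Type*} (u : List A) :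
    (markedWord u)[u.length + 1]? = some .rightEnd := by
  simp [markedWord]

theorem getElem?_markedWord_cases {A : Type*} {u : List A} {i : ℕ} {x : Marked A}
    (h : (markedWord u)[i]? = some x) : (i = 0 ∧ x = .leftEnd) ∨
      (∃ j a, i = j + 1 ∧ u[j]? = some a ∧ x = .letter a) ∨
      (i = u.length + 1 ∧ x = .rightEnd) := by
  rcases i with _ | j
  · simp only [markedWord, List.getElem?_cons_zero, Option.some.injEq] at h
    exact .inl ⟨rfl, h.symm⟩
  · rcases Nat.lt_trichotomy j u.length with hj | rfl | hj
    · have ha := List.getElem?_eq_getElem hj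
      rw [getElem?_markedWord_letter ha] at h
      exact .inr (.inl ⟨j, u[j], rfl, ha, by simpa using h.symm⟩)
    · rw [getElem?_markedWord_last] at h
      exact .inr (.inr ⟨rfl, by simpa using h.symm⟩)
    · rw [List.getElem?_eq_none (by rw [length_markedWord]; omega)] at h
      simp at h

theorem γ_elimReg_of_not_isGo {c : RegState Q S} (h : ¬ c.IsGo) (x : Marked A) :
    (D.elimReg r s₀).γ c x = [] := by
  cases c <;> simp_all [elimReg, IsGo]

theorem hasAuxSteps_regAuxStep (u : List A) :
    HasAuxSteps D r s₀ u 0 (RegAuxStep D r s₀ u) := by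
  intro c d j a ha hc hgo h1 h2
  refine ⟨hgo, .letter a, ?_, h1, h2, (γ_elimReg_of_not_isGo hgo _).symm⟩
  rw [hc, Nat.zero_add]
  exact getElem?_markedWord_letter ha

theorem regAuxStep_search (u : List A) (q : Q) :
    RegAuxStep D r s₀ u (search q, 0) (ret q s₀, 0 + 1) :=
  ⟨by simp [IsGo], .leftEnd, by simp [markedWord], by simp [elimReg, regδ],
    by simp [elimReg, regδ], by simp [elimReg]⟩

theorem regAuxStep_back (u : List A) (q : Q) :
    RegAuxStep D r s₀ u (back q s₀, 0) (go q s₀, 0) :=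
  ⟨by simp [IsGo], .leftEnd, by simp [markedWord], by simp [elimReg, regδ],
    by simp [elimReg, regδ], by simp [elimReg]⟩

theorem regEmb_reaches_regEmbTape (u : List A) (c : Q × ℕ) :
    ReflTransGen (RegAuxStep D r s₀ u) (regEmb r s₀ u 0 c) (regEmbTape r s₀ u c) := by
  obtain ⟨q, _ | k⟩ := c
  · exact .single (regAuxStep_back u q)
  · simp only [regEmb, regEmbTape, Nat.zero_add, Nat.add_sub_cancel]
    exact .refl

/-- A step over the annotated tape is simulated by one step with the same production and by
auxiliary steps. -/
theorem step_elimReg {u : List A} {c d : Q × ℕ} {v : List B}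
    (h : D.Step (annot (regStep r) s₀ u) c v d) :
    ∃ e, (D.elimReg r s₀).Step u (regEmbTape r s₀ u c) v e ∧
      ReflTransGen (RegAuxStep D r s₀ u) e (regEmbTape r s₀ u d) := by
  obtain ⟨q, k⟩ := d
  obtain ⟨p, i⟩ := c
  obtain ⟨x, hx, rfl, h2, rfl⟩ := h
  have hbr : ∀ q, ReflTransGen (RegAuxStep D r s₀ u)
      (back q (u.foldl (regStep r) s₀), u.length) (regEmbTape r s₀ u (q, u.length)) := by
    intro q
    refine .trans ?_ (regEmb_reaches_regEmbTape u _)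
    rcases u.length.eq_zero_or_pos with h0 | h0
    · rw [h0, List.length_eq_zero_iff.1 h0]
      exact .refl
    · obtain ⟨j, hj⟩ : ∃ j, u.length = j + 1 := ⟨u.length - 1, by omega⟩
      have := back_reaches (t := s₀) (hasAuxSteps_regAuxStep (D := D) (r := r) (s₀ := s₀) u)
        (fun _ => regAuxStep_search u q) (j := j) (by omega)
      rw [← hj, List.take_length] at this
      rw [regEmb.eq_def, hj]
      simpa [hj] using this
  simp only at h2 hx
  rcases getElem?_markedWord_cases hx with ⟨rfl, rfl⟩ | ⟨j, b, rfl, hb, rfl⟩ | ⟨rfl, rfl⟩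
  · refine ⟨(((D.elimReg r s₀).δ (go p s₀) .leftEnd).1, k), ⟨.leftEnd, by simp [markedWord,
      regEmbTape], by simp [regEmbTape], ?_, by simp [elimReg, Marked.pair, regEmbTape]⟩, ?_⟩
    · simp only [regEmbTape, elimReg, regδ, Marked.pair, h2]
      cases (D.δ p .leftEnd).2 <;> rfl
    · have := D.δ_leftEnd p
      simp only [elimReg, regδ, Marked.pair]
      rcases hd : (D.δ p .leftEnd).2 with _ | _ | _
      · obtain rfl : k = 0 := by rw [hd] at h2; simp at h2; omega
        exact .refl
      · exact absurd hd this
      · obtain rfl : k = 1 := by rw [hd] at h2; simp at h2; omega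
        exact .refl
  · rw [getElem?_annot, Option.map_eq_some_iff] at hb
    obtain ⟨a, ha, rfl⟩ := hb
    have := go_reaches (hasAuxSteps_regAuxStep (D := D) (r := r) (s₀ := s₀) u)
      (fun _ => regAuxStep_search u) (p := p) ha (k := k) (by push_cast at h2 ⊢; omega)
    rw [Nat.zero_add] at this
    refine ⟨_, ⟨.letter a, ?_, ?_, ?_, ?_⟩, this.trans (regEmb_reaches_regEmbTape u _)⟩
    · exact getElem?_markedWord_letter ha
    · simp [regEmbTape]
    · simp only [regEmbTape, elimReg, regδ, Marked.pair, Nat.add_sub_cancel]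
      rw [h2]
      cases (D.δ p (.letter (a, (u.take j).foldl (regStep r) s₀))).2 <;> rfl
    · simp [elimReg, Marked.pair, regEmbTape]
  · simp only [length_annot] at h2 ⊢
    refine ⟨(((D.elimReg r s₀).δ (go p (u.foldl (regStep r) s₀)) .rightEnd).1, k), ⟨.rightEnd,
      getElem?_markedWord_last u, by simp [regEmbTape], ?_,
      by simp [elimReg, Marked.pair, regEmbTape]⟩, ?_⟩
    · simp only [regEmbTape, elimReg, regδ, Marked.pair, h2]
      cases (D.δ p .rightEnd).2 <;> rfl
    · have := D.δ_rightEnd p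
      simp only [elimReg, regδ, Marked.pair]
      rcases hd : (D.δ p .rightEnd).2 with _ | _ | _
      · obtain rfl : k = u.length + 1 := by rw [hd] at h2; simp at h2; omega
        simp only [regEmbTape, Nat.add_sub_cancel, List.take_length]
        exact .refl
      · obtain rfl : k = u.length := by rw [hd] at h2; simp at h2; omega
        exact hbr _
      · exact absurd hd this

/-- If every step of `D` over `w` is simulated by a step of `C` over `u` with the same production
followed by auxiliary steps without production, and `C` accepts where `D` accepts, then the images
agree.  A run of `D` that does not accept does not stop, nor does then the run of `C`. -/
theorem isImage_iff_of_simulation {P A' : Type*} {D : TwoWayTransducer Q A' B}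
    {C : TwoWayTransducer P A B} {w : List A'} {u : List A} (E : Q × ℕ → P × ℕ)
    (Aux : P × ℕ → P × ℕ → Prop) (hAux : ∀ c d, Aux c d → C.LiveStep u c [] d)
    (hstep : ∀ c v d, D.Step w c v d → ∃ e, C.Step u (E c) v e ∧ ReflTransGen Aux e (E d))
    (hacc : ∀ c, c.2 ≤ w.length + 1 → (C.IsAccepting u (E c) ↔ D.IsAccepting w c))
    (hstart : ReflTransGen Aux (C.start, 0) (E (D.start, 0))) (v : List B) :
    C.IsImage u v ↔ D.IsImage w v := by
  have haux : ∀ {c d}, ReflTransGen Aux c d → Produces (C.LiveStep u) c [] d :=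
    fun h => produces_nil_of_reflTransGen hAux h
  have hlive : ∀ c v d, D.LiveStep w c v d → ∃ e, C.LiveStep u (E c) v e ∧
      ReflTransGen Aux e (E d) := by
    intro c v d h
    obtain ⟨e, he, hed⟩ := hstep c v d h.2
    exact ⟨e, ⟨fun hc => h.1 ((hacc c h.2.near.1).1 hc), he⟩, hed⟩
  have hsim : ∀ {v}, D.IsImage w v → C.IsImage u v := by
    intro v h
    rw [isImage_iff] at h ⊢
    obtain ⟨d, hd, hda⟩ := h
    obtain ⟨d', ⟨rfl, hle⟩, hd'⟩ := hd.simulate (step' := C.LiveStep u)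
      (fun c c' => c' = E c ∧ c.2 ≤ w.length + 1)
      (by
        rintro c v d _ ⟨rfl, -⟩ h
        obtain ⟨e, he, hed⟩ := hlive c v d h
        have := (haux hed).head he
        rw [List.append_nil] at this
        exact ⟨_, ⟨rfl, h.2.near.2⟩, this⟩) _ ⟨rfl, Nat.zero_le _⟩
    refine ⟨_, ?_, (hacc d hle).2 hda⟩
    simpa using (haux hstart).trans hd'
  refine ⟨fun h => ?_, hsim⟩
  obtain ⟨d, hd, hda⟩ := isImage_iff.1 h
  have h_end : ∀ e, ¬ ∃ v, C.LiveStep u d v e := fun e ⟨v, hv⟩ => hv.1 hda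
  have hU := C.liveStep_rightUnique u
  have hr := reach_stop_of_reach hU h_end hd.reflTransGen (haux hstart).reflTransGen
  have key : ∀ x, Acc (fun y x => TransGen (fun c d => ∃ v, C.LiveStep u c v d) x y) x →
      ∀ c, c.2 ≤ w.length + 1 → E c = x →
        ∃ v d, Produces (D.LiveStep w) c v d ∧ D.IsAccepting w d := by
    intro x hx
    induction hx with
    | intro x _ ih =>
      rintro c hc rfl
      by_cases hca : D.IsAccepting w c
      · exact ⟨_, _, .refl c, hca⟩
      · obtain ⟨v, d, hcd⟩ := D.exists_step hc
        obtain ⟨e, he, hed⟩ := hlive c v d ⟨hca, hcd⟩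
        obtain ⟨v', d', hd', hda'⟩ := ih (E d)
          (TransGen.head' ⟨v, he⟩ (haux hed).reflTransGen) d hcd.near.2 rfl
        exact ⟨_, _, hd'.head ⟨hca, hcd⟩, hda'⟩
  obtain ⟨v', d', hd', hda'⟩ := key _ (acc_transGen_of_stops hU h_end hr) _ (Nat.zero_le _) rfl
  have hD : D.IsImage w v' := isImage_iff.2 ⟨d', hd', hda'⟩
  obtain ⟨d'', hd'', hda''⟩ := isImage_iff.1 (hsim hD)
  rwa [hd.output_unique C.liveStep_det (fun w e he => he.1 hda) (fun w e he => he.1 hda'') hd'']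

theorem isAccepting_regEmbTape {u : List A} (c : Q × ℕ) :
    (D.elimReg r s₀).IsAccepting u (regEmbTape r s₀ u c) ↔
      D.IsAccepting (annot (regStep r) s₀ u) c := by
  simp [IsAccepting, elimReg, regEmbTape, length_annot]

theorem RegAuxStep.liveStep {u : List A} {c d : RegState Q S × ℕ}
    (h : RegAuxStep D r s₀ u c d) : (D.elimReg r s₀).LiveStep u c [] d := by
  refine ⟨?_, h.2⟩
  rintro ⟨⟨q, s, hc, -⟩, -⟩
  exact h.1 (by simp [hc, IsGo])

theorem elimReg_isImage {u : List A} {v : List B} :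
    (D.elimReg r s₀).IsImage u v ↔ D.IsImage (annot (regStep r) s₀ u) v :=
  isImage_iff_of_simulation (regEmbTape r s₀ u) (RegAuxStep D r s₀ u)
    (fun _ _ h => h.liveStep) (fun _ _ _ h => step_elimReg h)
    (fun c _ => isAccepting_regEmbTape c) .refl v

/-- The machine that eliminates a register which is filled from the right: the mirror image of the
elimination of a register filled from the left, except that its first task is to find the value
at the left endmarker. -/
def elimRegRight (D : TwoWayTransducer Q (A × S) B) (r : A → Option S) (s₀ : S) :
    TwoWayTransducer (RegState Q S) A B :=
  { (D.mirror.elimReg r s₀).mirror with start := search D.start }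

theorem elimRegRight_isImage {u : List A} {v : List B} :
    (D.elimRegRight r s₀).IsImage u v ↔
      D.IsImage (annot (regStep r) s₀ u.reverse).reverse v := by
  have hl : (annot (regStep r) s₀ u.reverse).length = u.length := by simp [length_annot]
  have hm : ∀ c v d, (D.mirror.elimReg r s₀).Step u.reverse c v d →
      (D.elimRegRight r s₀).Step u (c.1, u.length + 1 - c.2) v (d.1, u.length + 1 - d.2) := by
    intro c v d h
    have := h.mirror
    rwa [List.length_reverse, List.reverse_reverse] at this
  have hlive : ∀ {c d}, RegAuxStep D.mirror r s₀ u.reverse c d →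
      (D.elimRegRight r s₀).LiveStep u (c.1, u.length + 1 - c.2) []
        (d.1, u.length + 1 - d.2) := by
    intro c d h
    refine ⟨?_, hm _ _ _ h.2⟩
    rintro ⟨⟨q, s, hc, -⟩, -⟩
    exact h.1 (by simp only at hc; simp [hc, IsGo])
  have hmap : ∀ {c d}, ReflTransGen (RegAuxStep D.mirror r s₀ u.reverse) c d →
      ReflTransGen (fun c d => (D.elimRegRight r s₀).LiveStep u c [] d)
        (c.1, u.length + 1 - c.2) (d.1, u.length + 1 - d.2) := fun h =>
    h.map (fun c : RegState Q S × ℕ => (c.1, u.length + 1 - c.2)) (fun c d h => hlive h)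
  refine isImage_iff_of_simulation
    (fun c => ((regEmbTape r s₀ u.reverse (c.1, u.length + 1 - c.2)).1, c.2))
    (fun c d => (D.elimRegRight r s₀).LiveStep u c [] d) (fun _ _ h => h) ?_ ?_ ?_ v
  · intro c v d h
    have hn := h.near
    rw [List.length_reverse, hl] at hn
    have h' := h.mirror
    rw [List.reverse_reverse, List.length_reverse, hl] at h'
    obtain ⟨e, he, hed⟩ := step_elimReg h'
    refine ⟨(e.1, u.length + 1 - e.2), ?_, ?_⟩
    · convert hm _ _ _ he using 2
      simp only [regEmbTape]
      omega
    · convert hmap hed using 2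
      simp only [regEmbTape]
      omega
  · intro c _
    simp [IsAccepting, elimRegRight, mirror, TwoWayAutomaton.mirror, elimReg, regEmbTape,
      length_annot]
  · have hsearch : RegAuxStep D.mirror r s₀ u.reverse (search D.start, u.length + 1)
        (search D.start, u.length) :=
      ⟨by simp [IsGo], .rightEnd, by rw [← u.length_reverse]; exact getElem?_markedWord_last _,
        by simp [elimReg, regδ], by simp [elimReg, regδ], by simp [elimReg]⟩
    have hret : ∀ s, RegAuxStep D.mirror r s₀ u.reverse (ret D.start s, u.length + 1)
        (go D.start s, u.length + 1) := fun s =>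
      ⟨by simp [IsGo], .rightEnd, by rw [← u.length_reverse]; exact getElem?_markedWord_last _,
        by simp [elimReg, regδ], by simp [elimReg, regδ], by simp [elimReg]⟩
    have := search_reaches (t := s₀) (hasAuxSteps_regAuxStep (D := D.mirror) (r := r) u.reverse)
      (regAuxStep_search u.reverse D.start) u.length (by simp)
    rw [Nat.zero_add, Nat.zero_add] at this
    convert hmap ((this.head hsearch).tail (hret _)) using 2 <;>
    simp [elimRegRight, regEmbTape]

end Image

end TwoWayTransducer

/-! ### The elimination of a register preserves aperiodicity -/

namespace TwoWayTransducer

open Relation RegState TwoWayAutomaton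

variable {Q A S B : Type*}

section Aperiodic

variable {D : TwoWayTransducer Q (A × S) B} {r : A → Option S} {s₀ t : S}

theorem innerStep_of_getElem? {P : Type*} {M : TwoWayAutomaton P A} {w : List A} {c d : P × ℕ}
    {k : ℕ} {a : A} (ha : w[k]? = some a) (hc : c.2 = k + 1)
    (h1 : d.1 = (M.δ c.1 (.letter a)).1)
    (h2 : (d.2 : ℤ) = (c.2 : ℤ) + ((M.δ c.1 (.letter a)).2 : ℤ)) : M.InnerStep w c d :=
  innerStep_iff.2 ⟨k, a, hc, ha, h1, h2⟩

theorem getElem?_append_mid {x y z : List A} {j : ℕ} {a : A} (h : y[j]? = some a) :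
    (x ++ y ++ z)[x.length + j]? = some a := by
  have hj := (List.getElem?_eq_some_iff.1 h).1
  rw [List.getElem?_append_left (by simp; omega), List.getElem?_append_right (by omega), ← h]
  congr 1
  omega

theorem hasAuxSteps_innerStep (x y z : List A) :
    HasAuxSteps D r s₀ y x.length ((D.elimReg r s₀).InnerStep (x ++ y ++ z)) := by
  intro c d j a ha hc _ h1 h2
  exact innerStep_of_getElem? (k := x.length + j) (getElem?_append_mid ha) (by omega) h1 h2

/-- The run enters the segment `y` of `x y z` with the value `t`: no letter of `y` sets the
register, or the letter before `y` stores `t`. -/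
def Source (D : TwoWayTransducer Q (A × S) B) (r : A → Option S) (s₀ t : S) (x y z : List A) :
    Prop :=
  (∃ a ∈ y, r a ≠ none) → ∀ q,
    (D.elimReg r s₀).InnerStep (x ++ y ++ z) (search q, x.length) (ret q t, x.length + 1)

/-- A step of `D` over the annotated segment `y` is simulated over `x y z`. -/
theorem innerStep_elimReg {x y z : List A} (hs : Source D r s₀ t x y z) {c d : Q × ℕ}
    (h : D.InnerStep (annot (regStep r) t y) c d) :
    TransGen ((D.elimReg r s₀).InnerStep (x ++ y ++ z)) (regEmb r t y x.length c)
      (regEmb r t y x.length d) := by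
  obtain ⟨p, i⟩ := c
  obtain ⟨q, k⟩ := d
  obtain ⟨j, b, rfl, hb, rfl, h2⟩ := innerStep_iff.1 h
  rw [getElem?_annot, Option.map_eq_some_iff] at hb
  obtain ⟨a, ha, rfl⟩ := hb
  refine .head' (innerStep_of_getElem? (k := x.length + j) (getElem?_append_mid ha)
    (by simp [regEmb]; omega) rfl ?_) (go_reaches (hasAuxSteps_innerStep x y z) hs (p := p) ha
      (k := k) (by simpa using h2))
  simp only [regEmb, elimReg, regδ, Marked.pair] at h2 ⊢
  have : ∀ m : SignType, (k : ℤ) = ((j + 1 : ℕ) : ℤ) + (m : ℤ) →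
      ((x.length + k : ℕ) : ℤ) = ((x.length + (j + 1) : ℕ) : ℤ) + (m : ℤ) := by
    intro m h
    push_cast at h ⊢
    omega
  refine (this _ h2).trans ?_
  cases (D.δ p (.letter (a, (y.take j).foldl (regStep r) t))).2 <;> rfl

theorem reaches_elimReg {x y z : List A} (hs : Source D r s₀ t x y z) {c d : Q × ℕ}
    (h : ReflTransGen (D.InnerStep (annot (regStep r) t y)) c d) :
    ReflTransGen ((D.elimReg r s₀).InnerStep (x ++ y ++ z)) (regEmb r t y x.length c)
      (regEmb r t y x.length d) := by
  induction h with
  | refl => exact .refl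
  | tail _ h ih => exact ih.trans (innerStep_elimReg hs h).to_reflTransGen

/-- Where the run of the simulating machine terminates, the simulated run leaves the word. -/
theorem exists_exit_of_acc {x y z : List A} (hs : Source D r s₀ t x y z) {c : Q × ℕ}
    (hc : c.2 ≤ y.length + 1)
    (hacc : Acc (fun e d => TransGen ((D.elimReg r s₀).InnerStep (x ++ y ++ z)) d e)
      (regEmb r t y x.length c)) :
    ∃ q s, ReflTransGen (D.InnerStep (annot (regStep r) t y)) c (q, Side.exit y.length s) := by
  generalize he : regEmb r t y x.length c = e at hacc
  induction hacc generalizing c with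
  | intro e _ ih =>
    subst he
    by_cases h0 : c.2 = 0
    · exact ⟨c.1, .left, by rw [show (c.1, Side.exit y.length .left) = c from Prod.ext rfl h0.symm]⟩
    by_cases h1 : c.2 = y.length + 1
    · exact ⟨c.1, .right,
        by rw [show (c.1, Side.exit y.length .right) = c from Prod.ext rfl h1.symm]⟩
    obtain ⟨d, hd⟩ := D.exists_innerStep (w := annot (regStep r) t y) (c := c) (by omega)
      (by rw [length_annot]; omega)
    have hn := innerStep_near hd
    rw [length_annot] at hn
    obtain ⟨q, s, hq⟩ := ih _ (innerStep_elimReg hs hd) (by omega) rfl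
    exact ⟨q, s, .head hd hq⟩

theorem acc_of_reaches_exit {P : Type*} {M : TwoWayAutomaton P A} {w : List A} {c : P × ℕ} {q : P}
    {s : Side} (h : ReflTransGen (M.InnerStep w) c (q, s.exit w.length)) :
    Acc (fun e d => TransGen (M.InnerStep w) d e) c :=
  acc_transGen_of_stops (M.innerStep_rightUnique w) (M.not_innerStep_exit w q s) h

theorem exit_unique {P : Type*} {M : TwoWayAutomaton P A} {w : List A} {c : P × ℕ} {q q' : P}
    {s s' : Side} (h : ReflTransGen (M.InnerStep w) c (q, s.exit w.length))
    (h' : ReflTransGen (M.InnerStep w) c (q', s'.exit w.length)) : q' = q ∧ s' = s := by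
  have := stop_unique (M.innerStep_rightUnique w) (M.not_innerStep_exit w q s)
    (M.not_innerStep_exit w q' s') h h'
  rw [Prod.mk.injEq] at this
  refine ⟨this.1, ?_⟩
  cases s <;> cases s' <;> simp [Side.exit] at this <;> rfl

theorem regEmb_exit_left {y : List A} {i₀ : ℕ} (q : Q) :
    regEmb r t y i₀ (q, Side.exit y.length .left) = (back q t, i₀) := rfl

theorem regEmb_exit_right {y : List A} {i₀ : ℕ} (q : Q) :
    regEmb r t y i₀ (q, Side.exit y.length .right) =
      (go q (y.foldl (regStep r) t), i₀ + (y.length + 1)) := by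
  simp [regEmb, Side.exit]

section Keep

/-! Words without letters that set the register: the value at the entrance is the value
everywhere. -/

variable {y y' : List A}

theorem source_of_keep (hy : ∀ a ∈ y, r a = none) (x z : List A) : Source D r s₀ t x y z :=
  fun ⟨a, ha, h⟩ => absurd (hy a ha) h

theorem search_reaches_of_keep (hy : ∀ a ∈ y, r a = none) (q : Q) :
    ∀ i ≤ y.length, ReflTransGen ((D.elimReg r s₀).InnerStep y) (search q, i) (search q, 0) := by
  intro i
  induction i with
  | zero => exact fun _ => .refl
  | succ i ih =>
    intro hi
    refine .head (innerStep_of_getElem? (k := i) (List.getElem?_eq_getElem hi) rfl ?_ ?_)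
      (ih (by omega)) <;> simp [elimReg, regδ, hy _ (List.getElem_mem hi)]

theorem ret_reaches_of_keep (hy : ∀ a ∈ y, r a = none) (q : Q) (s : S) {i j : ℕ}
    (hi : i + j = y.length) :
    ReflTransGen ((D.elimReg r s₀).InnerStep y) (ret q s, i + 1) (ret q s, y.length + 1) := by
  induction j generalizing i with
  | zero => rw [← hi]
  | succ j ih =>
    have hil : i < y.length := by omega
    refine .head (innerStep_of_getElem? (k := i) (List.getElem?_eq_getElem hil) rfl ?_ ?_)
      (ih (i := i + 1) (by omega)) <;> simp [elimReg, regδ, hy _ (List.getElem_mem hil)]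

theorem regEmb_of_keep (hy : ∀ a ∈ y, r a = none) {i₀ k : ℕ} (q : Q) :
    regEmb r t y i₀ (q, k + 1) = (go q t, i₀ + (k + 1)) := by
  simp only [regEmb]
  rw [foldl_regStep_of_keep fun a ha => hy a (List.mem_of_mem_take ha)]

theorem entry_eq_succ (hy : y ≠ []) (x : Side) :
    ∃ k, x.entry y.length = k + 1 ∧ k < y.length := by
  have := List.length_pos_iff.2 hy
  cases x
  · exact ⟨0, rfl, this⟩
  · exact ⟨y.length - 1, by simp [Side.entry]; omega, by omega⟩

/-- On a word that leaves the register alone, the excursions to the left pass through the whole word,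
and otherwise the run is that of `D` over the word annotated with a constant value. -/
theorem behavior_subset_of_keep (hy : ∀ a ∈ y, r a = none) (hy' : ∀ a ∈ y', r a = none)
    (hn : y ≠ []) (hn' : y' ≠ [])
    (h : ∀ s, D.BehaviorEquiv (annot (regStep r) s y) (annot (regStep r) s y')) (x z : Side) :
    (D.elimReg r s₀).behavior x z y ⊆ (D.elimReg r s₀).behavior x z y' := by
  obtain ⟨k, hk, hkl⟩ := entry_eq_succ hn x
  obtain ⟨k', hk', hkl'⟩ := entry_eq_succ hn' x
  have hgo : ∀ (p : Q) (s : S) (c : RegState Q S) (z : Side),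
      ReflTransGen ((D.elimReg r s₀).InnerStep y) (go p s, x.entry y.length) (c, z.exit y.length) →
      ReflTransGen ((D.elimReg r s₀).InnerStep y') (go p s, x.entry y'.length)
        (c, z.exit y'.length) := by
    intro p s c z hc
    have hs := source_of_keep (D := D) (s₀ := s₀) (t := s) hy [] []
    have hs' := source_of_keep (D := D) (s₀ := s₀) (t := s) hy' [] []
    have he : regEmb r s y 0 (p, x.entry y.length) = (go p s, x.entry y.length) := by
      rw [hk, regEmb_of_keep hy, Nat.zero_add]
    have he' : regEmb r s y' 0 (p, x.entry y'.length) = (go p s, x.entry y'.length) := by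
      rw [hk', regEmb_of_keep hy', Nat.zero_add]
    have hacc := acc_of_reaches_exit hc
    rw [← he] at hacc
    obtain ⟨q, e, hq⟩ := exists_exit_of_acc (c := (p, x.entry y.length)) hs
      (by rw [hk]; omega) (by simpa using hacc)
    have hb : (p, q) ∈ D.behavior x e (annot (regStep r) s y) := by
      simpa [behavior, length_annot] using hq
    rw [h s x e] at hb
    have hq' : ReflTransGen (D.InnerStep (annot (regStep r) s y')) (p, x.entry y'.length)
        (q, e.exit y'.length) := by
      simpa [behavior, length_annot] using hb
    have h1 := reaches_elimReg hs hq
    have h2 := reaches_elimReg hs' hq'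
    simp only [List.nil_append, List.append_nil, List.length_nil] at h1 h2
    rw [he] at h1
    rw [he'] at h2
    cases e with
    | left =>
      rw [regEmb_exit_left] at h1 h2
      obtain ⟨rfl, rfl⟩ := exit_unique (s := .left) h1 hc
      exact h2
    | right =>
      rw [regEmb_exit_right, foldl_regStep_of_keep hy, Nat.zero_add] at h1
      rw [regEmb_exit_right, foldl_regStep_of_keep hy', Nat.zero_add] at h2
      obtain ⟨rfl, rfl⟩ := exit_unique (s := .right) h1 hc
      exact h2
  rintro ⟨σ, τ⟩ hστ
  change ReflTransGen _ _ _ at hστ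
  change ReflTransGen _ _ _
  cases σ with
  | go p s => exact hgo p s τ z hστ
  | back p s =>
    have hb : ∀ {y : List A} {k}, (∀ a ∈ y, r a = none) → k < y.length →
        (D.elimReg r s₀).InnerStep y (back p s, k + 1) (go p s, k + 1) := by
      intro y k hy hk
      refine innerStep_of_getElem? (k := k) (List.getElem?_eq_getElem hk) rfl ?_ ?_ <;>
      simp [elimReg, regδ, hy _ (List.getElem_mem hk)]
    have h1 := hb hy hkl
    have h2 := hb hy' hkl'
    rw [← hk] at h1
    rw [← hk'] at h2
    exact .head h2 (hgo p s τ z (reach_stop_of_reach (innerStep_rightUnique _ _)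
      (not_innerStep_exit _ _ _ _) hστ (.single h1)))
  | search q =>
    obtain ⟨rfl, rfl⟩ := exit_unique (s := .left)
      (search_reaches_of_keep hy q _ (by omega)) hστ
    exact search_reaches_of_keep hy' q _ (by omega)
  | ret q s =>
    simp only [hk] at hστ
    obtain ⟨rfl, rfl⟩ := exit_unique (s := .right)
      (ret_reaches_of_keep hy q s (Nat.add_sub_cancel' hkl.le)) hστ
    simp only [hk']
    exact ret_reaches_of_keep hy' q s (Nat.add_sub_cancel' hkl'.le)

end Keep

section Set

/-! A segment `y` between two letters that set the register: its behavior in the simulating machine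
only depends on the behavior in `D` of the annotated segment. -/

variable {X Z y y' : List A} {a b : A} {e : S}

/-- Configurations outside of the segment `y`, which extends over the positions `i + 1`, …, `i + m`,
and outside of a segment `y'` of length `m'` at the same place.  Left out are the configurations in
which an excursion from the inside of the segment has come to the letter before it or returns to the
letter after it, and those in which the register has a wrong value on the letter after the
segment. -/
inductive RegCorr (i m m' : ℕ) (e : S) : RegState Q S × ℕ → RegState Q S × ℕ → Prop
  | left (σ : RegState Q S) (k : ℕ) (hk : k ≤ i) (h : k = i → ∀ q, σ ≠ search q) :
      RegCorr i m m' e (σ, k) (σ, k)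
  | right (σ : RegState Q S) (j : ℕ)
      (h : j = 0 → (∀ q s, σ = go q s → s = e) ∧ ∀ q s, σ ≠ ret q s) (k k' : ℕ)
      (hk : k = i + m + 1 + j) (hk' : k' = i + m' + 1 + j) : RegCorr i m m' e (σ, k) (σ, k')

theorem move_of_search {σ : RegState Q S} {x : Marked A} {q : Q}
    (h : ((D.elimReg r s₀).δ σ x).1 = search q) : ((D.elimReg r s₀).δ σ x).2 = -1 := by
  revert h
  simp only [elimReg]
  cases σ <;> cases x <;> simp only [regδ] <;> (try split) <;> simp_all

theorem state_of_move_neg {σ : RegState Q S} {x : Marked A}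
    (h : ((D.elimReg r s₀).δ σ x).2 = -1) :
    (∃ q s, ((D.elimReg r s₀).δ σ x).1 = back q s) ∨
      ∃ q, ((D.elimReg r s₀).δ σ x).1 = search q := by
  revert h
  simp only [elimReg]
  cases σ <;> cases x <;> simp only [regδ] <;> (try split) <;> simp_all

theorem source_of_set (hX : X.getLast? = some a) (hra : r a = some t) (Z : List A) (q : Q) :
    (D.elimReg r s₀).InnerStep (X ++ y ++ Z) (search q, X.length) (ret q t, X.length + 1) := by
  obtain ⟨x, rfl⟩ : ∃ x, X = x ++ [a] := by
    obtain ⟨h, h'⟩ := List.getLast?_eq_some_iff.1 hX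
    exact ⟨h, h'⟩
  refine innerStep_of_getElem? (k := x.length) (a := a) ?_ ?_ ?_ ?_ <;>
    simp [elimReg, regδ, hra]

/-- The run through the segment. -/
theorem enter_segment (hX : X.getLast? = some a) (hra : r a = some t)
    (he : y.foldl (regStep r) t = e) (he' : y'.foldl (regStep r) t = e)
    (h : D.BehaviorEquiv (annot (regStep r) t y) (annot (regStep r) t y')) (Z : List A)
    {q : Q} {x : Side}
    (hacc : Acc (fun e d => TransGen ((D.elimReg r s₀).InnerStep (X ++ y ++ Z)) d e)
      (regEmb r t y X.length (q, x.entry y.length))) :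
    ∃ c c', RegCorr X.length y.length y'.length e c c' ∧
      ReflTransGen ((D.elimReg r s₀).InnerStep (X ++ y ++ Z))
        (regEmb r t y X.length (q, x.entry y.length)) c ∧
      ReflTransGen ((D.elimReg r s₀).InnerStep (X ++ y' ++ Z))
        (regEmb r t y' X.length (q, x.entry y'.length)) c' := by
  have hs : Source D r s₀ t X y Z := fun _ => source_of_set hX hra Z
  have hs' : Source D r s₀ t X y' Z := fun _ => source_of_set hX hra Z
  obtain ⟨q', z, hq⟩ := exists_exit_of_acc hs (by cases x <;> simp [Side.entry]) hacc
  have hb : (q, q') ∈ D.behavior x z (annot (regStep r) t y) := by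
    simpa [behavior, length_annot] using hq
  rw [h x z] at hb
  have hq' : ReflTransGen (D.InnerStep (annot (regStep r) t y')) (q, x.entry y'.length)
      (q', z.exit y'.length) := by
    simpa [behavior, length_annot] using hb
  refine ⟨_, _, ?_, reaches_elimReg hs hq, reaches_elimReg hs' hq'⟩
  cases z with
  | left => exact .left _ _ le_rfl (by simp)
  | right =>
    rw [regEmb_exit_right, regEmb_exit_right, he, he']
    exact .right (go q' e) 0 (by simp) _ _ rfl rfl

theorem back_reaches_entry (hX : X.getLast? = some a) (hra : r a = some t)
    (he : y.foldl (regStep r) t = e) (Z : List A) (q : Q) :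
    ReflTransGen ((D.elimReg r s₀).InnerStep (X ++ y ++ Z)) (back q e, X.length + y.length)
      (regEmb r t y X.length (q, y.length)) := by
  rcases y.length.eq_zero_or_pos with h0 | h0
  · rw [h0]
    rw [List.length_eq_zero_iff.1 h0] at he
    rw [← he]
    exact .refl
  · obtain ⟨j, hj⟩ : ∃ j, y.length = j + 1 := ⟨y.length - 1, by omega⟩
    have := back_reaches (hasAuxSteps_innerStep (D := D) (s₀ := s₀) X y Z)
      (fun _ => source_of_set hX hra Z q) (j := j) (by omega)
    rw [← hj, List.take_length, he] at this
    refine this.trans ?_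
    simp only [hj, regEmb]
    exact .refl

/-- An excursion that starts on the letter after the segment. -/
theorem excursion_from_right {b : A} {z : List A} (hX : X.getLast? = some a) (hra : r a = some t)
    (hrb : r b ≠ none) (he : y.foldl (regStep r) t = e) (q : Q) (s : S) :
    TransGen ((D.elimReg r s₀).InnerStep (X ++ y ++ (b :: z))) (back q s, X.length + y.length + 1)
      (go q e, X.length + y.length + 1) := by
  have hb : (X ++ y ++ (b :: z))[X.length + y.length]? = some b := by
    rw [List.getElem?_append_right (by simp)]
    simp
  have h1 := search_reaches (hasAuxSteps_innerStep (D := D) (s₀ := s₀) X y (b :: z))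
    (source_of_set hX hra (b :: z) q) y.length le_rfl
  rw [List.take_length, he] at h1
  refine .head' (innerStep_of_getElem? hb rfl ?_ ?_)
    (h1.tail (innerStep_of_getElem? hb rfl ?_ ?_)) <;>
  simp [elimReg, regδ, Option.isSome_iff_ne_none.2 hrb]
  omega

/-- If `y` and `y'` end with the same value of the register and the annotated segments have the same
behaviors under `D`, then runs over `X y b z` and `X y' b z` leave these words in the same way from
corresponding configurations. The letters around the segment, the last one of `X` and `b`, set the
register, so that an excursion from the inside of the segment goes at most to the last letter of
`X`, and one from the outside that enters the segment leaves it on the side from which it came. -/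
theorem regCorr_run {z : List A} (hX : X.getLast? = some a) (hra : r a = some t)
    (hrb : r b ≠ none) (he : y.foldl (regStep r) t = e) (he' : y'.foldl (regStep r) t = e)
    (h : D.BehaviorEquiv (annot (regStep r) t y) (annot (regStep r) t y'))
    {c c' : RegState Q S × ℕ} {τ : RegState Q S} {s : Side}
    (hc : RegCorr X.length y.length y'.length e c c')
    (hr : ReflTransGen ((D.elimReg r s₀).InnerStep (X ++ y ++ (b :: z))) c
      (τ, s.exit (X ++ y ++ (b :: z)).length)) :
    ReflTransGen ((D.elimReg r s₀).InnerStep (X ++ y' ++ (b :: z))) c'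
      (τ, s.exit (X ++ y' ++ (b :: z)).length) := by
  have hacc := acc_of_reaches_exit hr
  induction hacc generalizing c' with
  | intro c hacc ih =>
    -- The run of the second word follows the run of the first one from one configuration outside
    -- of the segment to the next one.
    have cont : ∀ {d d'}, RegCorr X.length y.length y'.length e d d' →
        TransGen ((D.elimReg r s₀).InnerStep (X ++ y ++ (b :: z))) c d →
        ReflTransGen ((D.elimReg r s₀).InnerStep (X ++ y' ++ (b :: z))) c' d' →
        ReflTransGen ((D.elimReg r s₀).InnerStep (X ++ y' ++ (b :: z))) c'
          (τ, s.exit (X ++ y' ++ (b :: z)).length) := fun hd h1 h2 =>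
      h2.trans (ih _ h1 hd (reach_stop_of_reach (innerStep_rightUnique _ _)
        (not_innerStep_exit _ _ _ _) hr h1.to_reflTransGen))
    rcases ReflTransGen.cases_head hr with rfl | ⟨c₁, hstep, -⟩
    · cases s with
      | left =>
        cases hc with
        | left => exact .refl
        | right σ j _ _ _ h0 => simp [Side.exit] at h0; omega
      | right =>
        cases hc with
        | left _ _ hk => simp [Side.exit] at hk
        | right _ j _ _ k' h0 h1 =>
          rw [show k' = Side.exit (X ++ y' ++ (b :: z)).length .right by
            simp [Side.exit] at h0 ⊢; omega]
    · have hn := innerStep_near hstep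
      have hstep' := hstep
      rw [innerStep_iff] at hstep'
      obtain ⟨k, l, hk, hl, h1, h2⟩ := hstep'
      cases hc with
      | left σ i hi hs =>
        simp only at hn hk h1 h2
        have hl1 : X[k]? = some l := by
          rw [← hl, List.append_assoc, List.getElem?_append_left (by omega)]
        have hout : c₁.2 ≤ X.length → ReflTransGen
            ((D.elimReg r s₀).InnerStep (X ++ y' ++ (b :: z))) (σ, i)
            (τ, s.exit (X ++ y' ++ (b :: z)).length) := by
          intro hc₁
          refine cont (d := c₁) (d' := c₁) (.left c₁.1 c₁.2 hc₁ ?_) (.single hstep)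
            (.single (innerStep_of_getElem? (k := k) (a := l) ?_ hk h1 h2))
          · intro hc₂ q hq
            have := move_of_search (h1.symm.trans hq)
            rw [this] at h2
            simp at h2
            omega
          · rw [List.append_assoc, List.getElem?_append_left (by omega), hl1]
        by_cases hc₁ : c₁.2 ≤ X.length
        · exact hout hc₁
        obtain rfl : i = X.length := by omega
        obtain rfl : l = a := by
          rw [List.getLast?_eq_getElem?, show X.length - 1 = k by omega, hl1] at hX
          simpa using hX
        have hm : ((D.elimReg r s₀).δ σ (.letter l)).2 = 1 := by
          generalize ((D.elimReg r s₀).δ σ (.letter l)).2 = m at h2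
          cases m <;> simp at h2 ⊢ <;> omega
        have hs := hs rfl
        -- The step enters the segment, and it simulates a step of `D`.
        obtain ⟨q, hq⟩ : ∃ q, ((D.elimReg r s₀).δ σ (.letter l)).1 = go q t := by
          cases σ with
          | go p s =>
            revert hm
            simp only [elimReg, regδ]
            split <;> simp [regStep, hra]
          | back p s => simp [elimReg, regδ, hra] at hm
          | search q => exact absurd rfl (hs q)
          | ret q s => simp [elimReg, regδ, hra] at hm
        have hc₁' : c₁ = regEmb r t y X.length (q, Side.left.entry y.length) := by
          refine Prod.ext (h1.trans hq) ?_
          simp only [regEmb, Side.entry]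
          omega
        have hstep' : (D.elimReg r s₀).InnerStep (X ++ y' ++ (b :: z)) (σ, X.length)
            (regEmb r t y' X.length (q, Side.left.entry y'.length)) := by
          refine innerStep_of_getElem? (k := k) (a := l) ?_ hk hq.symm ?_
          · rw [List.append_assoc, List.getElem?_append_left (by omega), hl1]
          · simp [regEmb, Side.entry, hm]
        rw [hc₁'] at hstep
        obtain ⟨d, d', hd, hd1, hd2⟩ := enter_segment hX hra he he' h (b :: z)
          (hacc _ (.single hstep))
        exact cont hd (.head' hstep hd1) (.head hstep' hd2)
      | right σ j hs i i' hi hi' =>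
        simp only at hn hk h1 h2
        have hl1 : (b :: z)[j]? = some l := by
          rw [← hl, List.getElem?_append_right (by simp; omega)]
          congr 1
          simp
          omega
        have hl2 : (X ++ y' ++ (b :: z))[X.length + y'.length + j]? = some l := by
          rw [List.getElem?_append_right (by simp), ← hl1]
          congr 1
          simp
        have hout : ∀ j₁, c₁.2 = X.length + y.length + 1 + j₁ →
            (j₁ = 0 → (∀ q s, c₁.1 = go q s → s = e) ∧ ∀ q s, c₁.1 ≠ ret q s) →
            ReflTransGen ((D.elimReg r s₀).InnerStep (X ++ y' ++ (b :: z))) (σ, i')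
            (τ, s.exit (X ++ y' ++ (b :: z)).length) := by
          intro j₁ hc₁ hj₁
          refine cont (d := c₁) (d' := (c₁.1, X.length + y'.length + 1 + j₁))
            (.right c₁.1 j₁ hj₁ _ _ hc₁ rfl) (.single hstep)
            (.single (innerStep_of_getElem? hl2 ?_ h1 ?_))
          · simp only; omega
          · simp only; omega
        have hneg : c₁.2 + 1 = i →
            (∀ q s, c₁.1 = go q s → s = e) ∧ ∀ q s, c₁.1 ≠ ret q s := by
          intro hc₁
          have hm : ((D.elimReg r s₀).δ σ (.letter l)).2 = -1 := by
            generalize ((D.elimReg r s₀).δ σ (.letter l)).2 = m at h2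
            cases m <;> simp at h2 ⊢ <;> omega
          rcases state_of_move_neg hm with ⟨q, s, hq⟩ | ⟨q, hq⟩ <;> simp [h1, hq]
        rcases j with _ | j
        · obtain rfl : l = b := by simpa using hl1.symm
          obtain ⟨hs1, hs2⟩ := hs rfl
          cases σ with
          | go p s =>
            obtain rfl := hs1 p s rfl
            simp only [elimReg, regδ] at h1 h2
            rcases hm : (D.δ p (Marked.pair s (.letter l))).2 with _ | _ | _
            · rw [hm] at h1 h2
              simp at h1 h2
              exact hout 0 (by omega) (by simp [h1])
            · rw [hm] at h1 h2
              simp only [SignType.coe_neg, SignType.coe_one] at h1 h2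
              have hc₁' : c₁ = (back (D.δ p (Marked.pair s (.letter l))).1 s,
                  X.length + y.length) := Prod.ext h1 (by simp only; omega)
              have hstep' : (D.elimReg r s₀).InnerStep (X ++ y' ++ (l :: z)) (go p s, i')
                  (back (D.δ p (Marked.pair s (.letter l))).1 s, X.length + y'.length) := by
                refine innerStep_of_getElem? hl2 (by simp only; omega) ?_ ?_
                · simp [elimReg, regδ, hm]
                · simp [elimReg, regδ, hm]
                  omega
              have hb := back_reaches_entry (D := D) (s₀ := s₀) hX hra he (l :: z)
                (D.δ p (Marked.pair s (.letter l))).1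
              have hb' := back_reaches_entry (D := D) (s₀ := s₀) hX hra he' (l :: z)
                (D.δ p (Marked.pair s (.letter l))).1
              rw [hc₁'] at hstep
              obtain ⟨d, d', hd, hd1, hd2⟩ := enter_segment (x := .right) hX hra he he' h (l :: z)
                (hacc _ (.head' hstep hb))
              exact cont hd (.head' hstep (hb.trans hd1)) (.head hstep' (hb'.trans hd2))
            · rw [hm] at h1 h2
              simp at h1 h2
              exact hout 1 (by omega) (by simp)
          | back q s =>
            have h3 := excursion_from_right (D := D) (s₀ := s₀) (z := z) hX hra hrb he q s
            have h4 := excursion_from_right (D := D) (s₀ := s₀) (z := z) hX hra hrb he' q s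
            obtain rfl : i = X.length + y.length + 1 := hi
            obtain rfl : i' = X.length + y'.length + 1 := hi'
            exact cont (.right (go q e) 0 (by simp) _ _ rfl rfl) h3 h4.to_reflTransGen
          | search q =>
            obtain ⟨v, hv⟩ := Option.ne_none_iff_exists'.1 hrb
            simp [elimReg, regδ, hv] at h1 h2
            exact hout 1 (by omega) (by simp)
          | ret q s => exact absurd rfl (hs2 q s)
        · by_cases hc₁ : c₁.2 + 1 = i
          · exact hout j (by omega) fun _ => hneg hc₁
          · exact hout (c₁.2 - (X.length + y.length + 1)) (by omega) (by omega)

/-- Segments with the same behaviors under `D` are exchangeable between two letters that set the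
register. The outer words `x` and `z` keep the ends of the whole word away from these letters. -/
theorem behaviorEquiv_of_set {x z : List A} (hra : r a = some t) (hrb : r b ≠ none)
    (he : y.foldl (regStep r) t = e) (he' : y'.foldl (regStep r) t = e)
    (h : D.BehaviorEquiv (annot (regStep r) t y) (annot (regStep r) t y'))
    (hx : x ≠ []) (hz : z ≠ []) :
    (D.elimReg r s₀).BehaviorEquiv (x ++ [a] ++ y ++ (b :: z)) (x ++ [a] ++ y' ++ (b :: z)) := by
  have hxl := List.length_pos_iff.2 hx
  have hzl := List.length_pos_iff.2 hz
  have main : ∀ {y y' : List A}, y.foldl (regStep r) t = e → y'.foldl (regStep r) t = e →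
      D.BehaviorEquiv (annot (regStep r) t y) (annot (regStep r) t y') → ∀ i o,
      (D.elimReg r s₀).behavior i o (x ++ [a] ++ y ++ (b :: z)) ⊆
        (D.elimReg r s₀).behavior i o (x ++ [a] ++ y' ++ (b :: z)) := by
    intro y y' he he' h i o
    rintro ⟨σ, τ⟩ hστ
    refine regCorr_run (by simp) hra hrb he he' h ?_ hστ
    cases i with
    | left => exact .left _ _ (by simp [Side.entry]) (by simp [Side.entry]; grind)
    | right =>
      exact .right _ z.length (by omega) _ _ (by simp [Side.entry]; omega)
        (by simp [Side.entry]; omega)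
  exact fun i o => Set.Subset.antisymm (main he he' h i o) (main he' he h.symm i o)

end Set

theorem foldl_regStep_const {w : List A} {a : A} (ha : a ∈ w) (hra : r a ≠ none) (s s' : S) :
    w.foldl (regStep r) s = w.foldl (regStep r) s' := by
  obtain ⟨x, z, rfl⟩ := List.append_of_mem ha
  obtain ⟨v, hv⟩ := Option.ne_none_iff_exists'.1 hra
  simp [regStep, hv]

/-- Either no letter of `w` sets the register, and its powers are compared directly, or the register
has the same value after each copy of `w`; then all but the outer copies of `w` in a power lie
between two letters that set the register, and carry the annotation of a power. -/
theorem elimReg_isAperiodic (h : D.IsAperiodic) : (D.elimReg r s₀).IsAperiodic := by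
  rw [IsAperiodic, isAperiodicMonoid_iff] at h ⊢
  obtain ⟨n, hn⟩ := h
  refine ⟨n + 5, fun w => ?_⟩
  by_cases hw : ∀ a ∈ w, r a = none
  · rcases eq_or_ne w [] with rfl | hne
    · rw [wordPow_nil, wordPow_nil]
      exact .rfl
    have hk : ∀ m, ∀ a ∈ wordPow w m, r a = none := fun m a ha => hw a (mem_wordPow ha)
    have hp : ∀ m, wordPow w (m + 1) ≠ [] := fun m hm => hne (by
      rw [wordPow_succ, List.append_eq_nil_iff] at hm
      exact hm.1)
    have hb : ∀ s, D.BehaviorEquiv (annot (regStep r) s (wordPow w (n + 5)))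
        (annot (regStep r) s (wordPow w (n + 5 + 1))) := by
      intro s
      rw [annot_wordPow (foldl_regStep_of_keep hw s), annot_wordPow (foldl_regStep_of_keep hw s)]
      exact behaviorEquiv_wordPow_of_le (by omega) (hn _)
    exact fun x z => Set.Subset.antisymm
      (behavior_subset_of_keep (hk _) (hk _) (hp _) (hp _) hb x z)
      (behavior_subset_of_keep (hk _) (hk _) (hp _) (hp _) (fun s => (hb s).symm) x z)
  · push Not at hw
    obtain ⟨a, ha, hra⟩ := hw
    obtain ⟨t, ht⟩ := Option.ne_none_iff_exists'.1 hra
    have hconst := foldl_regStep_const (r := r) ha hra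
    obtain ⟨x, z, hxz⟩ := List.append_of_mem ha
    have hne : w ≠ [] := by rw [hxz]; simp
    -- After a first copy of `w`, the register has the same value `e` after each copy.
    set e := w.foldl (regStep r) t with he
    have hz : z.foldl (regStep r) t = e := by
      rw [he, hxz]
      simp [regStep, ht]
    have hee : w.foldl (regStep r) e = e := hconst e t
    have key := behaviorEquiv_of_set (D := D) (s₀ := s₀) (x := w ++ x) (z := z ++ w)
      (y := z ++ wordPow w (n + 1) ++ x) (y' := z ++ wordPow w (n + 2) ++ x)
      (e := x.foldl (regStep r) e) ht hra
      (by rw [List.foldl_append, List.foldl_append, hz, foldl_wordPow hee])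
      (by rw [List.foldl_append, List.foldl_append, hz, foldl_wordPow hee])
      (by
        rw [annot_append, annot_append, annot_append, annot_append, List.foldl_append,
          List.foldl_append, hz, foldl_wordPow hee, foldl_wordPow hee, annot_wordPow hee,
          annot_wordPow hee]
        exact (behaviorEquiv_wordPow_of_le (Nat.le_succ n) (hn _)).context _ _)
      (by simp [hne]) (by simp [hne])
    have hpow : ∀ m, w ++ x ++ [a] ++ (z ++ wordPow w m ++ x) ++ (a :: (z ++ w)) =
        wordPow w (m + 4) := by
      intro m
      have : wordPow w (m + 4) = w ++ (w ++ (wordPow w m ++ (w ++ w))) := by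
        rw [show m + 4 = 1 + (1 + (m + (1 + 1))) by omega]
        simp only [wordPow_add, wordPow_one]
      rw [this]
      conv_rhs => rw [hxz]
      conv_lhs => rw [hxz]
      simp
    rw [hpow, hpow] at key
    exact key

end Aperiodic

end TwoWayTransducer

/-! ### Cascades of registers -/

/-- The length-preserving functions that are computed by cascades of registers. -/
inductive Cascade : {A A' : Type v} → (List A → List A') → Prop
  | map {A A' : Type v} (g : A → A') : Cascade (List.map g)
  | reg {A : Type v} {S : Type} [Finite S] (r : A → Option S) (s₀ : S) :
      Cascade (annot (regStep r) s₀)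
  | comp {A₁ A₂ A₃ : Type v} {f : List A₁ → List A₂} {g : List A₂ → List A₃} :
      Cascade f → Cascade g → Cascade (g ∘ f)

/-- The annotation `f` of the input words can be eliminated: each aperiodic transducer reading the
annotated words can be replaced by an aperiodic transducer reading the original words. -/
def Eliminable (B : Type w) {A A' : Type v} (f : List A → List A') : Prop :=
  ∀ (Q : Type u) [Finite Q] (D : TwoWayTransducer Q A' B), D.IsAperiodic →
    ∃ (P : Type u) (_ : Finite P) (C : TwoWayTransducer P A B),
      C.IsAperiodic ∧ ∀ u v, C.IsImage u v ↔ D.IsImage (f u) v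

theorem Eliminable.comp {B : Type w} {A₁ A₂ A₃ : Type v} {f : List A₁ → List A₂}
    {g : List A₂ → List A₃} (hf : Eliminable.{u} B f) (hg : Eliminable.{u} B g) :
    Eliminable.{u} B (g ∘ f) := by
  intro Q _ D hD
  obtain ⟨P, _, C, hC, h⟩ := hg Q D hD
  obtain ⟨P', hP', C', hC', h'⟩ := hf P C hC
  exact ⟨P', hP', C', hC', fun u v => (h' u v).trans (h _ v)⟩

theorem eliminable_map (B : Type w) {A A' : Type v} (g : A → A') :
    Eliminable.{u} B (List.map g) :=
  fun Q hQ D hD => ⟨Q, hQ, D.comapLetters g, TwoWayTransducer.isAperiodic_comapLetters g hD,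
    fun _ _ => TwoWayTransducer.comapLetters_isImage⟩

theorem Cascade.eliminable {B : Type w} {A A' : Type v} {f : List A → List A'} (h : Cascade f) :
    Eliminable.{u} B f := by
  induction h with
  | map g => exact eliminable_map B g
  | reg r s₀ =>
    exact fun Q _ D hD => ⟨RegState Q _, RegState.finite, D.elimReg r s₀,
      TwoWayTransducer.elimReg_isAperiodic hD, fun _ _ => TwoWayTransducer.elimReg_isImage⟩
  | comp _ _ ih₁ ih₂ => exact ih₁.comp ih₂

/-- The function `f` applied from right to left. -/
def mirrorFun {A A' : Type*} (f : List A → List A') (u : List A) : List A' :=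
  (f u.reverse).reverse

theorem Cascade.eliminable_mirrorFun {B : Type w} {A A' : Type v} {f : List A → List A'}
    (h : Cascade f) : Eliminable.{u} B (mirrorFun f) := by
  induction h with
  | map g =>
    convert eliminable_map.{u} B g using 1
    funext u
    simp [mirrorFun]
  | reg r s₀ =>
    refine fun Q _ D hD => ⟨RegState Q _, RegState.finite, D.elimRegRight r s₀, ?_,
      fun _ _ => TwoWayTransducer.elimRegRight_isImage⟩
    have := TwoWayTransducer.isAperiodic_mirror (TwoWayTransducer.elimReg_isAperiodic (r := r)
      (s₀ := s₀) (TwoWayTransducer.isAperiodic_mirror hD))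
    -- The transition monoid does not depend on the initial state.
    rw [TwoWayTransducer.IsAperiodic, TwoWayAutomaton.isAperiodicMonoid_iff] at this ⊢
    exact this
  | @comp _ _ _ f g _ _ ih₁ ih₂ =>
    have : mirrorFun (g ∘ f) = mirrorFun g ∘ mirrorFun f := by
      funext u
      simp [mirrorFun]
    rw [this]
    exact ih₁.comp ih₂

/-! ### Aperiodic one-way automata are cascades of registers -/

/-- The maps in the monoid generated by `G`. -/
inductive Generated {S : Type*} (G : Set (S → S)) : (S → S) → Prop
  | id : Generated G id
  | comp {x f : S → S} : x ∈ G → Generated G f → Generated G (x ∘ f)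

theorem Generated.trans {S : Type*} {G : Set (S → S)} {f g : S → S} (hf : Generated G f)
    (hg : Generated G g) : Generated G (g ∘ f) := by
  induction hg with
  | id => exact hf
  | @comp x g hx _ ih => exact .comp (f := g ∘ f) hx ih

theorem Generated.mono {S : Type*} {G G' : Set (S → S)} (h : G ⊆ G') {f : S → S}
    (hf : Generated G f) : Generated G' f := by
  induction hf with
  | id => exact .id
  | comp hx _ ih => exact .comp (h hx) ih

/-- The monoid generated by `G` is aperiodic. -/
def AperiodicMaps {S : Type*} (G : Set (S → S)) : Prop :=
  ∃ n : ℕ, ∀ f, Generated G f → f^[n] = f^[n + 1]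

/-- In an aperiodic monoid only the identity is a permutation, so that every other generator acts on a
smaller set. This makes the induction on the number of states work. -/
theorem AperiodicMaps.not_surjective {S : Type*} [Finite S] {G : Set (S → S)}
    (h : AperiodicMaps G) {c : S → S} (hc : c ∈ G) (hid : c ≠ id) : ¬ Function.Surjective c := by
  intro hs
  obtain ⟨n, hn⟩ := h
  have hi : Function.Injective c := Finite.injective_iff_surjective.2 hs
  refine hid (funext fun s => ?_)
  have := congrFun (hn c (.comp hc .id)) s
  rw [Function.iterate_succ_apply] at this
  exact ((hi.iterate n) this).symm

/-- The automaton whose state is the composition of the maps `ρ a` for the letters `a` since the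
last letter with `ρ a = none`. -/
def blockStep {A S : Type*} (ρ : A → Option (S → S)) (f : S → S) (a : A) : S → S :=
  match ρ a with
  | some x => x ∘ f
  | none => id

/-- The image of `ρ`. -/
def optRange {A S : Type*} (ρ : A → Option (S → S)) : Set (S → S) := {x | ∃ a, ρ a = some x}

section Step

variable {A : Type v} {S : Type} (ρ : A → Option (S → S)) (c : S → S)

open Classical in
/-- Letters acting by `c` start new blocks. -/
noncomputable def blockMap (a : A) : Option (S → S) := if ρ a = some c then none else ρ a

open Classical in
/-- The register that remembers whether a letter acting by `c` has occurred since the last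
reset. -/
noncomputable def seenReg (a : A × (S → S)) : Option Bool :=
  if ρ a.1 = none then some false else if ρ a.1 = some c then some true else none

open Classical in
/-- The register that stores the map of the block before the first letter acting by `c`. -/
noncomputable def firstReg (a : (A × (S → S)) × Bool) : Option (S → S) :=
  if ρ a.1.1 = some c ∧ a.2 = false then some a.1.2 else none

/-- The map `y` followed by `c`, on the range of `c`. -/
def restrictRange (y : S → S) (s : Set.range c) : Set.range c := ⟨c (y s), y s, rfl⟩

open Classical in
/-- The letters acting by `c`, together with the blocks before them, act on the range of `c`. -/
noncomputable def rangeMap (a : ((A × (S → S)) × Bool) × (S → S)) :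
    Option (Set.range c → Set.range c) :=
  if ρ a.1.1.1 = none then none
  else if ρ a.1.1.1 = some c then
    if a.1.2 = false then none
    else if Generated (optRange ρ) a.1.1.2 then some (restrictRange c a.1.1.2) else some id
  else some id

/-- The map of the letters since the last reset, from the map `y` of the last block, the map `w` of
the first block and the map `g` on the range of `c` of what lies between. -/
def assemble (y : S → S) (b : Bool) (w : S → S) (g : Set.range c → Set.range c) : S → S :=
  if b then fun s => y (g ⟨c (w s), w s, rfl⟩) else y

/-- The simulation of an automaton by the one with blocks cut at the letters acting by `c`, two
registers, and an automaton with the range of `c` as its set of states. -/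
theorem assemble_annot (l : List A) {y : S → S} (b : Bool) (w : S → S)
    (g : Set.range c → Set.range c) (hy : Generated (optRange ρ) y) :
    (annot (blockStep (rangeMap ρ c)) g (annot (regStep (firstReg ρ c)) w
      (annot (regStep (seenReg ρ c)) b (annot (blockStep (blockMap ρ c)) y l)))).map
      (fun a => (a.1.1.1.1, assemble c a.1.1.1.2 a.1.1.2 a.1.2 a.2)) =
    annot (blockStep ρ) (assemble c y b w g) l := by
  induction l generalizing y b w g with
  | nil => rfl
  | cons a l ih =>
    simp only [annot, List.map_cons]
    congr 1
    rcases h : ρ a with _ | x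
    · rw [ih]
      · congr 1
        simp [assemble, blockStep, blockMap, regStep, seenReg, h]
      · simp only [blockStep, blockMap, h]
        exact .id
    · by_cases hx : x = c
      · subst hx
        rw [ih]
        · congr 1
          cases b
          · funext s
            simp [assemble, blockStep, blockMap, regStep, seenReg, firstReg, rangeMap, h]
          · funext s
            simp [assemble, blockStep, blockMap, regStep, seenReg, firstReg, rangeMap, h, hy,
              restrictRange]
        · simp only [blockStep, blockMap, h, if_true]
          exact .id
      · rw [ih]
        · congr 1
          cases b
          · funext s
            simp [assemble, blockStep, blockMap, regStep, seenReg, h, hx]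
          · funext s
            simp [assemble, blockStep, blockMap, regStep, seenReg, firstReg, rangeMap, h, hx]
        · simp only [blockStep, blockMap, h, Option.some.injEq, hx, if_false]
          exact .comp ⟨a, h⟩ hy

/-- Each map on the range of `c` is the restriction of a map of the original monoid. -/
theorem aperiodicMaps_rangeMap (hc : c ∈ optRange ρ) (h : AperiodicMaps (optRange ρ)) :
    AperiodicMaps (optRange (rangeMap ρ c)) := by
  obtain ⟨n, hn⟩ := h
  have key : ∀ g, Generated (optRange (rangeMap ρ c)) g →
      ∃ f, Generated (optRange ρ) f ∧ ∀ s, (g s : S) = f s := by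
    intro g hg
    induction hg with
    | id => exact ⟨id, .id, fun _ => rfl⟩
    | @comp x g hx _ ih =>
      obtain ⟨f, hf, hgf⟩ := ih
      obtain ⟨a, ha⟩ := hx
      unfold rangeMap at ha
      split_ifs at ha with h1 h2 h3 h4 <;> simp only [Option.some.injEq] at ha <;> subst ha
      · exact ⟨c ∘ (a.1.1.2 ∘ f), .comp hc (hf.trans h4), fun s => by simp [restrictRange, hgf]⟩
      · exact ⟨f, hf, hgf⟩
      · exact ⟨f, hf, hgf⟩
  have hiter : ∀ {g : Set.range c → Set.range c} {f : S → S}, (∀ s, (g s : S) = f s) →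
      ∀ k s, ((g^[k]) s : S) = (f^[k]) s := by
    intro g f hgf k
    induction k with
    | zero => exact fun _ => rfl
    | succ k ih => exact fun s => by rw [Function.iterate_succ_apply, ih, hgf]; rfl
  refine ⟨n, fun g hg => ?_⟩
  obtain ⟨f, hf, hgf⟩ := key g hg
  funext s
  exact Subtype.ext (by rw [hiter hgf, hiter hgf, hn f hf])

end Step

/-- The induction is on the number `N` of states and then on the number `M` of maps other than the
identity: cutting blocks at one of these maps makes `M` smaller, and its range makes `N` smaller. -/
theorem cascade_annot_blockStep_aux (N : ℕ) : ∀ (M : ℕ) (S : Type) [Finite S], Nat.card S = N →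
    ∀ (A : Type v) (ρ : A → Option (S → S)), (optRange ρ \ {id}).ncard = M →
      AperiodicMaps (optRange ρ) → Cascade (annot (blockStep ρ) id) := by
  induction N using Nat.strong_induction_on with
  | _ N ihN =>
  intro M
  induction M using Nat.strong_induction_on with
  | _ M ihM =>
  intro S _ hS A ρ hM hρ
  rcases Set.eq_empty_or_nonempty (optRange ρ \ {id}) with h0 | ⟨c, hc, hcid⟩
  · have hst : ∀ a, blockStep ρ id a = id := by
      intro a
      unfold blockStep
      split
      · rename_i x hx
        by_contra hne
        exact (h0 ▸ (⟨⟨a, hx⟩, hne⟩ : x ∈ optRange ρ \ {id}) : x ∈ (∅ : Set (S → S)))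
      · rfl
    have : annot (blockStep ρ) id = List.map fun a => (a, id) := by
      funext l
      induction l with
      | nil => rfl
      | cons a l ih => rw [annot, hst, ih, List.map_cons]
    rw [this]
    exact .map _
  · have hsub : optRange (blockMap ρ c) ⊆ optRange ρ \ {c} := by
      rintro x ⟨a, ha⟩
      unfold blockMap at ha
      split_ifs at ha with h
      exact ⟨⟨a, ha⟩, fun hx => h (hx ▸ ha)⟩
    have h1 : Cascade (annot (blockStep (blockMap ρ c)) id) := by
      refine ihM _ ?_ S hS A _ rfl ?_
      · rw [← hM]
        refine Set.ncard_lt_ncard (Set.ssubset_iff_subset_ne.2 ⟨?_, ?_⟩) (Set.toFinite _)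
        · exact fun x hx => ⟨(hsub hx.1).1, hx.2⟩
        · intro he
          have : c ∈ optRange (blockMap ρ c) \ {id} := he ▸ ⟨hc, hcid⟩
          exact (hsub this.1).2 rfl
      · obtain ⟨n, hn⟩ := hρ
        exact ⟨n, fun f hf => hn f (hf.mono fun x hx => (hsub hx).1)⟩
    have h2 : Cascade (annot (regStep (seenReg ρ c)) false) := .reg _ _
    have h3 : Cascade (annot (regStep (firstReg ρ c)) id) := .reg _ _
    have h4 : Cascade (annot (blockStep (rangeMap ρ c)) id) := by
      refine ihN _ ?_ _ (Set.range c) rfl _ _ rfl (aperiodicMaps_rangeMap ρ c hc hρ)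
      rw [← hS]
      rw [Nat.card_coe_set_eq, ← Set.ncard_univ]
      exact Set.ncard_lt_ncard (Set.ssubset_univ_iff.2 fun hu =>
        hρ.not_surjective hc hcid (Set.range_eq_univ.1 hu)) (Set.toFinite _)
    convert (((h1.comp h2).comp h3).comp h4).comp
      (.map fun a => (a.1.1.1.1, assemble c a.1.1.1.2 a.1.1.2 a.1.2 a.2)) using 1
    funext l
    exact (assemble_annot ρ c l false id id .id).symm

/-- A one-way automaton with an aperiodic monoid of transformations is a cascade of registers. -/
theorem cascade_annot {A : Type v} {S : Type} [Finite S] (st : S → A → S) (s₀ : S)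
    (h : AperiodicMaps {x | ∃ a, x = fun s => st s a}) : Cascade (annot st s₀) := by
  have hr : optRange (fun a : A => some fun s => st s a) = {x | ∃ a, x = fun s => st s a} := by
    ext x
    simp [optRange, eq_comm]
  have := cascade_annot_blockStep_aux (Nat.card S) _ S rfl A (fun a => some fun s => st s a) rfl
    (by rwa [hr])
  have key : ∀ (l : List A) (f : S → S),
      (annot (blockStep fun a : A => some fun s => st s a) f l).map (fun a => (a.1, a.2 s₀)) =
        annot st (f s₀) l := by
    intro l
    induction l with
    | nil => exact fun _ => rfl
    | cons a l ih =>
      intro f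
      simp only [annot, List.map_cons, ih]
      rfl
  convert this.comp (.map fun a => (a.1, a.2 s₀)) using 1
  funext l
  exact (key l id).symm

/-! ### Aperiodic invariants of words -/

/-- The kernel of `φ` is a congruence on the words over `A`, and the quotient is an aperiodic
monoid. -/
structure AperiodicInvariant {A X : Type*} (φ : List A → X) : Prop where
  congr : ∀ {u u' : List A}, φ u = φ u' → ∀ x y, φ (x ++ u ++ y) = φ (x ++ u' ++ y)
  aper : ∃ n, ∀ u, φ (wordPow u n) = φ (wordPow u (n + 1))

namespace AperiodicInvariant

variable {A A' X Y : Type*} {φ : List A → X}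

theorem congr_left (h : AperiodicInvariant φ) {u u' : List A} (hu : φ u = φ u') (x : List A) :
    φ (x ++ u) = φ (x ++ u') := by
  simpa using h.congr hu x []

theorem congr_right (h : AperiodicInvariant φ) {u u' : List A} (hu : φ u = φ u') (y : List A) :
    φ (u ++ y) = φ (u' ++ y) := by
  simpa using h.congr hu [] y

theorem wordPow_eq (h : AperiodicInvariant φ) :
    ∃ n, ∀ m, n ≤ m → ∀ u, φ (wordPow u m) = φ (wordPow u (m + 1)) := by
  obtain ⟨n, hn⟩ := h.aper
  refine ⟨n, fun m hm u => ?_⟩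
  obtain ⟨k, rfl⟩ := Nat.exists_eq_add_of_le hm
  rw [wordPow_add, show n + k + 1 = n + 1 + k by omega, wordPow_add]
  exact h.congr_right (hn u) _

theorem reverse (h : AperiodicInvariant φ) : AperiodicInvariant fun u => φ u.reverse where
  congr hu x y := by
    simp only [List.reverse_append, ← List.append_assoc]
    simpa using h.congr hu y.reverse x.reverse
  aper := by
    obtain ⟨n, hn⟩ := h.aper
    exact ⟨n, fun u => by rw [wordPow_reverse, wordPow_reverse, hn]⟩

theorem comp_map (h : AperiodicInvariant φ) (f : A' → A) :
    AperiodicInvariant fun u : List A' => φ (u.map f) where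
  congr hu x y := by simpa using h.congr hu (x.map f) (y.map f)
  aper := by
    obtain ⟨n, hn⟩ := h.aper
    exact ⟨n, fun u => by rw [wordPow_map, wordPow_map, hn]⟩

theorem prod {ψ : List A → Y} (h : AperiodicInvariant φ) (h' : AperiodicInvariant ψ) :
    AperiodicInvariant fun u => (φ u, ψ u) where
  congr hu x y := by
    rw [Prod.mk.injEq] at hu
    rw [h.congr hu.1, h'.congr hu.2]
  aper := by
    obtain ⟨n, hn⟩ := h.wordPow_eq
    obtain ⟨m, hm⟩ := h'.wordPow_eq
    exact ⟨max n m, fun u => by rw [hn _ (le_max_left _ _), hm _ (le_max_right _ _)]⟩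

end AperiodicInvariant

section Representatives

variable {A : Type v} {X : Type} {φ : List A → X}

/-- A word with value `x`. -/
noncomputable def rep (hs : Function.Surjective φ) (x : X) : List A := Function.surjInv hs x

theorem apply_rep (hs : Function.Surjective φ) (x : X) : φ (rep hs x) = x :=
  Function.surjInv_eq hs x

/-- The value of `u a` from the value of `u`. -/
noncomputable def valSnoc (hs : Function.Surjective φ) (x : X) (a : A) : X := φ (rep hs x ++ [a])

/-- The value of `a u` from the value of `u`. -/
noncomputable def valCons (hs : Function.Surjective φ) (a : A) (x : X) : X := φ (a :: rep hs x)

theorem valSnoc_apply (h : AperiodicInvariant φ) (hs : Function.Surjective φ) (u : List A) (a : A) :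
    valSnoc hs (φ u) a = φ (u ++ [a]) :=
  h.congr_right (apply_rep hs _) _

theorem valCons_apply (h : AperiodicInvariant φ) (hs : Function.Surjective φ) (u : List A) (a : A) :
    valCons hs a (φ u) = φ (a :: u) :=
  h.congr_left (apply_rep hs (φ u)) [a]

theorem foldl_valSnoc (h : AperiodicInvariant φ) (hs : Function.Surjective φ) (u w : List A) :
    w.foldl (valSnoc hs) (φ u) = φ (u ++ w) := by
  induction w generalizing u with
  | nil => simp
  | cons a w ih => rw [List.foldl_cons, valSnoc_apply h hs, ih]; simp

theorem cascade_annot_valSnoc [Finite X] (h : AperiodicInvariant φ) (hs : Function.Surjective φ) :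
    Cascade (annot (valSnoc hs) (φ [])) := by
  refine cascade_annot _ _ ?_
  obtain ⟨n, hn⟩ := h.aper
  refine ⟨n, fun f hf => ?_⟩
  obtain ⟨w, hw⟩ : ∃ w : List A, ∀ u, f (φ u) = φ (u ++ w) := by
    induction hf with
    | id => exact ⟨[], fun u => by simp⟩
    | comp hx _ ih =>
      obtain ⟨a, rfl⟩ := hx
      obtain ⟨w, hw⟩ := ih
      exact ⟨w ++ [a], fun u => by
        rw [Function.comp_apply, hw, valSnoc_apply h hs, List.append_assoc]⟩
  have hk : ∀ k u, (f^[k]) (φ u) = φ (u ++ wordPow w k) := by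
    intro k
    induction k with
    | zero => intro u; simp [wordPow_zero]
    | succ k ih => intro u; rw [Function.iterate_succ_apply, hw, ih, wordPow_succ]; simp
  funext x
  obtain ⟨u, rfl⟩ := hs x
  rw [hk, hk]
  exact h.congr_left (hn w) u

end Representatives

/-! ### Star-free languages have aperiodic invariants -/

/-- The language is a union of fibres of `φ`. -/
def Saturates {α X : Type*} (φ : List α → X) (L : Language α) : Prop :=
  ∀ ⦃u u'⦄, φ u = φ u' → u ∈ L → u' ∈ L

/-- The values of the two parts of `u`, for all factorizations of `u` into two parts. -/
def splits {α X : Type*} (φ : List α → X) (u : List α) : Set (X × X) :=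
  {p | ∃ s t, u = s ++ t ∧ p = (φ s, φ t)}

section Splits

variable {α X : Type*} {φ : List α → X}

theorem splits_subset (h : AperiodicInvariant φ) {u u' : List α} (hu : φ u = φ u')
    (hs : splits φ u ⊆ splits φ u') (x y : List α) :
    splits φ (x ++ u ++ y) ⊆ splits φ (x ++ u' ++ y) := by
  rintro _ ⟨s, t, hst, rfl⟩
  rw [List.append_assoc] at hst
  rcases List.append_eq_append_iff.1 hst with ⟨c, rfl, hc⟩ | ⟨c, rfl, rfl⟩
  · rcases List.append_eq_append_iff.1 hc with ⟨d, rfl, rfl⟩ | ⟨d, rfl, rfl⟩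
    · refine ⟨x ++ (u' ++ d), t, by simp, ?_⟩
      rw [Prod.mk.injEq]
      exact ⟨by simpa using h.congr hu x d, rfl⟩
    · obtain ⟨c', d', rfl, hcd⟩ := hs ⟨c, d, rfl, rfl⟩
      rw [Prod.mk.injEq] at hcd
      refine ⟨x ++ c', d' ++ y, by simp, ?_⟩
      rw [Prod.mk.injEq]
      exact ⟨h.congr_left hcd.1 x, h.congr_right hcd.2 y⟩
  · refine ⟨s, c ++ (u' ++ y), by simp, ?_⟩
    rw [Prod.mk.injEq]
    exact ⟨rfl, by simpa using h.congr hu c y⟩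

theorem exists_split_wordPow {u s t : List α} {m : ℕ} (h : wordPow u (m + 1) = s ++ t) :
    ∃ i j x y, i + j = m ∧ u = x ++ y ∧ s = wordPow u i ++ x ∧ t = y ++ wordPow u j := by
  induction m generalizing s with
  | zero => exact ⟨0, 0, s, t, rfl, by rwa [wordPow_one] at h, rfl, by simp [wordPow_zero]⟩
  | succ m ih =>
    rw [wordPow_succ] at h
    rcases List.append_eq_append_iff.1 h with ⟨c, rfl, hc⟩ | ⟨c, hc, rfl⟩
    · obtain ⟨i, j, x, y, rfl, hxy, rfl, rfl⟩ := ih hc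
      exact ⟨i + 1, j, x, y, by omega, hxy, by rw [wordPow_succ, List.append_assoc], rfl⟩
    · exact ⟨0, m + 1, s, c, by omega, hc, rfl, rfl⟩

theorem aperiodicInvariant_splits (h : AperiodicInvariant φ) :
    AperiodicInvariant fun u => (φ u, splits φ u) where
  congr {u u'} hu x y := by
    rw [Prod.mk.injEq] at hu ⊢
    exact ⟨h.congr hu.1 x y, Set.Subset.antisymm (splits_subset h hu.1 hu.2.subset x y)
      (splits_subset h hu.1.symm hu.2.symm.subset x y)⟩
  aper := by
    obtain ⟨n, hn⟩ := h.wordPow_eq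
    refine ⟨n + n + 1, fun u => ?_⟩
    rw [Prod.mk.injEq]
    refine ⟨hn _ (by omega) u, Set.Subset.antisymm ?_ ?_⟩
    -- One of the two parts of a long power contains many copies of `u`.
    · rintro _ ⟨s, t, hst, rfl⟩
      obtain ⟨i, j, x, y, hij, hxy, rfl, rfl⟩ := exists_split_wordPow hst
      rcases (by omega : n ≤ i ∨ n ≤ j) with hi | hj
      · refine ⟨wordPow u (i + 1) ++ x, y ++ wordPow u j, ?_, ?_⟩
        · rw [List.append_assoc, ← List.append_assoc x, ← hxy, ← wordPow_succ, ← wordPow_add]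
          congr 1
          omega
        · rw [h.congr_right (hn i hi u) x]
      · refine ⟨wordPow u i ++ x, y ++ wordPow u (j + 1), ?_, ?_⟩
        · rw [List.append_assoc, ← List.append_assoc x, ← hxy, ← wordPow_succ, ← wordPow_add]
          congr 1
          omega
        · rw [h.congr_left (hn j hj u) y]
    · rintro _ ⟨s, t, hst, rfl⟩
      obtain ⟨i, j, x, y, hij, hxy, rfl, rfl⟩ := exists_split_wordPow hst
      rcases (by omega : n + 1 ≤ i ∨ n + 1 ≤ j) with hi | hj
      · obtain ⟨i, rfl⟩ : ∃ k, i = k + 1 := ⟨i - 1, by omega⟩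
        refine ⟨wordPow u i ++ x, y ++ wordPow u j, ?_, ?_⟩
        · rw [List.append_assoc, ← List.append_assoc x, ← hxy, ← wordPow_succ, ← wordPow_add]
          congr 1
          omega
        · rw [h.congr_right (hn i (by omega) u) x]
      · obtain ⟨j, rfl⟩ : ∃ k, j = k + 1 := ⟨j - 1, by omega⟩
        refine ⟨wordPow u i ++ x, y ++ wordPow u j, ?_, ?_⟩
        · rw [List.append_assoc, ← List.append_assoc x, ← hxy, ← wordPow_succ, ← wordPow_add]
          congr 1
          omega
        · rw [h.congr_left (hn j (by omega) u) y]

end Splits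

section StarFree

variable {α : Type u}

theorem aperiodicInvariant_isEmpty : AperiodicInvariant fun u : List α => u = [] where
  congr hu x y := by simp_all
  aper := ⟨1, fun u => by simp [wordPow_succ, wordPow_zero]⟩

theorem aperiodicInvariant_letter (a : α) :
    AperiodicInvariant fun u : List α => (u = [], u = [a]) where
  congr hu x y := by
    simp only [Prod.mk.injEq] at hu
    simp [List.append_eq_singleton_iff, hu.1, hu.2]
  aper := by
    refine ⟨2, fun u => ?_⟩
    have : ∀ n, wordPow u (n + 2) ≠ [a] := by
      intro n h
      have := congrArg List.length h
      rw [wordPow_succ, wordPow_succ] at this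
      rcases u with _ | ⟨b, u⟩
      · simp [wordPow_nil] at this
      · simp at this
    rw [Prod.mk.injEq]
    refine ⟨by simp [wordPow_succ, wordPow_zero], ?_⟩
    rw [eq_iff_iff]
    exact ⟨fun h => absurd h (this 0), fun h => absurd h (this 1)⟩

theorem IsStarFree.exists_invariant {L : Language α} (h : IsStarFree L) :
    ∃ (X : Type) (_ : Finite X) (φ : List α → X), AperiodicInvariant φ ∧ Saturates φ L := by
  induction h with
  | empty => exact ⟨Unit, inferInstance, fun _ => (), ⟨fun _ _ _ => rfl, 0, fun _ => rfl⟩,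
      fun u u' _ hu => absurd hu (Language.notMem_zero u)⟩
  | emptyWord =>
    refine ⟨Prop, inferInstance, _, aperiodicInvariant_isEmpty, fun u u' he hu => ?_⟩
    rw [Language.mem_one] at hu ⊢
    exact he ▸ hu
  | letter a =>
    refine ⟨Prop × Prop, inferInstance, _, aperiodicInvariant_letter a, fun u u' he hu => ?_⟩
    simp only [Prod.mk.injEq] at he
    exact he.2.mp (show u = [a] from hu)
  | union _ _ ih₁ ih₂ =>
    obtain ⟨X, _, φ, hφ, h₁⟩ := ih₁
    obtain ⟨Y, _, ψ, hψ, h₂⟩ := ih₂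
    refine ⟨X × Y, inferInstance, _, hφ.prod hψ, fun u u' he hu => ?_⟩
    rw [Prod.mk.injEq] at he
    rw [Language.mem_add] at hu ⊢
    exact hu.imp (h₁ he.1) (h₂ he.2)
  | concat _ _ ih₁ ih₂ =>
    obtain ⟨X, _, φ, hφ, h₁⟩ := ih₁
    obtain ⟨Y, _, ψ, hψ, h₂⟩ := ih₂
    refine ⟨(X × Y) × Set ((X × Y) × (X × Y)), inferInstance, _,
      aperiodicInvariant_splits (hφ.prod hψ), fun u u' he hu => ?_⟩
    rw [Prod.mk.injEq] at he
    obtain ⟨s, hs, t, ht, rfl⟩ := Language.mem_mul.1 hu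
    obtain ⟨s', t', rfl, hst⟩ := he.2.subset ⟨s, t, rfl, rfl⟩
    simp only [Prod.mk.injEq] at hst
    exact Language.mem_mul.2 ⟨s', h₁ hst.1.1 hs, t', h₂ hst.2.2 ht, rfl⟩
  | compl _ ih =>
    obtain ⟨X, hX, φ, hφ, h⟩ := ih
    exact ⟨X, hX, φ, hφ, fun u u' he hu hu' => hu (h he.symm hu')⟩

theorem exists_common_invariant {s : Set (Language α)} (hs : s.Finite)
    (h : ∀ L ∈ s, IsStarFree L) :
    ∃ (X : Type) (_ : Finite X) (φ : List α → X),
      AperiodicInvariant φ ∧ ∀ L ∈ s, Saturates φ L := by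
  induction s, hs using Set.Finite.induction_on with
  | empty => exact ⟨Unit, inferInstance, fun _ => (), ⟨fun _ _ _ => rfl, 0, fun _ => rfl⟩, by simp⟩
  | @insert L s _ _ ih =>
    obtain ⟨X, _, φ, hφ, h₁⟩ := ih fun L hL => h L (Set.mem_insert_of_mem _ hL)
    obtain ⟨Y, _, ψ, hψ, h₂⟩ := (h L (Set.mem_insert _ _)).exists_invariant
    refine ⟨X × Y, inferInstance, _, hφ.prod hψ, fun K hK u u' he hu => ?_⟩
    rw [Prod.mk.injEq] at he
    rcases hK with rfl | hK
    · exact h₂ he.2 hu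
    · exact h₁ K hK he.1 hu

end StarFree

/-! ### Accepting paths of transducers with look-around -/

namespace StarFreeTransducer

open Relation

variable {Q A B : Type*} {T : StarFreeTransducer Q A B}

/-- A step of a run towards acceptance. -/
def LiveStep (T : StarFreeTransducer Q A B) (u : List A) (c : Q × ℕ) (v : List B) (d : Q × ℕ) :
    Prop :=
  ¬ T.IsAccepting u c ∧ T.Step u c v d

/-- A step of a run towards acceptance, without its production. -/
def Next (T : StarFreeTransducer Q A B) (u : List A) (c d : Q × ℕ) : Prop :=
  ∃ v, T.LiveStep u c v d

theorem next_rightUnique (hdet : T.IsDeterministic) (u : List A) :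
    Relator.RightUnique (T.Next u) := by
  rintro c d d' ⟨_, -, τ, hτ, hs, hsat, h1, h2, -⟩ ⟨_, -, τ', hτ', hs', hsat', h1', h2', -⟩
  obtain rfl : τ = τ' := by
    by_contra hne
    exact hdet τ hτ τ' hτ' (hs.trans hs'.symm) hne u c.2 ⟨hsat, hsat'⟩
  exact Prod.ext (h1.trans h1'.symm) (by omega)

theorem not_next_of_isAccepting {u : List A} {c : Q × ℕ} (h : T.IsAccepting u c) (d : Q × ℕ) :
    ¬ T.Next u c d := fun ⟨_, hv⟩ => hv.1 h

/-- The configuration `c` occurs in the accepting path over `u`. -/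
def OnPath (T : StarFreeTransducer Q A B) (u : List A) (c : Q × ℕ) : Prop :=
  ∃ d, T.IsAccepting u d ∧ ReflTransGen (T.Next u) (T.start, 0) c ∧ ReflTransGen (T.Next u) c d

/-- The configuration `c` occurs before `d` in the accepting path over `u`. -/
def Before (T : StarFreeTransducer Q A B) (u : List A) (c d : Q × ℕ) : Prop :=
  T.OnPath u c ∧ T.OnPath u d ∧ TransGen (T.Next u) c d

theorem OnPath.next (hdet : T.IsDeterministic) {u : List A} {c d : Q × ℕ} (hc : T.OnPath u c)
    (h : T.Next u c d) : T.OnPath u d := by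
  obtain ⟨e, he, h1, h2⟩ := hc
  exact ⟨e, he, h1.tail h, reach_stop_of_reach (next_rightUnique hdet u)
    (not_next_of_isAccepting he) h2 (.single h)⟩

theorem OnPath.not_transGen_self (hdet : T.IsDeterministic) {u : List A} {c : Q × ℕ}
    (hc : T.OnPath u c) : ¬ TransGen (T.Next u) c c := by
  obtain ⟨e, he, -, h2⟩ := hc
  exact not_transGen_self_of_stops (next_rightUnique hdet u) (not_next_of_isAccepting he) h2

section Lists

variable {C : Type*} {step : C → List B → C → Prop}

theorem _root_.Run.head_mem {c d : C} {π : List C} {v : List B} (h : Run step c π v d) : c ∈ π := by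
  cases h <;> simp

theorem _root_.Run.reaches_of_mem {c d e : C} {π : List C} {v : List B} (h : Run step c π v d)
    (he : e ∈ π) : ReflTransGen (fun c d => ∃ v, step c v d) c e ∧
      ReflTransGen (fun c d => ∃ v, step c v d) e d := by
  induction h with
  | refl c => rw [List.mem_singleton.1 he]; exact ⟨.refl, .refl⟩
  | cons hs hr ih =>
    rcases List.mem_cons.1 he with rfl | he
    · exact ⟨.refl, .head ⟨_, hs⟩ (Produces.reflTransGen ⟨_, hr⟩)⟩
    · exact ⟨.head ⟨_, hs⟩ (ih he).1, (ih he).2⟩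

theorem _root_.Run.transGen_of_sublist {c d e f : C} {π : List C} {v : List B} (h : Run step c π v d)
    (hef : [e, f].Sublist π) : TransGen (fun c d => ∃ v, step c v d) e f := by
  induction h with
  | refl c => have := hef.length_le; simp at this
  | cons hs hr ih =>
    rcases List.sublist_cons_iff.1 hef with h | ⟨r, h, hrπ⟩
    · exact ih h
    · simp only [List.cons.injEq] at h
      obtain ⟨rfl, rfl⟩ := h
      exact .head' ⟨_, hs⟩ (Run.reaches_of_mem hr (List.singleton_sublist.1 hrπ)).1

theorem _root_.Run.extend {c d e : C} {π : List C} {v : List B} (h : Run step d π v e)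
    (hcd : ReflTransGen (fun c d => ∃ v, step c v d) c d) :
    ∃ π' v', Run step c π' v' e ∧ π.Sublist π' := by
  induction hcd using ReflTransGen.head_induction_on with
  | refl => exact ⟨π, v, h, .refl _⟩
  | head hs _ ih =>
    obtain ⟨v, hs⟩ := hs
    obtain ⟨π', v', hr, hsub⟩ := ih
    exact ⟨_, _, .cons hs hr, hsub.cons _⟩

end Lists

theorem onPath_of_mem {u : List A} {π : List (Q × ℕ)} {o : List B} (h : T.IsAcceptingRun u π o)
    {c : Q × ℕ} (hc : c ∈ π) : T.OnPath u c :=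
  let ⟨d, hd, hacc⟩ := h
  ⟨d, hacc, Run.reaches_of_mem hd hc⟩

theorem OnPath.exists_run {u : List A} {c : Q × ℕ} (h : T.OnPath u c) :
    ∃ π o, T.IsAcceptingRun u π o ∧ c ∈ π := by
  obtain ⟨d, hd, h1, h2⟩ := h
  obtain ⟨π, v, hr, -⟩ := Run.extend (.refl d) h2
  obtain ⟨π', v', hr', hs⟩ := Run.extend hr h1
  exact ⟨π', v', ⟨d, hr', hd⟩, hs.subset hr.head_mem⟩

theorem Before.exists_run {u : List A} {c d : Q × ℕ} (h : T.Before u c d) :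
    ∃ π o, T.IsAcceptingRun u π o ∧ [c, d].Sublist π := by
  obtain ⟨⟨-, -, h0, -⟩, ⟨e, he, -, h2⟩, h1⟩ := h
  obtain ⟨π, v, hr, -⟩ := Run.extend (.refl e) h2
  obtain ⟨c₁, ⟨w, hs⟩, h1⟩ := TransGen.head'_iff.1 h1
  obtain ⟨π', v', hr', hs'⟩ := Run.extend hr h1
  obtain ⟨π'', v'', hr'', hs''⟩ := Run.extend (.cons hs hr') h0
  exact ⟨π'', v'', ⟨e, hr'', he⟩,
    (((List.singleton_sublist.2 hr.head_mem).trans hs').cons_cons c).trans hs''⟩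

/-- Position `i` of `v u w` and position `j` of `v u' w` are the same position of `v` or of `w`. -/
def SamePos (v u u' w : List A) (i j : ℕ) : Prop :=
  (1 ≤ i ∧ i ≤ v.length ∧ j = i) ∨
    ∃ k < w.length, i = v.length + u.length + 1 + k ∧ j = v.length + u'.length + 1 + k

theorem SamePos.symm {v u u' w : List A} {i j : ℕ} (h : SamePos v u u' w i j) :
    SamePos v u' u w j i := by
  rcases h with ⟨h1, h2, rfl⟩ | ⟨k, hk, h1, h2⟩
  · exact .inl ⟨h1, h2, rfl⟩
  · exact .inr ⟨k, hk, h2, h1⟩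

/-- The index of a position of `v` or of `w` among these positions. -/
theorem SamePos.exists_index {v u u' w : List A} {i j : ℕ} (h : SamePos v u u' w i j) :
    ∃ k : ℕ, (contextPositions v u w)[k]? = some i ∧ (contextPositions v u' w)[k]? = some j := by
  rcases h with ⟨h1, h2, rfl⟩ | ⟨k, hk, rfl, rfl⟩
  · refine ⟨j - 1, ?_, ?_⟩ <;>
    · rw [contextPositions, List.getElem?_append_left (by simp; omega), List.getElem?_range'
        (by omega)]
      simp
      omega
  · refine ⟨v.length + k, ?_, ?_⟩ <;>
    · rw [contextPositions, List.getElem?_append_right (by simp)]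
      simp [hk]

theorem nodup_contextPositions (v u w : List A) : (contextPositions v u w).Nodup := by
  rw [contextPositions, List.nodup_append]
  refine ⟨List.nodup_range' .., List.nodup_range' .., ?_⟩
  intro a ha b hb
  rw [List.mem_range'_1] at ha hb
  omega

/-- A sequence of configurations in the selected positions occurs in a path if and only if its
renaming occurs in the projection. -/
theorem sublist_projectPath {I : List ℕ} (hI : I.Nodup) {l l' : List (Q × ℕ)}
    {π : List (Q × ℕ)}
    (hl : List.Forall₂ (fun c c' => c'.1 = c.1 ∧ I[c'.2]? = some c.2) l l') :
    l.Sublist π ↔ l'.Sublist (projectPath I π) := by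
  have hmem : ∀ {c c' : Q × ℕ}, c'.1 = c.1 ∧ I[c'.2]? = some c.2 → c.2 ∈ I ∧
      (c.1, I.idxOf c.2) = c' := by
    rintro ⟨q, i⟩ ⟨q', j⟩ ⟨h1, h2⟩
    obtain ⟨hj, rfl⟩ := List.getElem?_eq_some_iff.1 h2
    exact ⟨List.getElem_mem _, Prod.ext h1.symm (hI.idxOf_getElem _ _)⟩
  have hall : ∀ c ∈ l, c.2 ∈ I := by
    clear * - hl hmem
    induction hl with
    | nil => simp
    | cons h _ ih => simpa using ⟨(hmem h).1, by simpa using ih⟩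
  have hmap : l' = l.map fun c => (c.1, I.idxOf c.2) := by
    clear * - hl hmem
    induction hl with
    | nil => rfl
    | cons h _ ih => rw [List.map_cons, ← ih, (hmem h).2]
  have hfil : l.filter (fun c => decide (c.2 ∈ I)) = l := by simpa using hall
  constructor
  · intro h
    rw [projectPath, hmap, ← hfil]
    exact (h.filter _).map _
  · intro h
    obtain ⟨m, hm, hml⟩ := List.sublist_map_iff.1 h
    -- The renaming of the selected positions is injective.
    have hinv : ∀ {m : List (Q × ℕ)}, (∀ c ∈ m, c.2 ∈ I) →
        (m.map fun c => (c.1, I.idxOf c.2)).map (fun c => (c.1, I.getD c.2 0)) = m := by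
      intro m hm
      rw [List.map_map]
      conv_rhs => rw [← List.map_id m]
      refine List.map_congr_left fun c hc => ?_
      have hlt := List.idxOf_lt_length_of_mem (hm c hc)
      simp [List.getD_eq_getElem?_getD, List.getElem?_eq_getElem hlt]
    have hmI : ∀ c ∈ m, c.2 ∈ I := fun c hc => by
      simpa using (List.mem_filter.1 (hm.subset hc)).2
    rw [← hinv hall, ← hmap, hml, hinv hmI]
    exact hm.trans List.filter_sublist

theorem onPath_of_samePos {v u w : List A} {m m' : ℕ}
    (h : ∀ ρ, T.IsContextPath v (wordPow u m) w ρ → T.IsContextPath v (wordPow u m') w ρ)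
    {q : Q} {i i' : ℕ} (hi : SamePos v (wordPow u m) (wordPow u m') w i i')
    (hp : T.OnPath (v ++ wordPow u m ++ w) (q, i)) :
    T.OnPath (v ++ wordPow u m' ++ w) (q, i') := by
  obtain ⟨k, hk, hk'⟩ := hi.exists_index
  obtain ⟨π, o, hr, hmem⟩ := hp.exists_run
  obtain ⟨π', o', hr', he⟩ := h _ ⟨π, o, hr, rfl⟩
  have h1 := (sublist_projectPath (nodup_contextPositions v (wordPow u m) w)
    (l := [(q, i)]) (l' := [(q, k)]) (by simp [hk])).1 (List.singleton_sublist.2 hmem)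
  rw [he] at h1
  have h2 := (sublist_projectPath (nodup_contextPositions v (wordPow u m') w)
    (l := [(q, i')]) (l' := [(q, k)]) (by simp [hk'])).2 h1
  exact onPath_of_mem hr' (List.singleton_sublist.1 h2)

/-- The context path determines the order in which the accepting path visits the positions of the
context. -/
theorem before_of_samePos {v u w : List A} {m m' : ℕ}
    (h : ∀ ρ, T.IsContextPath v (wordPow u m) w ρ → T.IsContextPath v (wordPow u m') w ρ)
    {q p : Q} {i i' j j' : ℕ} (hi : SamePos v (wordPow u m) (wordPow u m') w i i')
    (hj : SamePos v (wordPow u m) (wordPow u m') w j j')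
    (hp : T.Before (v ++ wordPow u m ++ w) (q, i) (p, j)) :
    T.Before (v ++ wordPow u m' ++ w) (q, i') (p, j') := by
  obtain ⟨k, hk, hk'⟩ := hi.exists_index
  obtain ⟨l, hl, hl'⟩ := hj.exists_index
  obtain ⟨π, o, hr, hmem⟩ := hp.exists_run
  obtain ⟨π', o', hr', he⟩ := h _ ⟨π, o, hr, rfl⟩
  have h1 := (sublist_projectPath (nodup_contextPositions v (wordPow u m) w)
    (l := [(q, i), (p, j)]) (l' := [(q, k), (p, l)]) (by simp [hk, hl])).1 hmem
  rw [he] at h1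
  have h2 := (sublist_projectPath (nodup_contextPositions v (wordPow u m') w)
    (l := [(q, i'), (p, j')]) (l' := [(q, k), (p, l)]) (by simp [hk', hl'])).2 h1
  have h3 := hr'
  obtain ⟨d, hd, -⟩ := hr'
  exact ⟨onPath_of_mem h3 (h2.subset (by simp)), onPath_of_mem h3 (h2.subset (by simp)),
    Run.transGen_of_sublist hd h2⟩

end StarFreeTransducer

/-! ### Words with the values of the contexts of their letters -/

/-- The letters of `u`, as a factor of `p u s`, each with the value of the part before it and the
value of the part after it. -/
def bimark {α X : Type*} (φ : List α → X) (p : List α) : List α → List α → List (X × α × X)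
  | [], _ => []
  | a :: u, s => (φ p, a, φ (u ++ s)) :: bimark φ (p ++ [a]) u s

section Bimark

variable {α X : Type*} {φ : List α → X}

theorem length_bimark (p u s : List α) : (bimark φ p u s).length = u.length := by
  induction u generalizing p with
  | nil => rfl
  | cons a u ih => simp [bimark, ih]

theorem bimark_append (p u v s : List α) :
    bimark φ p (u ++ v) s = bimark φ p u (v ++ s) ++ bimark φ (p ++ u) v s := by
  induction u generalizing p with
  | nil => simp [bimark]
  | cons a u ih => simp [bimark, ih]

theorem getElem?_bimark (p u s : List α) (k : ℕ) :
    (bimark φ p u s)[k]? =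
      u[k]?.map fun a => (φ (p ++ u.take k), a, φ (u.drop (k + 1) ++ s)) := by
  induction u generalizing p k with
  | nil => simp [bimark]
  | cons a u ih => cases k <;> simp [bimark, ih]

theorem bimark_congr (h : AperiodicInvariant φ) {p p' s s' : List α} (hp : φ p = φ p')
    (hs : φ s = φ s') (u : List α) : bimark φ p u s = bimark φ p' u s' := by
  induction u generalizing p p' with
  | nil => rfl
  | cons a u ih =>
    rw [bimark, bimark, hp, h.congr_left hs u, ih (h.congr_right hp [a])]

end Bimark

namespace StarFreeTransducer

open Relation TwoWayAutomaton

variable {Q A B : Type*} {T : StarFreeTransducer Q A B} {X : Type*} {ψ : List (Marked A) → X}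

/-! ### The tests of a transducer with look-around -/

/-- The transition can be taken in state `q` at a letter `x`, if the part of the tape before it has
value `m` and the part after it has value `n`. -/
def Enabled (T : StarFreeTransducer Q A B) (ψ : List (Marked A) → X) (q : Q) (m : X) (x : Marked A)
    (n : X) (τ : LookAroundTransition Q A B) : Prop :=
  τ ∈ T.Δ ∧ τ.source = q ∧ τ.letter = x ∧ (∃ p ∈ τ.pre, ψ p = m) ∧ ∃ s ∈ τ.suf, ψ s = n

/-- The tests of the transducer are determined by the values of `ψ`. -/
def Decides (T : StarFreeTransducer Q A B) (ψ : List (Marked A) → X) : Prop :=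
  ∀ τ ∈ T.Δ, Saturates ψ τ.pre ∧ Saturates ψ τ.suf

theorem enabled_iff (hψ : T.Decides ψ) {u : List A} {p s : List (Marked A)} {x : Marked A}
    (h : markedWord u = p ++ x :: s) {q : Q} {τ : LookAroundTransition Q A B} :
    T.Enabled ψ q (ψ p) x (ψ s) τ ↔ τ ∈ T.Δ ∧ τ.source = q ∧ τ.Satisfied u p.length := by
  have hsat : τ.Satisfied u p.length ↔ p ∈ τ.pre ∧ τ.letter = x ∧ s ∈ τ.suf := by
    simp [LookAroundTransition.Satisfied, h, eq_comm]
  rw [hsat]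
  constructor
  · rintro ⟨h1, h2, h3, ⟨p', hp', hp⟩, s', hs', hs⟩
    exact ⟨h1, h2, (hψ τ h1).1 hp hp', h3, (hψ τ h1).2 hs hs'⟩
  · rintro ⟨h1, h2, h3, h4, h5⟩
    exact ⟨h1, h2, h4, ⟨p, h3, rfl⟩, s, h5, rfl⟩

theorem enabled_unique (hdet : T.IsDeterministic) (hψ : T.Decides ψ) {u : List A}
    {p s : List (Marked A)} {x : Marked A} (h : markedWord u = p ++ x :: s) {q : Q}
    {τ τ' : LookAroundTransition Q A B} (hτ : T.Enabled ψ q (ψ p) x (ψ s) τ)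
    (hτ' : T.Enabled ψ q (ψ p) x (ψ s) τ') : τ = τ' := by
  rw [enabled_iff hψ h] at hτ hτ'
  by_contra hne
  exact hdet τ hτ.1 τ' hτ'.1 (hτ.2.1.trans hτ'.2.1.symm) hne u _ ⟨hτ.2.2, hτ'.2.2⟩

theorem step_iff (hψ : T.Decides ψ) {u : List A} {p s : List (Marked A)} {x : Marked A}
    (h : markedWord u = p ++ x :: s) {q : Q} {v : List B} {d : Q × ℕ} :
    T.Step u (q, p.length) v d ↔ ∃ τ, T.Enabled ψ q (ψ p) x (ψ s) τ ∧ d.1 = τ.target ∧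
      (d.2 : ℤ) = (p.length : ℤ) + (τ.move : ℤ) ∧ v = τ.output := by
  simp only [enabled_iff hψ h, Step, and_assoc]

theorem exists_split_of_step {u : List A} {c d : Q × ℕ} {v : List B} (h : T.Step u c v d) :
    ∃ p x s, markedWord u = p ++ x :: s ∧ p.length = c.2 := by
  obtain ⟨τ, -, -, ⟨-, hx, -⟩, -⟩ := h
  obtain ⟨hi, -⟩ := List.getElem?_eq_some_iff.1 hx
  exact ⟨(markedWord u).take c.2, (markedWord u)[c.2], (markedWord u).drop (c.2 + 1),
    by simp, by simp; omega⟩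

/-! ### The visit of a given configuration is a regular property -/

/-- The states of the automaton that runs the transducer and remembers whether the marked
configuration has been visited. -/
inductive VisitState (Q : Type*)
  | live (q : Q) (seen : Prop)
  | accepted
  | dead

theorem VisitState.finite [Finite Q] : Finite (VisitState Q) := by
  refine Finite.of_injective (β := Option (Option (Q × Prop))) (fun
    | live q f => some (some (q, f))
    | accepted => some none
    | dead => none) ?_
  intro x y h
  cases x <;> cases y <;> simp_all

open Classical VisitState in
/-- The automaton that runs the transducer over tapes with their endmarkers, where each letter is
given with the values of its context and with a mark, which may be a state. It leaves the tape to
the right in the state `accepted` if the run is accepting and visits a mark in the state given by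
the mark. -/
noncomputable def visitAutomaton (T : StarFreeTransducer Q A B) (ψ : List (Marked A) → X) :
    TwoWayAutomaton (VisitState Q) (X × (Marked A × Option Q) × X) where
  δ c l := match c, l with
    | live q f, .letter (m, (x, k), n) =>
      if x = .rightEnd ∧ q ∈ T.final then
        if f ∨ k = some q then (accepted, 1) else (dead, 0)
      else if h : ∃ τ, T.Enabled ψ q m x n τ then
        (live h.choose.target (f ∨ k = some q), h.choose.move)
      else (dead, 0)
    | _, _ => (dead, 0)
  δ_leftEnd q := by cases q <;> simp
  δ_rightEnd q := by cases q <;> simp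
  start := live T.start False
  final := ∅

/-- The tape `p x s` with the mark `q` on the letter `x`. -/
def markAt (q : Q) (p : List (Marked A)) (x : Marked A) (s : List (Marked A)) :
    List (Marked A × Option Q) :=
  p.map (fun y => (y, none)) ++ (x, some q) :: s.map fun y => (y, none)

/-- The values of words with marks. -/
abbrev onMarked (Q : Type*) (ψ : List (Marked A) → X) (l : List (Marked A × Option Q)) : X :=
  ψ (l.map Prod.fst)

theorem map_fst_markAt (q : Q) (p : List (Marked A)) (x : Marked A) (s : List (Marked A)) :
    (markAt q p x s).map Prod.fst = p ++ x :: s := by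
  simp [markAt, Function.comp_def]

theorem getElem?_markAt {q : Q} {p : List (Marked A)} {x : Marked A} {s : List (Marked A)} {k : ℕ}
    {y : Marked A} (h : (p ++ x :: s)[k]? = some y) :
    ∃ mk, (markAt q p x s)[k]? = some (y, mk) ∧ ∀ q', mk = some q' ↔ k = p.length ∧ q' = q := by
  rcases Nat.lt_trichotomy k p.length with hk | rfl | hk
  · rw [List.getElem?_append_left hk] at h
    refine ⟨none, ?_, fun q' => by simp [hk.ne]⟩
    rw [markAt, List.getElem?_append_left (by simpa), List.getElem?_map, h]
    rfl
  · refine ⟨some q, ?_, fun q' => by simp [eq_comm]⟩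
    simp only [List.getElem?_append_right le_rfl, Nat.sub_self, List.getElem?_cons_zero,
      Option.some.injEq] at h
    rw [markAt, List.getElem?_append_right (by simp)]
    simp [h]
  · obtain ⟨j, rfl⟩ := Nat.exists_eq_add_of_lt hk
    rw [List.getElem?_append_right (by omega),
      show p.length + j + 1 - p.length = j + 1 by omega, List.getElem?_cons_succ] at h
    refine ⟨none, ?_, fun q' => by simp; omega⟩
    rw [markAt, List.getElem?_append_right (by simp; omega), List.length_map,
      show p.length + j + 1 - p.length = j + 1 by omega, List.getElem?_cons_succ,
      List.getElem?_map, h]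
    rfl

section Visit

variable {u : List A} {q₀ : Q} {p₀ s₀ : List (Marked A)} {x₀ : Marked A}

theorem getElem?_visit {p s : List (Marked A)} {x : Marked A}
    (h : p₀ ++ x₀ :: s₀ = p ++ x :: s) :
    ∃ mk, (bimark (onMarked Q ψ) [] (markAt q₀ p₀ x₀ s₀) [])[p.length]? =
        some (ψ p, (x, mk), ψ s) ∧
      ∀ q, mk = some q ↔ p.length = p₀.length ∧ q = q₀ := by
  obtain ⟨mk, hmk, hq⟩ := getElem?_markAt (q := q₀) (p := p₀) (x := x₀) (s := s₀)
    (k := p.length) (y := x) (by rw [h]; simp)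
  refine ⟨mk, ?_, hq⟩
  rw [getElem?_bimark, hmk]
  simp [onMarked, List.map_take, List.map_drop, map_fst_markAt, h]

theorem visit_step (hdet : T.IsDeterministic) (hψ : T.Decides ψ)
    (hu : markedWord u = p₀ ++ x₀ :: s₀) {c d : Q × ℕ} (h : T.Next u c d) (f : Prop) :
    (T.visitAutomaton ψ).InnerStep (bimark (onMarked Q ψ) [] (markAt q₀ p₀ x₀ s₀) [])
      (.live c.1 f, c.2 + 1) (.live d.1 (f ∨ c = (q₀, p₀.length)), d.2 + 1) := by
  obtain ⟨v, hna, hs⟩ := h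
  obtain ⟨p, x, s, hp, hc⟩ := exists_split_of_step hs
  obtain ⟨q, i⟩ := c
  obtain rfl : p.length = i := hc
  obtain ⟨mk, hz, hmk⟩ := getElem?_visit (Q := Q) (ψ := ψ) (q₀ := q₀) (hu.symm.trans hp)
  obtain ⟨τ, hτ, h1, h2, -⟩ := (step_iff hψ hp).1 hs
  have hx : ¬ (x = .rightEnd ∧ q ∈ T.final) := by
    rintro ⟨rfl, hq⟩
    refine hna ⟨hq, ?_⟩
    have : (markedWord u)[p.length]? = some .rightEnd := by rw [hp]; simp
    rcases TwoWayTransducer.getElem?_markedWord_cases this with h | ⟨_, _, _, _, h⟩ | h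
    · simp at h
    · simp at h
    · exact h.1
  have hex : ∃ τ, T.Enabled ψ q (ψ p) x (ψ s) τ := ⟨τ, hτ⟩
  have hch : hex.choose = τ := enabled_unique hdet hψ hp hex.choose_spec hτ
  have hδ : (T.visitAutomaton ψ).δ (.live q f) (.letter (ψ p, (x, mk), ψ s)) =
      (.live τ.target (f ∨ mk = some q), τ.move) := by
    simp only [visitAutomaton, hx, if_false, hex, dite_true, hch]
  refine TwoWayTransducer.innerStep_of_getElem? hz rfl ?_ ?_
  · rw [hδ]
    simp only [h1, hmk, Prod.mk.injEq, VisitState.live.injEq, true_and, eq_iff_iff]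
    tauto
  · rw [hδ]
    simp only
    push_cast
    omega

theorem visit_reaches (hdet : T.IsDeterministic) (hψ : T.Decides ψ)
    (hu : markedWord u = p₀ ++ x₀ :: s₀) {c d : Q × ℕ} (h : ReflTransGen (T.Next u) c d)
    (f : Prop) : ∃ f' : Prop, (f → f') ∧ ReflTransGen ((T.visitAutomaton ψ).InnerStep
      (bimark (onMarked Q ψ) [] (markAt q₀ p₀ x₀ s₀) [])) (.live c.1 f, c.2 + 1)
      (.live d.1 f', d.2 + 1) := by
  induction h using ReflTransGen.head_induction_on generalizing f with
  | refl => exact ⟨f, id, .refl⟩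
  | head hs _ ih =>
    obtain ⟨f', hf, hr⟩ := ih (f ∨ _ = (q₀, p₀.length))
    exact ⟨f', fun h => hf (.inl h), .head (visit_step hdet hψ hu hs f) hr⟩

theorem visit_accept (hu : markedWord u = p₀ ++ x₀ :: s₀) {c : Q × ℕ} (h : T.IsAccepting u c)
    {f : Prop} (hf : f ∨ c = (q₀, p₀.length)) : (T.visitAutomaton ψ).InnerStep
      (bimark (onMarked Q ψ) [] (markAt q₀ p₀ x₀ s₀) []) (.live c.1 f, c.2 + 1)
      (.accepted, u.length + 2 + 1) := by
  obtain ⟨q, i⟩ := c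
  obtain ⟨hq, rfl⟩ : q ∈ T.final ∧ i = u.length + 1 := h
  have hp : markedWord u = (.leftEnd :: u.map .letter) ++ .rightEnd :: [] := rfl
  obtain ⟨mk, hz, hmk⟩ := getElem?_visit (Q := Q) (ψ := ψ) (q₀ := q₀) (hu.symm.trans hp)
  have hf' : f ∨ mk = some q := by
    rw [hmk]
    simpa [and_comm] using hf
  have hδ : (T.visitAutomaton ψ).δ (.live q f) (.letter (ψ (.leftEnd :: u.map .letter),
      (.rightEnd, mk), ψ [])) = (.accepted, 1) := by
    simp only [visitAutomaton, hq, and_self, if_true, hf']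
  refine TwoWayTransducer.innerStep_of_getElem? hz (by simp) ?_ ?_
  · rw [hδ]
  · rw [hδ]
    simp
    ring

theorem visit_dead {z : List (X × (Marked A × Option Q) × X)} {i : ℕ} {d : VisitState Q × ℕ}
    (h : ReflTransGen ((T.visitAutomaton ψ).InnerStep z) (.dead, i) d) : d.1 = .dead := by
  induction h with
  | refl => rfl
  | @tail b c _ hs ih =>
    obtain ⟨b, j⟩ := b
    obtain rfl : b = .dead := ih
    obtain ⟨k, a, -, -, h1, -⟩ := innerStep_iff.1 hs
    exact h1

theorem onPath_of_visit (hψ : T.Decides ψ) (hu : markedWord u = p₀ ++ x₀ :: s₀)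
    {c : VisitState Q × ℕ} (h : ReflTransGen ((T.visitAutomaton ψ).InnerStep
      (bimark (onMarked Q ψ) [] (markAt q₀ p₀ x₀ s₀) [])) c (.accepted, u.length + 2 + 1)) :
    ∀ q i f, c = (.live q f, i + 1) → ∃ d, T.IsAccepting u d ∧ ReflTransGen (T.Next u) (q, i) d ∧
      (f ∨ (ReflTransGen (T.Next u) (q, i) (q₀, p₀.length) ∧
        ReflTransGen (T.Next u) (q₀, p₀.length) d)) := by
  induction h using ReflTransGen.head_induction_on with
  | refl =>
    intro q i f h
    simp at h
  | @head c c₁ hs hr ih =>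
    rintro q i f rfl
    obtain ⟨k, l, hk, hl, h1, h2⟩ := innerStep_iff.1 hs
    obtain rfl : i = k := by simpa using hk
    have hilen : i < (p₀ ++ x₀ :: s₀).length := by
      have := (List.getElem?_eq_some_iff.1 hl).1
      rw [length_bimark] at this
      rwa [← map_fst_markAt q₀, List.length_map]
    obtain ⟨p, x, s, hp, rfl⟩ : ∃ p x s, p₀ ++ x₀ :: s₀ = p ++ x :: s ∧ p.length = i :=
      ⟨(p₀ ++ x₀ :: s₀).take i, (p₀ ++ x₀ :: s₀)[i], (p₀ ++ x₀ :: s₀).drop (i + 1),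
        by rw [List.cons_getElem_drop_succ, List.take_append_drop], by simp at hilen ⊢; omega⟩
    obtain ⟨mk, hz, hmk⟩ := getElem?_visit (Q := Q) (ψ := ψ) (q₀ := q₀) hp
    obtain rfl : (ψ p, (x, mk), ψ s) = l := by simpa [hz] using hl
    obtain ⟨c₁, i₁⟩ := c₁
    by_cases hx : x = .rightEnd ∧ q ∈ T.final
    · have hlen : p.length = u.length + 1 := by
        have : (markedWord u)[p.length]? = some .rightEnd := by rw [hu, hp, ← hx.1]; simp
        rcases TwoWayTransducer.getElem?_markedWord_cases this with h | ⟨_, _, _, _, h⟩ | h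
        · simp at h
        · simp at h
        · exact h.1
      by_cases hf : f ∨ mk = some q
      · refine ⟨(q, p.length), ⟨hx.2, hlen⟩, .refl, hf.imp id fun h => ?_⟩
        rw [hmk] at h
        rw [h.1, h.2]
        exact ⟨.refl, .refl⟩
      · obtain rfl : c₁ = .dead := by
          simpa [visitAutomaton, hx, hf] using h1
        simpa using visit_dead hr
    · by_cases hex : ∃ τ, T.Enabled ψ q (ψ p) x (ψ s) τ
      · have hδ : (T.visitAutomaton ψ).δ (.live q f) (.letter (ψ p, (x, mk), ψ s)) =
            (.live hex.choose.target (f ∨ mk = some q), hex.choose.move) := by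
          simp only [visitAutomaton, hx, if_false, hex, dite_true]
        rw [hδ] at h1 h2
        simp only at h1 h2
        subst h1
        rcases i₁ with _ | i₁
        · rcases ReflTransGen.cases_head hr with h | ⟨_, ⟨h, -, -⟩, -⟩ <;> simp at h
        have hnext : T.Next u (q, p.length) (hex.choose.target, i₁) := by
          refine ⟨_, ?_, (step_iff hψ (hu.trans hp)).2 ⟨_, hex.choose_spec, rfl, ?_, rfl⟩⟩
          · rintro ⟨hq, hl⟩
            refine hx ⟨?_, hq⟩
            have := TwoWayTransducer.getElem?_markedWord_last u
            simp only at hl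
            rw [← hl, hu, hp] at this
            simpa using this
          · push_cast at h2 ⊢
            omega
        obtain ⟨d, hd, hcd, hf⟩ := ih _ _ _ rfl
        refine ⟨d, hd, .head hnext hcd, ?_⟩
        rcases hf with (hf | hf) | ⟨h3, h4⟩
        · exact .inl hf
        · rw [hmk] at hf
          have he : (q, p.length) = (q₀, p₀.length) := Prod.ext hf.2 hf.1
          exact .inr (he ▸ ⟨.refl, .head hnext hcd⟩)
        · exact .inr ⟨.head hnext h3, h4⟩
      · obtain rfl : c₁ = .dead := by
          simpa [visitAutomaton, hx, hex] using h1
        simpa using visit_dead hr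

/-- The accepting path visits the marked configuration if and only if the automaton crosses the
annotated tape from its initial state to `accepted`. -/
theorem visit_iff (hdet : T.IsDeterministic) (hψ : T.Decides ψ)
    (hu : markedWord u = p₀ ++ x₀ :: s₀) :
    ((.live T.start False, .accepted) : VisitState Q × VisitState Q) ∈
      (T.visitAutomaton ψ).behavior .left .right
        (bimark (onMarked Q ψ) [] (markAt q₀ p₀ x₀ s₀) []) ↔
      T.OnPath u (q₀, p₀.length) := by
  have hlen : (bimark (onMarked Q ψ) [] (markAt q₀ p₀ x₀ s₀) []).length = u.length + 2 := by
    rw [length_bimark, ← length_markedWord, hu, ← map_fst_markAt q₀, List.length_map]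
  simp only [behavior, Set.mem_ofPred_eq, Side.entry, Side.exit, hlen]
  constructor
  · intro h
    obtain ⟨d, hd, -, h | ⟨h1, h2⟩⟩ := onPath_of_visit hψ hu h T.start 0 False rfl
    · exact h.elim
    · exact ⟨d, hd, h1, h2⟩
  · rintro ⟨d, hd, h1, h2⟩
    obtain ⟨f, -, hr⟩ := visit_reaches (q₀ := q₀) hdet hψ hu h1 False
    refine hr.trans ?_
    rcases ReflTransGen.cases_head h2 with rfl | ⟨e, he, hed⟩
    · exact .single (visit_accept hu hd (.inr rfl))
    · obtain ⟨f', hf', hr'⟩ := visit_reaches (q₀ := q₀) hdet hψ hu hed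
        (f ∨ (q₀, p₀.length) = (q₀, p₀.length))
      exact .head (visit_step hdet hψ hu he f)
        (hr'.tail (visit_accept hu hd (.inl (hf' (.inr rfl)))))

end Visit

end StarFreeTransducer

/-! ### Values of contexts -/

/-- The syntactic congruence of a family of properties of words is aperiodic if these properties do
not distinguish some power of a word from the next one. -/
theorem aperiodicInvariant_contexts {A ι : Type*} (P : ι → List A → Prop)
    (h : ∃ n, ∀ u i x y, P i (x ++ wordPow u n ++ y) ↔ P i (x ++ wordPow u (n + 1) ++ y)) :
    AperiodicInvariant fun u => {c : ι × List A × List A | P c.1 (c.2.1 ++ u ++ c.2.2)} where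
  congr := by
    intro u u' hu x y
    ext ⟨i, x', y'⟩
    have := Set.ext_iff.1 hu (i, x' ++ x, y ++ y')
    simpa using this
  aper := h.imp fun n hn u => Set.ext fun c => hn u c.1 c.2.1 c.2.2

theorem AperiodicInvariant.of_ker {A X Y : Type*} {φ : List A → X} {χ : List A → Y}
    (h : AperiodicInvariant φ) (hχ : ∀ u u', χ u = χ u' ↔ φ u = φ u') : AperiodicInvariant χ where
  congr hu x y := (hχ _ _).2 (h.congr ((hχ _ _).1 hu) x y)
  aper := h.aper.imp fun _ hn u => (hχ _ _).2 (hn u)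

/-- An invariant with finitely many values can be replaced by one that is onto a finite type in the
lowest universe. -/
theorem AperiodicInvariant.exists_surjective {A Y K : Type*} [Finite K] {φ : List A → Y}
    (h : AperiodicInvariant φ) (key : List A → K) (hkey : ∀ u u', key u = key u' → φ u = φ u') :
    ∃ (X : Type) (_ : Finite X) (χ : List A → X), AperiodicInvariant χ ∧ Function.Surjective χ ∧
      ∀ u u', χ u = χ u' ↔ φ u = φ u' := by
  have hfin : Finite (Set.range φ) := by
    refine Finite.of_injective (fun y => key y.2.choose) fun y y' hy => Subtype.ext ?_
    rw [← y.2.choose_spec, ← y'.2.choose_spec]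
    exact hkey _ _ hy
  have hχ : ∀ u u', (Finite.equivFin (Set.range φ) ∘ Set.rangeFactorization φ) u =
      (Finite.equivFin (Set.range φ) ∘ Set.rangeFactorization φ) u' ↔ φ u = φ u' := by
    intro u u'
    rw [Function.comp_apply, Function.comp_apply, (Finite.equivFin _).injective.eq_iff,
      Subtype.ext_iff]
    rfl
  exact ⟨_, inferInstance, _, h.of_ker hχ,
    (Finite.equivFin _).surjective.comp Set.rangeFactorization_surjective, hχ⟩

instance Side.finite : Finite Side :=
  Finite.of_injective (fun s => match s with | Side.left => true | Side.right => false) (by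
    intro x y h
    cases x <;> cases y <;> simp_all)

namespace TwoWayAutomaton

variable {S α X : Type*} {φ : List α → X}

/-- The value of `u`, and the behaviors of `u` as a factor of the words `p u s`, where its letters
are given with the values of their contexts. They only depend on the values of `p` and of `s`. -/
def factorBehaviors (M : TwoWayAutomaton S (X × α × X)) (φ : List α → X) (u : List α) :
    X × (X → X → Side → Side → Set (S × S)) :=
  (φ u, fun m n x y => {c | ∃ p s, φ p = m ∧ φ s = n ∧ c ∈ M.behavior x y (bimark φ p u s)})

theorem behaviorEquiv_of_factorBehaviors (h : AperiodicInvariant φ)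
    {M : TwoWayAutomaton S (X × α × X)} {u u' : List α}
    (hu : M.factorBehaviors φ u = M.factorBehaviors φ u') (p s : List α) :
    M.BehaviorEquiv (bimark φ [] (p ++ u ++ s) []) (bimark φ [] (p ++ u' ++ s) []) := by
  rw [factorBehaviors, factorBehaviors, Prod.mk.injEq] at hu
  have hb : M.BehaviorEquiv (bimark φ p u s) (bimark φ p u' s) := by
    intro x y
    have hs : ∀ u, M.behavior x y (bimark φ p u s) =
        {c | ∃ p' s', φ p' = φ p ∧ φ s' = φ s ∧ c ∈ M.behavior x y (bimark φ p' u s')} := by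
      refine fun u => Set.ext fun c => ⟨fun hc => ⟨p, s, rfl, rfl, hc⟩, ?_⟩
      rintro ⟨p', s', hp, hs, hc⟩
      rwa [bimark_congr h hp hs] at hc
    rw [hs u, hs u']
    exact congrFun (congrFun (congrFun (congrFun hu.2 _) _) x) y
  simp only [bimark_append, List.nil_append, List.append_nil]
  rw [bimark_congr h rfl (h.congr_right hu.1 s) p,
    bimark_congr h (h.congr_left hu.1 p) (rfl : φ [] = φ []) s]
  exact hb.context _ _

end TwoWayAutomaton

namespace StarFreeTransducer

open TwoWayAutomaton

variable {Q A B : Type*} {T : StarFreeTransducer Q A B} {X : Type*} {ψ : List (Marked A) → X}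

/-- The configuration with state `q` at the letter `a` of `v a w` occurs in the accepting path. -/
def Visits (T : StarFreeTransducer Q A B) (q : Q) (v : List A) (a : A) (w : List A) : Prop :=
  T.OnPath (v ++ a :: w) (q, v.length + 1)

/-- The visits after a power of `u` take place in the context of this power. -/
theorem visits_wordPow_left {n : ℕ}
    (hn : ∀ (u v w : List A) (ρ : List (Q × ℕ)),
      T.IsContextPath v (wordPow u n) w ρ ↔ T.IsContextPath v (wordPow u (n + 1)) w ρ)
    (q : Q) (a : A) (u x y w : List A) :
    T.Visits q (x ++ wordPow u n ++ y) a w ↔ T.Visits q (x ++ wordPow u (n + 1) ++ y) a w := by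
  have hs : ∀ m m', SamePos x (wordPow u m) (wordPow u m') (y ++ a :: w)
      ((x ++ wordPow u m ++ y).length + 1) ((x ++ wordPow u m' ++ y).length + 1) := by
    intro m m'
    exact .inr ⟨y.length, by simp, by simp; omega, by simp; omega⟩
  simp only [Visits, List.append_assoc _ y]
  constructor <;> intro h
  · refine onPath_of_samePos (fun ρ => (hn u _ _ ρ).1) ?_ h
    simpa using hs n (n + 1)
  · refine onPath_of_samePos (fun ρ => (hn u _ _ ρ).2) ?_ h
    simpa using hs (n + 1) n

theorem visits_wordPow_right {n : ℕ}
    (hn : ∀ (u v w : List A) (ρ : List (Q × ℕ)),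
      T.IsContextPath v (wordPow u n) w ρ ↔ T.IsContextPath v (wordPow u (n + 1)) w ρ)
    (q : Q) (a : A) (u x y w : List A) :
    T.Visits q w a (x ++ wordPow u n ++ y) ↔ T.Visits q w a (x ++ wordPow u (n + 1) ++ y) := by
  have hs : ∀ m m', SamePos (w ++ a :: x) (wordPow u m) (wordPow u m') y
      (w.length + 1) (w.length + 1) := by
    intro m m'
    exact .inl ⟨by simp, by simp, rfl⟩
  have he : ∀ m, w ++ a :: (x ++ wordPow u m ++ y) = w ++ a :: x ++ wordPow u m ++ y := by simp
  simp only [Visits, he]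
  exact ⟨onPath_of_samePos (fun ρ => (hn u _ _ ρ).1) (hs _ _),
    onPath_of_samePos (fun ρ => (hn u _ _ ρ).2) (hs _ _)⟩

theorem visits_iff_behavior (hdet : T.IsDeterministic) (hψ : T.Decides ψ) {q : Q} {a : A}
    {v w : List A} : T.Visits q v a w ↔
      ((.live T.start False, .accepted) : VisitState Q × VisitState Q) ∈
        (T.visitAutomaton ψ).behavior .left .right (bimark (onMarked Q ψ) []
          (markAt q (.leftEnd :: v.map .letter) (.letter a) (w.map .letter ++ [.rightEnd])) []) := by
  rw [visit_iff (u := v ++ a :: w) hdet hψ (by simp [markedWord])]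
  simp [Visits]

/-- The behaviors of a factor of the tape, with the values of the context, for the automaton that
detects visits. -/
noncomputable def visitKey (T : StarFreeTransducer Q A B) (ψ : List (Marked A) → X) (u : List A) :=
  (T.visitAutomaton ψ).factorBehaviors (onMarked Q ψ) (u.map fun a => (.letter a, none))

theorem visits_of_visitKey (hdet : T.IsDeterministic) (hψ : T.Decides ψ)
    (h : AperiodicInvariant ψ) {u u' : List A} (hu : T.visitKey ψ u = T.visitKey ψ u')
    (q : Q) (a : A) (x y w : List A) :
    (T.Visits q (x ++ u ++ y) a w ↔ T.Visits q (x ++ u' ++ y) a w) ∧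
      (T.Visits q w a (x ++ u ++ y) ↔ T.Visits q w a (x ++ u' ++ y)) := by
  have hb := behaviorEquiv_of_factorBehaviors (h.comp_map Prod.fst) hu
  simp only [visits_iff_behavior hdet hψ]
  constructor
  · have := Set.ext_iff.1 (hb ((.leftEnd, none) :: x.map fun a => (.letter a, none))
      ((y.map fun a => (.letter a, none)) ++ (.letter a, some q) ::
        ((w.map fun a => (.letter a, none)) ++ [(.rightEnd, none)])) .left .right)
      (.live T.start False, .accepted)
    simpa [markAt, Function.comp_def] using this
  · have := Set.ext_iff.1 (hb ((.leftEnd, none) :: (w.map fun a => (.letter a, none)) ++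
      (.letter a, some q) :: x.map fun a => (.letter a, none))
      ((y.map fun a => (.letter a, none)) ++ [(.rightEnd, none)]) .left .right)
      (.live T.start False, .accepted)
    simpa [markAt, Function.comp_def] using this

/-- For an aperiodic transducer, the visits of the accepting path to a position only depend on the
values of the parts before and after the position for some aperiodic invariant. -/
theorem exists_visit_invariant [Finite Q] [Finite X] (hdet : T.IsDeterministic)
    (haper : T.IsAperiodic) (hψ : T.Decides ψ) (h : AperiodicInvariant ψ) :
    ∃ (Y : Type) (_ : Finite Y) (φ : List A → Y), AperiodicInvariant φ ∧ Function.Surjective φ ∧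
      (∀ u u', φ u = φ u' → ψ (u.map .letter) = ψ (u'.map .letter)) ∧
      ∀ v v' w w', φ v = φ v' → φ w = φ w' → ∀ q a, T.Visits q v a w → T.Visits q v' a w' := by
  obtain ⟨n, -, hn⟩ := haper
  have h1 := aperiodicInvariant_contexts
    (fun (c : Q × A × List A) (v : List A) => T.Visits c.1 v c.2.1 c.2.2)
    ⟨n, fun u c x y => visits_wordPow_left hn _ _ _ _ _ _⟩
  have h2 := aperiodicInvariant_contexts
    (fun (c : Q × A × List A) (w : List A) => T.Visits c.1 c.2.2 c.2.1 w)
    ⟨n, fun u c x y => visits_wordPow_right hn _ _ _ _ _ _⟩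
  have := VisitState.finite (Q := Q)
  obtain ⟨Y, hY, φ, hφ, hs, hker⟩ := ((h.comp_map Marked.letter).prod (h1.prod h2)).exists_surjective
    (T.visitKey ψ) (by
      intro u u' hu
      have hv := visits_of_visitKey hdet hψ h hu
      refine Prod.ext ?_ (Prod.ext ?_ ?_)
      · simpa [visitKey, factorBehaviors, onMarked, Function.comp_def] using congrArg Prod.fst hu
      · exact Set.ext fun c => (hv _ _ _ _ _).1
      · exact Set.ext fun c => (hv _ _ _ _ _).2)
  refine ⟨Y, hY, φ, hφ, hs, fun u u' hu => congrArg Prod.fst ((hker _ _).1 hu), ?_⟩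
  intro v v' w w' hv hw q a hq
  have e1 := congrArg (fun z => z.2.1) ((hker _ _).1 hv)
  have e2 := congrArg (fun z => z.2.2) ((hker _ _).1 hw)
  have h3 := (Set.ext_iff.1 e1 ((q, a, w), [], [])).1 (by simpa using hq)
  have h4 := (Set.ext_iff.1 e2 ((q, a, v'), [], [])).1 (by simpa using h3)
  simpa using h4

end StarFreeTransducer

/-! ### A transducer over words with values of contexts -/

namespace StarFreeTransducer

open Relation TwoWayAutomaton

/-- The value under `φ` of the parts before and after a position determine the transition that can
be taken there (through `ψ`) and the states of the visits of the accepting path. -/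
structure Guides {Q A B X Y : Type*} (T : StarFreeTransducer Q A B) (ψ : List (Marked A) → Y)
    (φ : List A → X) : Prop where
  deterministic : T.IsDeterministic
  decides : T.Decides ψ
  tape : AperiodicInvariant ψ
  word : AperiodicInvariant φ
  tape_of_word : ∀ u u', φ u = φ u' → ψ (u.map .letter) = ψ (u'.map .letter)
  visits : ∀ v v' w w', φ v = φ v' → φ w = φ w' → ∀ q a, T.Visits q v a w → T.Visits q v' a w'

/-- The states of the transducer `guarded`. The state `run q s m n` stands for the state `q`; the
boundary that the head has crossed last is on its side `s`, and `m` and `n` are the values of the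
parts of the input before and after this boundary. -/
inductive GuardedState (Q X : Type*)
  | dead
  | init
  | enter (m n : X)
  | run (q : Q) (s : Side) (m n : X)

section Guarded

open GuardedState

variable {Q : Type u} {A : Type v} {B : Type w} {X : Type} {Y : Type*} {φ : List A → X}

/-- The letter `l` agrees with the values `m`, `n` of the parts of the input before and after the
boundary on the side `s` of `l`. -/
def Matches (hs : Function.Surjective φ) (s : Side) (m n : X) (l : X × A × X) : Prop :=
  match s with
  | .left => m = l.1 ∧ n = valCons hs l.2.1 l.2.2
  | .right => m = valSnoc hs l.1 l.2.1 ∧ n = l.2.2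

/-- The transition `τ` can be taken in the state `run q s m n` at a letter. At a letter of the input
this requires that the values agree, and that the accepting path visits this position in state `q`,
so that the runs of `guarded` follow accepting paths as long as they are not dead. -/
def Candidate (T : StarFreeTransducer Q A B) (ψ : List (Marked A) → Y)
    (hs : Function.Surjective φ) (q : Q) (s : Side) (m n : X) :
    Marked (X × A × X) → LookAroundTransition Q A B → Prop
  | .leftEnd, τ => T.Enabled ψ q (ψ []) .leftEnd
      (ψ ((rep hs n).map .letter ++ [.rightEnd])) τ ∧ τ.move ≠ -1
  | .letter l, τ => Matches hs s m n l ∧ T.Visits q (rep hs l.1) l.2.1 (rep hs l.2.2) ∧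
      T.Enabled ψ q (ψ (.leftEnd :: (rep hs l.1).map .letter)) (.letter l.2.1)
        (ψ ((rep hs l.2.2).map .letter ++ [.rightEnd])) τ
  | .rightEnd, τ => T.Enabled ψ q (ψ (.leftEnd :: (rep hs m).map .letter)) .rightEnd (ψ []) τ ∧
      τ.move ≠ 1

/-- The effect of a move from the state `run _ s m n` at a letter, with the new state `q`. -/
noncomputable def afterMove (hs : Function.Surjective φ) (q : Q) (s : Side) (m n : X) :
    Marked (X × A × X) → SignType → GuardedState Q X × SignType
  | .letter l, .neg => (run q .right l.1 (valCons hs l.2.1 l.2.2), -1)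
  | .letter l, .pos => (run q .left (valSnoc hs l.1 l.2.1) l.2.2, 1)
  | .letter _, .zero => (run q s m n, 0)
  | .leftEnd, .neg => (dead, 0)
  | .leftEnd, .zero => (run q s m n, 0)
  | .leftEnd, .pos => (run q .left m n, 1)
  | .rightEnd, .neg => (run q .right m n, -1)
  | .rightEnd, .zero => (run q s m n, 0)
  | .rightEnd, .pos => (dead, 0)

open Classical in
/-- The two-way transducer that simulates a transducer with look-around over words whose letters
are given with the values of their contexts. Before the simulation it reads the first letter, for
the value of the input. -/
noncomputable def guarded (T : StarFreeTransducer Q A B) (ψ : List (Marked A) → Y)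
    (hs : Function.Surjective φ) : TwoWayTransducer (GuardedState Q X) (X × A × X) B where
  δ c l := match c with
    | dead => (dead, 0)
    | init => match l with
      | .leftEnd => (init, 1)
      | .letter l => (enter l.1 (valCons hs l.2.1 l.2.2), -1)
      | .rightEnd => (enter (φ []) (φ []), -1)
    | enter m n => match l with
      | .leftEnd => (run T.start .right m n, 0)
      | _ => (dead, 0)
    | run q s m n =>
      if h : ∃ τ, T.Candidate ψ hs q s m n l τ then
        afterMove hs h.choose.target s m n l h.choose.move
      else (dead, 0)
  δ_leftEnd c := by
    rcases c with _ | _ | _ | ⟨q, s, m, n⟩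
    · simp
    · simp
    · simp
    · simp only
      split
      · rename_i h
        generalize h.choose.move = d
        cases d <;> simp [afterMove]
      · simp
  δ_rightEnd c := by
    rcases c with _ | _ | _ | ⟨q, s, m, n⟩
    · simp
    · simp
    · simp
    · simp only
      split
      · rename_i h
        generalize h.choose.move = d
        cases d <;> simp [afterMove]
      · simp
  start := init
  final := {c | ∃ q ∈ T.final, ∃ s m n, c = run q s m n}
  γ c l := match c with
    | run q s m n =>
      if h : ∃ τ, T.Candidate ψ hs q s m n l τ then h.choose.output else []
    | _ => []

variable {T : StarFreeTransducer Q A B} {ψ : List (Marked A) → Y} {hs : Function.Surjective φ}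

theorem guarded_of_candidate {q : Q} {s : Side} {m n : X} {l : Marked (X × A × X)}
    {τ : LookAroundTransition Q A B} (h : T.Candidate ψ hs q s m n l τ)
    (hu : ∀ τ', T.Candidate ψ hs q s m n l τ' → τ' = τ) :
    (T.guarded ψ hs).δ (run q s m n) l = afterMove hs τ.target s m n l τ.move ∧
      (T.guarded ψ hs).γ (run q s m n) l = τ.output := by
  have hex : ∃ τ, T.Candidate ψ hs q s m n l τ := ⟨τ, h⟩
  have hc : hex.choose = τ := hu _ hex.choose_spec
  simp only [guarded, hex, dite_true, hc, and_self]

theorem guarded_of_not_candidate {q : Q} {s : Side} {m n : X} {l : Marked (X × A × X)}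
    (h : ¬ ∃ τ, T.Candidate ψ hs q s m n l τ) :
    (T.guarded ψ hs).δ (run q s m n) l = (dead, 0) ∧
      (T.guarded ψ hs).γ (run q s m n) l = [] := by
  simp only [guarded, h, dite_false, and_self]

/-- `Valid φ p u s c C`: the configuration `c` of `guarded` over the factor `u` of `p u s`
represents the configuration `C` of the transducer with look-around over `p u s`. -/
inductive Valid (φ : List A → X) (p u s : List A) : GuardedState Q X × ℕ → Q × ℕ → Prop
  | left (q : Q) (b : ℕ) (hb : b ≤ u.length) : Valid φ p u s
      (run q .left (φ (p ++ u.take b)) (φ (u.drop b ++ s)), b + 1) (q, p.length + (b + 1))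
  | right (q : Q) (b : ℕ) (hb : b ≤ u.length) : Valid φ p u s
      (run q .right (φ (p ++ u.take b)) (φ (u.drop b ++ s)), b) (q, p.length + b)

theorem Valid.exists_run {p u s : List A} {c : GuardedState Q X × ℕ} {C : Q × ℕ}
    (h : Valid φ p u s c C) : (∃ d m n, c.1 = run C.1 d m n) ∧ C.2 = p.length + c.2 := by
  cases h
  · exact ⟨⟨_, _, _, rfl⟩, rfl⟩
  · exact ⟨⟨_, _, _, rfl⟩, rfl⟩

/-- The configuration `c` of `guarded`, at a letter `x`, takes the same transitions as the
configuration `C` that it represents. -/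
def Faithful (T : StarFreeTransducer Q A B) (ψ : List (Marked A) → Y) (hs : Function.Surjective φ)
    (p u s : List A) (c : GuardedState Q X × ℕ) (C : Q × ℕ) (x : Marked (X × A × X)) : Prop :=
  ∃ d m n P y S, c.1 = run C.1 d m n ∧ markedWord (p ++ u ++ s) = P ++ y :: S ∧ P.length = C.2 ∧
    C.2 = p.length + c.2 ∧ (∀ τ, T.Candidate ψ hs C.1 d m n x τ → T.Enabled ψ C.1 (ψ P) y (ψ S) τ ∧
      ∀ q : Q, ∃ i : ℕ, (i : ℤ) = (c.2 : ℤ) + (τ.move : ℤ) ∧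
        (afterMove hs q d m n x τ.move).2 = τ.move ∧
        Valid φ p u s ((afterMove hs q d m n x τ.move).1, i) (q, p.length + i)) ∧
    ∀ τ, T.OnPath (p ++ u ++ s) C → T.Enabled ψ C.1 (ψ P) y (ψ S) τ →
      (∃ i ≤ (p ++ u ++ s).length + 1, (i : ℤ) = (C.2 : ℤ) + (τ.move : ℤ)) →
      T.Candidate ψ hs C.1 d m n x τ

theorem OnPath.position_le {U : List A} {C : Q × ℕ} (h : T.OnPath U C) : C.2 ≤ U.length + 1 := by
  obtain ⟨d, hd, -, h⟩ := h
  rcases ReflTransGen.cases_head h with rfl | ⟨e, ⟨v, -, hs⟩, -⟩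
  · exact hd.2.le
  · obtain ⟨p, x, s, hp, he⟩ := exists_split_of_step hs
    have := congrArg List.length hp
    simp [length_markedWord] at this
    omega

theorem Faithful.unique (hg : T.Guides ψ φ) {p u s : List A} {c : GuardedState Q X × ℕ}
    {C : Q × ℕ} {x : Marked (X × A × X)} (hf : T.Faithful ψ hs p u s c C x) {d : Side} {m n : X}
    (hc : c.1 = run C.1 d m n) {τ τ' : LookAroundTransition Q A B}
    (h : T.Candidate ψ hs C.1 d m n x τ) (h' : T.Candidate ψ hs C.1 d m n x τ') : τ' = τ := by
  obtain ⟨d', m', n', P, y, S, hc', hU, hP, -, h1, -⟩ := hf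
  rw [hc] at hc'
  simp only [run.injEq, true_and] at hc'
  obtain ⟨rfl, rfl, rfl⟩ := hc'
  exact enabled_unique hg.deterministic hg.decides hU (h1 _ h').1 (h1 _ h).1

theorem Faithful.of_step (hg : T.Guides ψ φ) {p u s : List A} {c : GuardedState Q X × ℕ}
    {C C' : Q × ℕ} {v : List B} {x : Marked (X × A × X)} (hf : T.Faithful ψ hs p u s c C x)
    (hC : T.OnPath (p ++ u ++ s) C) (h : T.LiveStep (p ++ u ++ s) C v C') :
    ∃ c', c'.1 = ((T.guarded ψ hs).δ c.1 x).1 ∧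
      (c'.2 : ℤ) = (c.2 : ℤ) + (((T.guarded ψ hs).δ c.1 x).2 : ℤ) ∧
      v = (T.guarded ψ hs).γ c.1 x ∧ Valid φ p u s c' C' := by
  have hC' := (hC.next hg.deterministic ⟨v, h⟩).position_le
  have hf' := hf
  obtain ⟨d, m, n, P, y, S, hc, hU, hP, hp, h1, h2⟩ := hf
  obtain ⟨-, hst⟩ := h
  rw [show C = (C.1, P.length) from Prod.ext rfl hP.symm, step_iff hg.decides hU] at hst
  obtain ⟨τ, hτ, ht, hm, hv⟩ := hst
  have hcand := h2 τ hC hτ ⟨C'.2, hC', by omega⟩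
  obtain ⟨i, hi, hi', hval⟩ := (h1 τ hcand).2 τ.target
  obtain ⟨e1, e2⟩ := guarded_of_candidate hcand (fun τ' h' => hf'.unique hg hc hcand h')
  refine ⟨((afterMove hs τ.target d m n x τ.move).1, i), ?_, ?_, ?_, ?_⟩
  · rw [hc, e1]
  · rw [hc, e1, hi', hi]
  · rw [hc, e2, hv]
  · rwa [show C' = (τ.target, p.length + i) from Prod.ext ht (by simp only; omega)]

theorem Faithful.of_guarded_step (hg : T.Guides ψ φ) {p u s : List A}
    {c c' : GuardedState Q X × ℕ} {C : Q × ℕ} {x : Marked (X × A × X)}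
    (hf : T.Faithful ψ hs p u s c C x) (h1 : c'.1 = ((T.guarded ψ hs).δ c.1 x).1)
    (h2 : (c'.2 : ℤ) = (c.2 : ℤ) + (((T.guarded ψ hs).δ c.1 x).2 : ℤ)) :
    (c'.1 = dead ∧ c'.2 = c.2 ∧ (T.guarded ψ hs).γ c.1 x = []) ∨
      ∃ C', T.Step (p ++ u ++ s) C ((T.guarded ψ hs).γ c.1 x) C' ∧ Valid φ p u s c' C' := by
  have hf' := hf
  obtain ⟨d, m, n, P, y, S, hc, hU, hP, hp, h3, -⟩ := hf
  by_cases hex : ∃ τ, T.Candidate ψ hs C.1 d m n x τ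
  · obtain ⟨τ, hcand⟩ := hex
    obtain ⟨hτ, h4⟩ := h3 τ hcand
    obtain ⟨i, hi, hi', hval⟩ := h4 τ.target
    obtain ⟨e1, e2⟩ := guarded_of_candidate hcand (fun τ' h' => hf'.unique hg hc hcand h')
    rw [hc, e1] at h1 h2
    refine .inr ⟨(τ.target, p.length + i), ?_, ?_⟩
    · rw [show C = (C.1, P.length) from Prod.ext rfl hP.symm, step_iff hg.decides hU]
      refine ⟨τ, hτ, rfl, by simp only; omega, ?_⟩
      rw [hc, e2]
    · rwa [show c' = ((afterMove hs τ.target d m n x τ.move).1, i) from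
        Prod.ext h1 (by rw [hi'] at h2; simp only; omega)]
  · obtain ⟨e1, e2⟩ := guarded_of_not_candidate hex
    rw [hc, e1] at h1 h2
    rw [hc]
    exact .inl ⟨h1, by simpa using h2, e2⟩

section Letter

variable {p u s : List A} {k : ℕ} {a : A}

theorem append_eq_of_getElem? (hk : u[k]? = some a) :
    p ++ u ++ s = p ++ u.take k ++ a :: (u.drop (k + 1) ++ s) := by
  obtain ⟨hlt, rfl⟩ := List.getElem?_eq_some_iff.1 hk
  rw [← List.cons_append, ← List.drop_eq_getElem_cons hlt, ← List.append_assoc,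
    List.append_assoc p (u.take k), List.take_append_drop]

theorem valSnoc_take (h : AperiodicInvariant φ) (hk : u[k]? = some a) :
    valSnoc hs (φ (p ++ u.take k)) a = φ (p ++ u.take (k + 1)) := by
  rw [valSnoc_apply h, List.take_add_one, hk]
  simp

theorem valCons_drop (h : AperiodicInvariant φ) (hk : u[k]? = some a) :
    valCons hs a (φ (u.drop (k + 1) ++ s)) = φ (u.drop k ++ s) := by
  obtain ⟨hlt, rfl⟩ := List.getElem?_eq_some_iff.1 hk
  rw [valCons_apply h, List.drop_eq_getElem_cons hlt]
  rfl

theorem matches_iff_valid (h : AperiodicInvariant φ) (hk : u[k]? = some a) {q : Q} {d : Side}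
    {m n : X} : Matches hs d m n (φ (p ++ u.take k), a, φ (u.drop (k + 1) ++ s)) ↔
      Valid φ p u s (run q d m n, k + 1) (q, p.length + (k + 1)) := by
  have hlt := (List.getElem?_eq_some_iff.1 hk).1
  constructor
  · intro hm
    cases d with
    | left =>
      obtain ⟨rfl, rfl⟩ := hm
      rw [valCons_drop h hk]
      exact .left q k hlt.le
    | right =>
      obtain ⟨rfl, rfl⟩ := hm
      rw [valSnoc_take h hk]
      exact .right q (k + 1) hlt
  · intro hv
    generalize hc : (run q d m n, k + 1) = c at hv
    generalize (q, p.length + (k + 1)) = C at hv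
    cases hv with
    | left q b hb =>
      simp only [Prod.mk.injEq, run.injEq, Nat.add_right_cancel_iff] at hc
      obtain ⟨⟨-, rfl, rfl, rfl⟩, rfl⟩ := hc
      exact ⟨rfl, (valCons_drop h hk).symm⟩
    | right q b hb =>
      simp only [Prod.mk.injEq, run.injEq] at hc
      obtain ⟨⟨-, rfl, rfl, rfl⟩, rfl⟩ := hc
      exact ⟨(valSnoc_take h hk).symm, rfl⟩

/-- At a letter of a consistently annotated factor, transitions are taken exactly from configurations
that represent a configuration on the accepting path. -/
theorem candidate_letter (hg : T.Guides ψ φ) (hk : u[k]? = some a) {q : Q} {d : Side} {m n : X}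
    {τ : LookAroundTransition Q A B} :
    T.Candidate ψ hs q d m n (.letter (φ (p ++ u.take k), a, φ (u.drop (k + 1) ++ s))) τ ↔
      Valid φ p u s (run q d m n, k + 1) (q, p.length + (k + 1)) ∧
      T.OnPath (p ++ u ++ s) (q, p.length + (k + 1)) ∧
      T.Enabled ψ q (ψ (.leftEnd :: (p ++ u.take k).map .letter)) (.letter a)
        (ψ ((u.drop (k + 1) ++ s).map .letter ++ [.rightEnd])) τ := by
  have e1 := apply_rep hs (φ (p ++ u.take k))
  have e2 := apply_rep hs (φ (u.drop (k + 1) ++ s))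
  have hu := append_eq_of_getElem? (p := p) (s := s) hk
  have hpos : (p ++ u.take k).length + 1 = p.length + (k + 1) := by
    have := (List.getElem?_eq_some_iff.1 hk).1
    simp
    omega
  have hv : T.Visits q (rep hs (φ (p ++ u.take k))) a (rep hs (φ (u.drop (k + 1) ++ s))) ↔
      T.OnPath (p ++ u ++ s) (q, p.length + (k + 1)) := by
    rw [hu, ← hpos]
    exact ⟨hg.visits _ _ _ _ e1 e2 q a, hg.visits _ _ _ _ e1.symm e2.symm q a⟩
  have he1 := hg.tape.congr_left (hg.tape_of_word _ _ e1) [.leftEnd]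
  have he2 := hg.tape.congr_right (hg.tape_of_word _ _ e2) [.rightEnd]
  rw [List.singleton_append, List.singleton_append] at he1
  simp only [Candidate]
  rw [matches_iff_valid hg.word hk (q := q), hv, he1, he2]

theorem Valid.change_state {d : Side} {m n : X} {q q' : Q} {i j : ℕ}
    (h : Valid φ p u s (run q d m n, i) (q, j)) : Valid φ p u s (run q' d m n, i) (q', j) := by
  generalize hc : (run q d m n, i) = c at h
  generalize hC : (q, j) = C at h
  cases h with
  | left q b hb =>
    simp only [Prod.mk.injEq, run.injEq] at hc hC
    obtain ⟨⟨-, rfl, rfl, rfl⟩, rfl⟩ := hc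
    obtain ⟨-, rfl⟩ := hC
    exact .left q' b hb
  | right q b hb =>
    simp only [Prod.mk.injEq, run.injEq] at hc hC
    obtain ⟨⟨-, rfl, rfl, rfl⟩, rfl⟩ := hc
    obtain ⟨-, rfl⟩ := hC
    exact .right q' i hb

theorem faithful_letter (hg : T.Guides ψ φ) (hk : u[k]? = some a) {c : GuardedState Q X × ℕ}
    {C : Q × ℕ} (hc : Valid φ p u s c C) (hck : c.2 = k + 1) :
    T.Faithful ψ hs p u s c C (.letter (φ (p ++ u.take k), a, φ (u.drop (k + 1) ++ s))) := by
  obtain ⟨hlt, ha⟩ := List.getElem?_eq_some_iff.1 hk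
  obtain ⟨⟨d, m, n, hrun⟩, hpos⟩ := hc.exists_run
  obtain ⟨c, i⟩ := c
  obtain ⟨q, j⟩ := C
  obtain rfl : i = k + 1 := hck
  obtain rfl : c = run q d m n := hrun
  obtain rfl : j = p.length + (k + 1) := hpos
  refine ⟨d, m, n, _, _, (u.drop (k + 1) ++ s).map .letter ++ [.rightEnd], rfl, ?_, ?_, rfl, ?_,
    fun τ hp he _ => (candidate_letter hg hk).2 ⟨hc, hp, he⟩⟩
  · rw [append_eq_of_getElem? hk]
    simp [markedWord]
  · simp
    omega
  · intro τ hτ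
    refine ⟨((candidate_letter hg hk).1 hτ).2.2, fun q' => ?_⟩
    generalize τ.move = mv
    cases mv
    · exact ⟨k + 1, by simp, rfl, hc.change_state⟩
    · refine ⟨k, by simp, rfl, ?_⟩
      simp only [afterMove, valCons_drop hg.word hk]
      exact .right q' k hlt.le
    · refine ⟨k + 2, by simp; omega, rfl, ?_⟩
      simp only [afterMove, valSnoc_take hg.word hk]
      exact .left q' (k + 1) hlt

end Letter

section Ends

variable {u : List A}

theorem faithful_leftEnd (hg : T.Guides ψ φ) {c : GuardedState Q X × ℕ}
    {C : Q × ℕ} (hc : Valid φ [] u [] c C) (hck : c.2 = 0) :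
    T.Faithful ψ hs [] u [] c C .leftEnd := by
  cases hc with
  | left => simp at hck
  | right q b hb =>
    obtain rfl : b = 0 := hck
    have e := hg.tape_of_word _ _ (apply_rep hs (φ (u.drop 0 ++ [])))
    have he := hg.tape.congr_right e [.rightEnd]
    refine ⟨_, _, _, [], .leftEnd, (u.drop 0 ++ []).map .letter ++ [.rightEnd], rfl,
      by simp [markedWord], rfl, rfl, ?_, ?_⟩
    · intro τ hτ
      rw [Candidate, he] at hτ
      refine ⟨hτ.1, fun q' => ?_⟩
      have hm := hτ.2
      generalize τ.move = mv at hm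
      cases mv
      · exact ⟨0, by simp, rfl, .right q' 0 hb⟩
      · simp at hm
      · exact ⟨1, by simp, rfl, .left q' 0 hb⟩
    · rintro τ - hτ ⟨i, -, hi⟩
      rw [Candidate, he]
      refine ⟨hτ, fun hm => ?_⟩
      rw [hm] at hi
      simp at hi

theorem faithful_rightEnd (hg : T.Guides ψ φ) {c : GuardedState Q X × ℕ}
    {C : Q × ℕ} (hc : Valid φ [] u [] c C) (hck : c.2 = u.length + 1) :
    T.Faithful ψ hs [] u [] c C .rightEnd := by
  cases hc with
  | right q b hb => simp only at hck; omega
  | left q b hb =>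
    obtain rfl : b = u.length := by simpa using hck
    have e := hg.tape_of_word _ _ (apply_rep hs (φ ([] ++ u.take u.length)))
    have he := hg.tape.congr_left e [.leftEnd]
    refine ⟨_, _, _, [.leftEnd] ++ ([] ++ u.take u.length).map .letter, .rightEnd, [], rfl,
      by simp [markedWord], by simp, rfl, ?_, ?_⟩
    · intro τ hτ
      rw [Candidate, ← List.singleton_append, he] at hτ
      refine ⟨hτ.1, fun q' => ?_⟩
      have hm := hτ.2
      generalize τ.move = mv at hm
      cases mv
      · exact ⟨u.length + 1, by simp, rfl, .left q' u.length hb⟩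
      · exact ⟨u.length, by simp, rfl, .right q' u.length hb⟩
      · simp at hm
    · rintro τ - hτ ⟨i, hle, hi⟩
      rw [Candidate, ← List.singleton_append, he]
      refine ⟨hτ, fun hm => ?_⟩
      rw [hm] at hi
      simp at hi hle
      omega

theorem faithful (hg : T.Guides ψ φ) {c : GuardedState Q X × ℕ} {C : Q × ℕ}
    (hc : Valid φ [] u [] c C) {x : Marked (X × A × X)}
    (hx : (markedWord (bimark φ [] u []))[c.2]? = some x) : T.Faithful ψ hs [] u [] c C x := by
  rcases TwoWayTransducer.getElem?_markedWord_cases hx with ⟨h, rfl⟩ | ⟨k, l, h, hl, rfl⟩ | ⟨h, rfl⟩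
  · exact faithful_leftEnd hg hc h
  · rw [getElem?_bimark, Option.map_eq_some_iff] at hl
    obtain ⟨a, ha, rfl⟩ := hl
    exact faithful_letter hg ha hc h
  · rw [length_bimark] at h
    exact faithful_rightEnd hg hc h

/-- The configurations of `guarded` before the simulation starts. -/
def IsEntry (u : List A) (c : GuardedState Q X × ℕ) : Prop :=
  c = (init, 0) ∨ c = (init, 1) ∨ c = (enter (φ []) (φ u), 0)

/-- The simulation realizes the same function, over inputs annotated with the values of contexts. -/
theorem guarded_isImage (hg : T.Guides ψ φ) (u : List A) (v : List B) :
    (T.guarded ψ hs).IsImage (bimark φ [] u []) v ↔ T.IsImage u v := by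
  have hword : ([] : List A) ++ u ++ [] = u := by simp
  have hfin : ∀ {c : GuardedState Q X × ℕ} {C : Q × ℕ}, Valid φ [] u [] c C →
      ((T.guarded ψ hs).IsAccepting (bimark φ [] u []) c ↔ T.IsAccepting u C) := by
    intro c C hc
    obtain ⟨⟨d, m, n, h1⟩, h2⟩ := hc.exists_run
    simp [TwoWayTransducer.IsAccepting, IsAccepting, guarded, length_bimark, h1, h2]
  have hstart : Valid φ [] u [] (run T.start .right (φ []) (φ u), 0) (T.start, 0) := by
    simpa using Valid.right (φ := φ) (p := []) (u := u) (s := []) T.start 0 (Nat.zero_le _)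
  have hx0 : (markedWord (bimark φ [] u []))[0]? = some .leftEnd := rfl
  have hstep1 : ∃ x, (markedWord (bimark φ [] u []))[1]? = some x ∧
      (T.guarded ψ hs).δ init x = (enter (φ []) (φ u), -1) := by
    cases u with
    | nil => exact ⟨.rightEnd, rfl, rfl⟩
    | cons a u =>
      refine ⟨.letter (φ [], a, φ (u ++ [])), rfl, ?_⟩
      simp only [guarded]
      rw [valCons_apply hg.word, List.append_nil]
  obtain ⟨x1, hx1, hδ1⟩ := hstep1
  constructor
  · intro h
    obtain ⟨d, hp, hd⟩ := TwoWayTransducer.isImage_iff.1 h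
    obtain ⟨D, hR, hp'⟩ := hp.simulate (step' := T.LiveStep u)
      (fun c C => (IsEntry (φ := φ) u c ∧ C = (T.start, 0)) ∨ Valid φ [] u [] c C ∨ c.1 = dead) (by
        rintro c v e C hR ⟨hna, x, hx, h1, h2, rfl⟩
        rcases hR with ⟨hc, rfl⟩ | hc | hc
        · rcases hc with rfl | rfl | rfl
          · obtain rfl : Marked.leftEnd = x := by simpa [hx0] using hx
            refine ⟨_, .inl ⟨.inr (.inl ?_), rfl⟩, .refl _⟩
            refine Prod.ext h1 ?_
            simp [guarded] at h2
            simp only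
            omega
          · obtain rfl : x1 = x := by simpa [hx1] using hx
            rw [hδ1] at h1 h2
            refine ⟨_, .inl ⟨.inr (.inr ?_), rfl⟩, .refl _⟩
            refine Prod.ext h1 ?_
            simp at h2
            simp only
            omega
          · obtain rfl : Marked.leftEnd = x := by simpa [hx0] using hx
            refine ⟨_, .inr (.inl ?_), .refl _⟩
            convert hstart using 1
            refine Prod.ext h1 ?_
            simp [guarded] at h2
            simp only
            omega
        · rcases (faithful hg hc hx).of_guarded_step hg h1 h2 with ⟨h3, -, h4⟩ | ⟨C', h3, h4⟩
          · exact ⟨C, .inr (.inr h3), h4 ▸ .refl _⟩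
          · rw [hword] at h3
            exact ⟨C', .inr (.inl h4), by
              simpa using (Produces.refl C').head ⟨fun h => hna ((hfin hc).2 h), h3⟩⟩
        · rw [hc] at h1 ⊢
          exact ⟨C, .inr (.inr h1), .refl _⟩) (T.start, 0) (.inl ⟨.inl rfl, rfl⟩)
    obtain ⟨π, hπ⟩ := hp'
    rcases hR with ⟨hc, -⟩ | hc | hc
    · obtain ⟨⟨q, -, s, m, n, hq⟩, -⟩ := hd
      rcases hc with rfl | rfl | rfl <;> simp at hq
    · exact ⟨π, D, hπ, (hfin hc).1 hd⟩
    · obtain ⟨⟨q, -, s, m, n, hq⟩, -⟩ := hd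
      rw [hc] at hq
      simp at hq
  · rintro ⟨π, D, hπ, hD⟩
    have hp : Produces (T.LiveStep u) (T.start, 0) v D := ⟨π, hπ⟩
    have hon : T.OnPath u (T.start, 0) := ⟨D, hD, .refl, hp.reflTransGen⟩
    obtain ⟨d, ⟨hval, -⟩, hp'⟩ := hp.simulate
      (step' := (T.guarded ψ hs).LiveStep (bimark φ [] u []))
      (fun C c => Valid φ [] u [] c C ∧ T.OnPath u C) (by
        rintro C v C' c ⟨hc, hC⟩ hst
        have hle := (hC.position_le)
        have hc2 := hc.exists_run.2
        simp only [List.length_nil, Nat.zero_add] at hc2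
        have hlt : c.2 < (markedWord (bimark φ [] u [])).length := by
          rw [length_markedWord, length_bimark]
          omega
        have hx := List.getElem?_eq_getElem hlt
        rw [← hword] at hst
        obtain ⟨c', h1, h2, h3, h4⟩ := (faithful hg hc hx).of_step hg (hword.symm ▸ hC) hst
        rw [hword] at hst
        refine ⟨c', ⟨h4, hC.next hg.deterministic ⟨v, hst⟩⟩, ?_⟩
        simpa using (Produces.refl c').head
          (⟨fun h => hst.1 ((hfin hc).1 h), _, hx, h1, h2, h3⟩ :
            (T.guarded ψ hs).LiveStep (bimark φ [] u []) c v c'))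
      (run T.start .right (φ []) (φ u), 0) ⟨hstart, hon⟩
    have hna : ∀ {c : GuardedState Q X × ℕ}, IsEntry (φ := φ) u c →
        ¬ (T.guarded ψ hs).IsAccepting (bimark φ [] u []) c := by
      rintro c hc ⟨⟨q, -, s, m, n, hq⟩, -⟩
      rcases hc with rfl | rfl | rfl <;> simp at hq
    refine TwoWayTransducer.isImage_iff.2 ⟨d, ?_, (hfin hval).2 hD⟩
    refine Produces.head (v := []) (d := (init, 1)) ⟨hna (.inl rfl), .leftEnd, hx0, rfl, rfl, rfl⟩ ?_
    refine Produces.head (v := []) (d := (enter (φ []) (φ u), 0))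
      ⟨hna (.inr (.inl rfl)), x1, hx1, ?_, ?_, rfl⟩ ?_
    · rw [hδ1]
    · rw [hδ1]
      rfl
    · exact Produces.head (v := []) ⟨hna (.inr (.inr rfl)), .leftEnd, hx0, rfl, rfl, rfl⟩ hp'

end Ends

end Guarded

end StarFreeTransducer

/-! ### Words that cannot be crossed -/

namespace TwoWayAutomaton

open Relation

variable {S A : Type*} {M : TwoWayAutomaton S A}

/-- If no run crosses `f` from left to right, then runs that start on the left of `f` do not see what
is on the right of `f`. -/
theorem behavior_left_append {f : List A} (hf : f ≠ []) (h : M.behavior .left .right f = ∅)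
    (g : List A) (y : Side) : M.behavior .left y (f ++ g) = M.behavior .left y f := by
  have hlen : 0 < f.length := List.length_pos_iff.2 hf
  have key : ∀ p c, ReflTransGen (M.InnerStep (f ++ g)) (p, 1) c →
      ReflTransGen (M.InnerStep f) (p, 1) c ∧ c.2 ≤ f.length := by
    intro p c hc
    induction hc with
    | refl => exact ⟨.refl, hlen⟩
    | @tail c d _ hs ih =>
      obtain ⟨hr, hle⟩ := ih
      have hn := innerStep_near hs
      have hs' : M.InnerStep f c d := hs.transfer rfl rfl hn.1
        (List.getElem?_append_left (by omega)).symm rfl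
      refine ⟨hr.tail hs', ?_⟩
      by_contra hlt
      have : (p, d.1) ∈ M.behavior .left .right f := by
        have hd : d = (d.1, f.length + 1) := Prod.ext rfl (by simp only; omega)
        have := hr.tail hs'
        rw [hd] at this
        exact this
      simp [h] at this
  ext ⟨p, q⟩
  constructor
  · intro hpq
    obtain ⟨hr, hle⟩ := key p _ hpq
    cases y with
    | left => exact hr
    | right => simp [Side.exit] at hle
  · intro hpq
    cases y with
    | left => simpa [behavior, Side.entry, Side.exit] using lift_run [] g hpq
    | right => simp [h] at hpq

theorem behavior_right_append {f : List A} (hf : f ≠ []) (h : M.behavior .right .left f = ∅)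
    (g : List A) (y : Side) : M.behavior .right y (g ++ f) = M.behavior .right y f := by
  have hm : M.mirror.behavior .left .right f.reverse = ∅ := by
    rw [← h]
    exact M.behavior_mirror .right .left f
  have := behavior_left_append (by simpa using hf) hm g.reverse y.flip
  rw [← M.behavior_mirror .right y f, ← M.behavior_mirror .right y (g ++ f), List.reverse_append]
  exact this

end TwoWayAutomaton

namespace StarFreeTransducer

open Relation TwoWayAutomaton GuardedState

variable {Q : Type u} {A : Type v} {B : Type w} {X : Type} {Y : Type*} {φ : List A → X}
  {T : StarFreeTransducer Q A B} {ψ : List (Marked A) → Y} {hs : Function.Surjective φ}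

/-- The letters `l` and `l'` agree with the values of the parts before and after their common
boundary. -/
def Consecutive (hs : Function.Surjective φ) (l l' : X × A × X) : Prop :=
  l'.1 = valSnoc hs l.1 l.2.1 ∧ l.2.2 = valCons hs l'.2.1 l'.2.2

theorem exists_of_not_isChain {α : Type*} {R : α → α → Prop} {z : List α} (h : ¬ z.IsChain R) :
    ∃ (k : ℕ) (a b : α), z[k]? = some a ∧ z[k + 1]? = some b ∧ ¬ R a b := by
  rw [List.isChain_iff_getElem] at h
  push Not at h
  obtain ⟨k, hk, hR⟩ := h
  exact ⟨k, z[k], z[k + 1], by simp, by simp, hR⟩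

/-- A step of `guarded` at a letter of the input. -/
theorem guarded_letter (c : GuardedState Q X) (l : X × A × X) :
    (T.guarded ψ hs).δ c (.letter l) = (dead, 0) ∨
      (c = init ∧ (T.guarded ψ hs).δ c (.letter l) = (enter l.1 (valCons hs l.2.1 l.2.2), -1)) ∨
      ∃ q d m n q' mv, c = run q d m n ∧ Matches hs d m n l ∧
        (T.guarded ψ hs).δ c (.letter l) = afterMove hs q' d m n (.letter l) mv := by
  rcases c with _ | _ | _ | ⟨q, d, m, n⟩
  · exact .inl rfl
  · exact .inr (.inl ⟨rfl, rfl⟩)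
  · exact .inl rfl
  · by_cases hex : ∃ τ, T.Candidate ψ hs q d m n (.letter l) τ
    · refine .inr (.inr ⟨q, d, m, n, hex.choose.target, hex.choose.move, rfl,
        hex.choose_spec.1, ?_⟩)
      simp only [guarded, hex, dite_true]
    · exact .inl (guarded_of_not_candidate hex).1

/-- The simulation dies at a boundary at which the annotations disagree. -/
theorem guarded_not_crossed {z : List (X × A × X)} (h : ¬ z.IsChain (Consecutive hs)) :
    (T.guarded ψ hs).behavior .left .right z = ∅ ∧
      (T.guarded ψ hs).behavior .right .left z = ∅ := by
  obtain ⟨k, l, l', hl, hl', hR⟩ := exists_of_not_isChain h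
  have hlen := (List.getElem?_eq_some_iff.1 hl').1
  constructor
  · refine Set.eq_empty_iff_forall_notMem.2 fun ⟨p, q⟩ hpq => ?_
    have key : ∀ c, ReflTransGen ((T.guarded ψ hs).InnerStep z) (p, 1) c →
        c.2 ≤ k + 1 ∨ (c.2 = k + 2 ∧ (c.1 = dead ∨
          ∃ q, c.1 = run q .left (valSnoc hs l.1 l.2.1) l.2.2)) := by
      intro c hc
      induction hc with
      | refl => exact .inl (by simp)
      | @tail c d _ hst ih =>
        have hn := innerStep_near hst
        obtain ⟨j, y, hj, hy, h1, h2⟩ := innerStep_iff.1 hst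
        rcases ih with ih | ⟨ih, hc⟩
        · rcases Nat.lt_or_ge d.2 (k + 2) with hd | hd
          · exact .inl (by omega)
          · obtain rfl : j = k := by omega
            obtain rfl : l = y := by simpa [hl] using hy
            refine .inr ⟨by omega, ?_⟩
            rcases guarded_letter (T := T) (ψ := ψ) (hs := hs) c.1 l with
              he | ⟨-, he⟩ | ⟨_, _, _, _, q', mv, -, -, he⟩
            · exact .inl (by rw [h1, he])
            · rw [he] at h2
              simp at h2
              omega
            · rw [he] at h1 h2
              cases mv
              · simp [afterMove] at h2; omega
              · simp [afterMove] at h2; omega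
              · exact .inr ⟨q', h1⟩
        · obtain rfl : j = k + 1 := by omega
          obtain rfl : l' = y := by simpa [hl'] using hy
          have he : (T.guarded ψ hs).δ c.1 (.letter l') = (dead, 0) := by
            rcases guarded_letter (T := T) (ψ := ψ) (hs := hs) c.1 l' with
              he | ⟨he, -⟩ | ⟨q₁, d₁, m₁, n₁, q', mv, hrun, hm, -⟩
            · exact he
            · rcases hc with hc | ⟨q, hc⟩ <;> simp [hc] at he
            · rcases hc with hc | ⟨q, hc⟩
              · simp [hc] at hrun
              · rw [hc] at hrun
                simp only [run.injEq] at hrun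
                obtain ⟨-, rfl, rfl, rfl⟩ := hrun
                exact absurd ⟨hm.1.symm, hm.2⟩ hR
          rw [he] at h1 h2
          simp at h2
          exact .inr ⟨by omega, .inl h1⟩
    have := key _ hpq
    simp [Side.exit] at this
    omega
  · refine Set.eq_empty_iff_forall_notMem.2 fun ⟨p, q⟩ hpq => ?_
    have key : ∀ c, ReflTransGen ((T.guarded ψ hs).InnerStep z) (p, z.length) c →
        k + 2 ≤ c.2 ∨ (c.2 = k + 1 ∧ (c.1 = dead ∨ (∃ m n, c.1 = enter m n) ∨
          ∃ q, c.1 = run q .right l'.1 (valCons hs l'.2.1 l'.2.2))) := by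
      intro c hc
      induction hc with
      | refl => exact .inl (by simp only; omega)
      | @tail c d _ hst ih =>
        have hn := innerStep_near hst
        obtain ⟨j, y, hj, hy, h1, h2⟩ := innerStep_iff.1 hst
        rcases ih with ih | ⟨ih, hc⟩
        · rcases Nat.lt_or_ge (k + 1) d.2 with hd | hd
          · exact .inl (by omega)
          · obtain rfl : j = k + 1 := by omega
            obtain rfl : l' = y := by simpa [hl'] using hy
            refine .inr ⟨by omega, ?_⟩
            rcases guarded_letter (T := T) (ψ := ψ) (hs := hs) c.1 l' with
              he | ⟨-, he⟩ | ⟨_, _, _, _, q', mv, -, -, he⟩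
            · exact .inl (by rw [h1, he])
            · exact .inr (.inl ⟨_, _, by rw [h1, he]⟩)
            · rw [he] at h1 h2
              cases mv
              · simp [afterMove] at h2; omega
              · exact .inr (.inr ⟨q', h1⟩)
              · simp [afterMove] at h2; omega
        · obtain rfl : j = k := by omega
          obtain rfl : l = y := by simpa [hl] using hy
          have he : (T.guarded ψ hs).δ c.1 (.letter l) = (dead, 0) := by
            rcases guarded_letter (T := T) (ψ := ψ) (hs := hs) c.1 l with
              he | ⟨he, -⟩ | ⟨q₁, d₁, m₁, n₁, q', mv, hrun, hm, -⟩
            · exact he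
            · rcases hc with hc | ⟨m, n, hc⟩ | ⟨q, hc⟩ <;> simp [hc] at he
            · rcases hc with hc | ⟨m, n, hc⟩ | ⟨q, hc⟩
              · simp [hc] at hrun
              · simp [hc] at hrun
              · rw [hc] at hrun
                simp only [run.injEq] at hrun
                obtain ⟨-, rfl, rfl, rfl⟩ := hrun
                exact absurd ⟨hm.1, hm.2.symm⟩ hR
          rw [he] at h1 h2
          simp at h2
          exact .inr ⟨by omega, .inl h1⟩
    have := key _ hpq
    simp [Side.exit] at this

/-- Dead runs, and runs that look for the left endmarker at a letter, do not leave a word. -/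
theorem guarded_not_exit {z : List (X × A × X)} {e : GuardedState Q X × ℕ} {f : GuardedState Q X}
    {y : Side} (he : e.1 = dead ∨ ∃ m n, e.1 = enter m n) (h1 : 1 ≤ e.2) (h2 : e.2 ≤ z.length) :
    ¬ ReflTransGen ((T.guarded ψ hs).InnerStep z) e (f, y.exit z.length) := by
  intro h
  suffices h : ∀ e', ReflTransGen ((T.guarded ψ hs).InnerStep z) e e' →
      (e'.1 = dead ∨ ∃ m n, e'.1 = enter m n) ∧ e'.2 = e.2 by
    have := (h _ ‹_›).2
    cases y <;> simp [Side.exit] at this <;> omega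
  intro e' h
  induction h with
  | refl => exact ⟨he, rfl⟩
  | @tail b d _ hst ih =>
    obtain ⟨j, l, -, -, h3, h4⟩ := innerStep_iff.1 hst
    have hδ : (T.guarded ψ hs).δ b.1 (.letter l) = (dead, 0) := by
      rcases ih.1 with hb | ⟨m, n, hb⟩ <;> rw [hb] <;> rfl
    rw [hδ] at h3 h4
    simp at h4
    exact ⟨.inl h3, by omega⟩

/-- Runs that do not start in a simulating state only see the first letter. -/
theorem guarded_behavior_of_not_run {z z' : List (X × A × X)} {c f : GuardedState Q X} {x y : Side}
    (hc : ∀ q d m n, c ≠ run q d m n) (hz : 2 ≤ z.length) (hz' : z.head? = z'.head?)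
    (h : (c, f) ∈ (T.guarded ψ hs).behavior x y z) :
    (c, f) ∈ (T.guarded ψ hs).behavior x y z' := by
  have hent : 1 ≤ x.entry z.length ∧ x.entry z.length ≤ z.length := by
    cases x <;> simp [Side.entry] <;> omega
  rcases c with _ | _ | ⟨m, n⟩ | ⟨q, d, m, n⟩
  · exact absurd h (guarded_not_exit (.inl rfl) hent.1 hent.2)
  · rcases ReflTransGen.cases_head h with h | ⟨e, hst, hr⟩
    · have := congrArg Prod.snd h
      cases y <;> simp [Side.exit] at this <;> omega
    · obtain ⟨j, l, hj, hl, h1, h2⟩ := innerStep_iff.1 hst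
      have h3 : e.1 = enter l.1 (valCons hs l.2.1 l.2.2) := h1
      replace h2 : (e.2 : ℤ) = (x.entry z.length : ℤ) + ((-1 : SignType) : ℤ) := h2
      simp at h2
      cases x with
      | right =>
        simp only [Side.entry] at h2
        exact absurd hr (guarded_not_exit (.inr ⟨_, _, h3⟩) (by omega) (by omega))
      | left =>
        obtain rfl : j = 0 := by simpa [Side.entry] using hj.symm
        have he : e = (enter l.1 (valCons hs l.2.1 l.2.2), 0) :=
          Prod.ext h3 (by simp [Side.entry] at h2; exact h2)
        have hfin : (f, y.exit z.length) = e := by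
          rcases ReflTransGen.cases_head hr with h | ⟨e', ⟨h, -⟩, -⟩
          · exact h.symm
          · rw [he] at h
            simp at h
        rw [he, Prod.mk.injEq] at hfin
        obtain ⟨rfl, hy⟩ := hfin
        cases y with
        | right => simp [Side.exit] at hy
        | left =>
          have hl' : z'[0]? = some l := by
            rw [← List.head?_eq_getElem?, ← hz', List.head?_eq_getElem?, hl]
          exact .single (TwoWayTransducer.innerStep_of_getElem? hl' rfl rfl rfl)
  · exact absurd h (guarded_not_exit (.inr ⟨_, _, rfl⟩) hent.1 hent.2)
  · exact absurd rfl (hc q d m n)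

end StarFreeTransducer

/-! ### Runs inside a factor of the input -/

namespace StarFreeTransducer

open Relation TwoWayAutomaton GuardedState

section Within

variable {Q A B : Type*} {T : StarFreeTransducer Q A B} {p u s : List A}

/-- A step towards acceptance that starts inside the factor `u` of `p u s`. -/
def Within (T : StarFreeTransducer Q A B) (p u s : List A) (C D : Q × ℕ) : Prop :=
  p.length + 1 ≤ C.2 ∧ C.2 ≤ p.length + u.length ∧ T.Next (p ++ u ++ s) C D

theorem next_near {U : List A} {C D : Q × ℕ} (h : T.Next U C D) :
    D.2 ≤ C.2 + 1 ∧ C.2 ≤ D.2 + 1 := by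
  obtain ⟨-, -, τ, -, -, -, -, h, -⟩ := h
  generalize τ.move = m at h
  cases m <;> simp at h <;> omega

theorem within_reaches {C D : Q × ℕ} (h : ReflTransGen (T.Within p u s) C D) :
    ReflTransGen (T.Next (p ++ u ++ s)) C D :=
  ReflTransGen.map id (fun _ _ h => h.2.2) h

theorem OnPath.reaches (hdet : T.IsDeterministic) {U : List A} {C D : Q × ℕ} (hC : T.OnPath U C)
    (h : ReflTransGen (T.Next U) C D) : T.OnPath U D := by
  induction h with
  | refl => exact hC
  | tail _ hs ih => exact ih.next hdet hs

/-- A run from a factor, or from next to it, to a position next to the factor has a first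
configuration next to the factor. -/
theorem exists_first_exit {C D : Q × ℕ} (h : ReflTransGen (T.Next (p ++ u ++ s)) C D)
    (hC : p.length ≤ C.2 ∧ C.2 ≤ p.length + u.length + 1)
    (hD : ∃ y : Side, D.2 = p.length + y.exit u.length) :
    ∃ q, ∃ y : Side, ReflTransGen (T.Within p u s) C (q, p.length + y.exit u.length) ∧
      ReflTransGen (T.Next (p ++ u ++ s)) (q, p.length + y.exit u.length) D := by
  induction h using ReflTransGen.head_induction_on with
  | refl =>
    obtain ⟨y, hy⟩ := hD
    have : D = (D.1, p.length + y.exit u.length) := Prod.ext rfl hy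
    exact ⟨D.1, y, this ▸ .refl, this ▸ .refl⟩
  | @head C E hs hr ih =>
    by_cases h0 : C.2 = p.length
    · have : C = (C.1, p.length + Side.left.exit u.length) := Prod.ext rfl h0
      exact ⟨C.1, .left, this ▸ .refl, this ▸ .head hs hr⟩
    by_cases h1 : C.2 = p.length + u.length + 1
    · have : C = (C.1, p.length + Side.right.exit u.length) := Prod.ext rfl h1
      exact ⟨C.1, .right, this ▸ .refl, this ▸ .head hs hr⟩
    have := next_near hs
    obtain ⟨q, y, hw, hn⟩ := ih (by omega)
    exact ⟨q, y, .head ⟨by omega, by omega, hs⟩ hw, hn⟩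

theorem inside_of_between (hdet : T.IsDeterministic) {C D E : Q × ℕ}
    (h : ReflTransGen (T.Within p u s) C D) (hD : T.OnPath (p ++ u ++ s) D)
    (h1 : ReflTransGen (T.Next (p ++ u ++ s)) C E)
    (h2 : TransGen (T.Next (p ++ u ++ s)) E D) :
    p.length + 1 ≤ E.2 ∧ E.2 ≤ p.length + u.length := by
  induction h using ReflTransGen.head_induction_on with
  | refl => exact absurd (TransGen.trans_right h1 h2) (hD.not_transGen_self hdet)
  | head hs hr ih =>
    rcases ReflTransGen.cases_head h1 with rfl | ⟨F, hF, h1⟩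
    · exact ⟨hs.1, hs.2.1⟩
    · rw [next_rightUnique hdet _ hF hs.2.2] at h1
      exact ih h1

theorem samePos_entry (hu : u ≠ []) (m m' : ℕ) (x : Side) :
    SamePos (p ++ u) (wordPow u m) (wordPow u m') (u ++ s)
      (p.length + x.entry (u ++ wordPow u m ++ u).length)
      (p.length + x.entry (u ++ wordPow u m' ++ u).length) := by
  have := List.length_pos_iff.2 hu
  cases x with
  | left => exact .inl ⟨by simp [Side.entry], by simp [Side.entry]; omega, rfl⟩
  | right =>
    exact .inr ⟨u.length - 1, by simp; omega, by simp [Side.entry]; omega,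
      by simp [Side.entry]; omega⟩

theorem samePos_exit (hp : p ≠ []) (hs : s ≠ []) (m m' : ℕ) (x : Side) :
    SamePos (p ++ u) (wordPow u m) (wordPow u m') (u ++ s)
      (p.length + x.exit (u ++ wordPow u m ++ u).length)
      (p.length + x.exit (u ++ wordPow u m' ++ u).length) := by
  have := List.length_pos_iff.2 hp
  have := List.length_pos_iff.2 hs
  cases x with
  | left => exact .inl ⟨by simp [Side.exit]; omega, by simp [Side.exit], rfl⟩
  | right =>
    exact .inr ⟨u.length, by simp; omega, by simp [Side.exit]; omega,
      by simp [Side.exit]; omega⟩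

/-- The run inside a power of `u` that starts and ends in given states at given ends is determined
by the order of its configurations in the outer copies of `u` and next to these. -/
theorem within_wordPow (hdet : T.IsDeterministic) {m m' : ℕ}
    (h : ∀ v w ρ, T.IsContextPath v (wordPow u m) w ρ ↔ T.IsContextPath v (wordPow u m') w ρ)
    (hu : u ≠ []) (hp : p ≠ []) (hs : s ≠ []) {q q' : Q} {x y : Side}
    (hon : T.OnPath (p ++ (u ++ wordPow u m ++ u) ++ s)
      (q, p.length + x.entry (u ++ wordPow u m ++ u).length))
    (hr : ReflTransGen (T.Within p (u ++ wordPow u m ++ u) s)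
      (q, p.length + x.entry (u ++ wordPow u m ++ u).length)
      (q', p.length + y.exit (u ++ wordPow u m ++ u).length)) :
    T.OnPath (p ++ (u ++ wordPow u m' ++ u) ++ s)
      (q, p.length + x.entry (u ++ wordPow u m' ++ u).length) ∧
    ReflTransGen (T.Within p (u ++ wordPow u m' ++ u) s)
      (q, p.length + x.entry (u ++ wordPow u m' ++ u).length)
      (q', p.length + y.exit (u ++ wordPow u m' ++ u).length) := by
  have hU : ∀ m, p ++ u ++ wordPow u m ++ (u ++ s) = p ++ (u ++ wordPow u m ++ u) ++ s := by simp
  have hne : ∀ m (x y : Side), p.length + x.entry (u ++ wordPow u m ++ u).length ≠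
      p.length + y.exit (u ++ wordPow u m ++ u).length := by
    intro m x y
    have := List.length_pos_iff.2 hu
    rw [Ne, Nat.add_left_cancel_iff, List.length_append, List.length_append]
    cases x <;> cases y <;> simp only [Side.entry, Side.exit] <;> omega
  have htrans : ∀ {m q q'} {x y : Side}, ReflTransGen (T.Within p (u ++ wordPow u m ++ u) s)
      (q, p.length + x.entry (u ++ wordPow u m ++ u).length)
      (q', p.length + y.exit (u ++ wordPow u m ++ u).length) →
      TransGen (T.Next (p ++ (u ++ wordPow u m ++ u) ++ s))
      (q, p.length + x.entry (u ++ wordPow u m ++ u).length)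
      (q', p.length + y.exit (u ++ wordPow u m ++ u).length) := by
    intro m q q' x y hr
    refine (reflTransGen_iff_eq_or_transGen.1 (within_reaches hr)).resolve_left fun he => ?_
    exact hne m x y (congrArg Prod.snd he).symm
  have hto : ∀ {i j i' j' : ℕ} {q q' : Q},
      SamePos (p ++ u) (wordPow u m) (wordPow u m') (u ++ s) i i' →
      SamePos (p ++ u) (wordPow u m) (wordPow u m') (u ++ s) j j' →
      (T.Before (p ++ (u ++ wordPow u m ++ u) ++ s) (q, i) (q', j) ↔
        T.Before (p ++ (u ++ wordPow u m' ++ u) ++ s) (q, i') (q', j')) := by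
    intro i j i' j' q q' hi hj
    rw [← hU, ← hU]
    exact ⟨before_of_samePos (fun ρ => (h _ _ ρ).1) hi hj,
      before_of_samePos (fun ρ => (h _ _ ρ).2) hi.symm hj.symm⟩
  have hend := hon.reaches hdet (within_reaches hr)
  obtain ⟨hon', hend', hb⟩ := (hto (samePos_entry hu m m' x) (samePos_exit hp hs m m' y)).1
    ⟨hon, hend, htrans hr⟩
  refine ⟨hon', ?_⟩
  obtain ⟨e, z, hw, hrest⟩ := exists_first_exit hb.to_reflTransGen
    (by cases x <;> simp [Side.entry]) ⟨y, rfl⟩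
  rcases reflTransGen_iff_eq_or_transGen.1 hrest with he | he
  · rwa [← he] at hw
  -- An earlier exit would also exist inside the other power.
  have hone := hon'.reaches hdet (within_reaches hw)
  have hb1 := (hto (samePos_entry hu m m' x) (samePos_exit hp hs m m' z)).2
    ⟨hon', hone, htrans hw⟩
  have hb2 := (hto (samePos_exit hp hs m m' z) (samePos_exit hp hs m m' y)).2 ⟨hone, hend', he⟩
  have := inside_of_between hdet hr hend hb1.2.2.to_reflTransGen hb2.2.2
  cases z <;> simp [Side.exit] at this

end Within

section Guarded

variable {Q : Type u} {A : Type v} {B : Type w} {X : Type} {Y : Type*} {φ : List A → X}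
  {T : StarFreeTransducer Q A B} {ψ : List (Marked A) → Y} {hs : Function.Surjective φ}

/-- The state in which `guarded` leaves the factor `u` of `p u s`. -/
def exitState (φ : List A → X) (p u s : List A) (q : Q) : Side → GuardedState Q X
  | .left => run q .right (φ p) (φ (u ++ s))
  | .right => run q .left (φ (p ++ u)) (φ s)

theorem valid_exit {p u s : List A} {c : GuardedState Q X × ℕ} {q : Q} {y : Side} :
    Valid φ p u s c (q, p.length + y.exit u.length) ↔
      c = (exitState φ p u s q y, y.exit u.length) := by
  constructor
  · intro h
    generalize hC : (q, p.length + y.exit u.length) = C at h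
    cases h with
    | left q b hb =>
      simp only [Prod.mk.injEq] at hC
      obtain ⟨rfl, hC⟩ := hC
      cases y with
      | left => simp [Side.exit] at hC
      | right =>
        obtain rfl : b = u.length := by simp [Side.exit] at hC; omega
        simp [exitState, Side.exit]
    | right q b hb =>
      simp only [Prod.mk.injEq] at hC
      obtain ⟨rfl, hC⟩ := hC
      cases y with
      | left =>
        obtain rfl : b = 0 := by simp [Side.exit] at hC; omega
        simp [exitState, Side.exit]
      | right => simp [Side.exit] at hC; omega
  · rintro rfl
    cases y with
    | left => simpa [exitState, Side.exit] using Valid.right (φ := φ) (p := p) (u := u) (s := s) q 0 (Nat.zero_le _)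
    | right => simpa [exitState, Side.exit] using Valid.left (φ := φ) (p := p) (u := u) (s := s) q u.length le_rfl

/-- The behaviors of an annotated factor, in a simulating state: the annotation of the letter at the
entry has to match, and the run is a piece of the accepting path. -/
theorem guarded_behavior_iff (hg : T.Guides ψ φ) {p u s : List A} {q : Q} {d : Side} {m n : X}
    {f : GuardedState Q X} {x y : Side} {l : X × A × X}
    (hl : (bimark φ p u s)[x.entry u.length - 1]? = some l) (hx : 1 ≤ x.entry u.length) :
    (run q d m n, f) ∈ (T.guarded ψ hs).behavior x y (bimark φ p u s) ↔
      Matches hs d m n l ∧ ∃ q', f = exitState φ p u s q' y ∧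
        T.OnPath (p ++ u ++ s) (q, p.length + x.entry u.length) ∧
        ReflTransGen (T.Within p u s) (q, p.length + x.entry u.length)
          (q', p.length + y.exit u.length) := by
  obtain ⟨k, hk⟩ : ∃ k, x.entry u.length = k + 1 := ⟨_, (Nat.sub_add_cancel hx).symm⟩
  have hl' := hl
  rw [hk, Nat.add_sub_cancel, getElem?_bimark, Option.map_eq_some_iff] at hl'
  obtain ⟨a, ha, hle⟩ := hl'
  replace hle := hle.symm
  rw [hle, matches_iff_valid hg.word ha (q := q), ← hk]
  simp only [behavior, Set.mem_ofPred_eq, length_bimark]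
  constructor
  · intro h
    have key : ∀ c, ReflTransGen ((T.guarded ψ hs).InnerStep (bimark φ p u s)) c
        (f, y.exit u.length) → ∀ C, Valid φ p u s c C → T.OnPath (p ++ u ++ s) C →
        ∃ q', f = exitState φ p u s q' y ∧
          ReflTransGen (T.Within p u s) C (q', p.length + y.exit u.length) := by
      intro c hr
      induction hr using ReflTransGen.head_induction_on with
      | refl =>
        intro C hC _
        have hC' : C = (C.1, p.length + y.exit u.length) := Prod.ext rfl hC.exists_run.2
        rw [hC'] at hC
        exact ⟨C.1, (Prod.mk.injEq _ _ _ _ ▸ valid_exit.1 hC).1, hC' ▸ .refl⟩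
      | @head c e hst hr ih =>
        intro C hC hon
        have hn := innerStep_near hst
        obtain ⟨j, l, hj, hl, h1, h2⟩ := innerStep_iff.1 hst
        rw [getElem?_bimark, Option.map_eq_some_iff] at hl
        obtain ⟨b, hb, rfl⟩ := hl
        rw [length_bimark] at hn
        rcases (faithful_letter hg hb hC hj).of_guarded_step hg h1 h2 with
          ⟨hd, hpos, -⟩ | ⟨C', hC', hval⟩
        · rw [← length_bimark (φ := φ) p u s] at hr
          refine absurd hr (guarded_not_exit (.inl hd) ?_ ?_)
          · omega
          · rw [length_bimark]
            omega
        · have hpos := hC.exists_run.2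
          have hnext : T.Next (p ++ u ++ s) C C' := by
            refine ⟨_, fun hacc => ?_, hC'⟩
            have := hacc.2
            simp only [List.length_append] at this
            omega
          obtain ⟨q', h3, h4⟩ := ih C' hval (hon.next hg.deterministic hnext)
          exact ⟨q', h3, .head ⟨by omega, by omega, hnext⟩ h4⟩
    by_cases hex : ∃ τ, T.Candidate ψ hs q d m n (.letter l) τ
    · obtain ⟨τ, hτ⟩ := hex
      rw [hle, candidate_letter hg ha, ← hk] at hτ
      obtain ⟨q', h1, h2⟩ := key _ h _ hτ.1 hτ.2.1
      exact ⟨hτ.1, q', h1, hτ.2.1, h2⟩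
    · have hlt := (List.getElem?_eq_some_iff.1 ha).1
      rcases ReflTransGen.cases_head h with h | ⟨e, hst, hr⟩
      · have := congrArg Prod.snd h
        cases y <;> simp [Side.exit] at this <;> omega
      · obtain ⟨j, l', hj, hl', h1, h2⟩ := innerStep_iff.1 hst
        obtain rfl : j = k := by simp only at hj; omega
        obtain rfl : l = l' := by
          rw [hk, Nat.add_sub_cancel, hl'] at hl
          simpa using hl.symm
        rw [(guarded_of_not_candidate hex).1] at h1 h2
        simp only [SignType.coe_zero, add_zero, Nat.cast_inj] at h2
        rw [← length_bimark (φ := φ) p u s] at hr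
        exact absurd hr (guarded_not_exit (.inl h1) (by omega) (by rw [length_bimark]; omega))
  · rintro ⟨hval, q', rfl, hon, hr⟩
    have key : ∀ C, ReflTransGen (T.Within p u s) C (q', p.length + y.exit u.length) →
        ∀ c, Valid φ p u s c C → T.OnPath (p ++ u ++ s) C →
        ReflTransGen ((T.guarded ψ hs).InnerStep (bimark φ p u s)) c
          (exitState φ p u s q' y, y.exit u.length) := by
      intro C hr
      induction hr using ReflTransGen.head_induction_on with
      | refl =>
        intro c hc _
        rw [valid_exit.1 hc]
      | @head C D hst hr ih =>
        intro c hc hon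
        obtain ⟨h1, h2, v, hnext⟩ := hst
        have hpos := hc.exists_run.2
        obtain ⟨j, hj⟩ : ∃ j, c.2 = j + 1 := ⟨c.2 - 1, by omega⟩
        have hb : u[j]? = some u[j] := List.getElem?_eq_getElem (by omega)
        obtain ⟨e, h3, h4, -, h5⟩ := (faithful_letter (hs := hs) hg hb hc hj).of_step hg hon hnext
        refine .head ?_ (ih e h5 (hon.next hg.deterministic ⟨v, hnext⟩))
        exact TwoWayTransducer.innerStep_of_getElem?
          (by rw [getElem?_bimark, hb]; rfl) hj h3 h4
    exact key _ hr _ hval hon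

end Guarded

end StarFreeTransducer

/-! ### Aperiodicity of the simulation -/

namespace StarFreeTransducer

open TwoWayAutomaton GuardedState

variable {Q : Type u} {A : Type v} {B : Type w} {X : Type} {Y : Type*} {φ : List A → X}
  {T : StarFreeTransducer Q A B} {ψ : List (Marked A) → Y} {hs : Function.Surjective φ}

theorem val_wordPow_append (h : AperiodicInvariant φ) {u s : List A} (hus : φ (u ++ s) = φ s)
    (k : ℕ) : φ (wordPow u k ++ s) = φ s := by
  induction k with
  | zero => rfl
  | succ k ih => rw [wordPow_succ, List.append_assoc, h.congr_left ih, hus]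

theorem val_append_wordPow (h : AperiodicInvariant φ) {p u : List A} (hpu : φ (p ++ u) = φ p)
    (k : ℕ) : φ (p ++ wordPow u k) = φ p := by
  induction k with
  | zero => rw [wordPow_zero, List.append_nil]
  | succ k ih => rw [wordPow_succ', ← List.append_assoc, h.congr_right ih, hpu]

theorem bimark_wordPow (h : AperiodicInvariant φ) {p u s : List A} (hpu : φ (p ++ u) = φ p)
    (hus : φ (u ++ s) = φ s) (k : ℕ) :
    bimark φ p (wordPow u k) s = wordPow (bimark φ p u s) k := by
  induction k with
  | zero => rfl
  | succ k ih =>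
    rw [wordPow_succ, wordPow_succ, bimark_append, ← ih,
      bimark_congr h rfl (val_wordPow_append h hus k), bimark_congr h hpu rfl]

theorem eq_bimark_of_isChain (h : AperiodicInvariant φ) {z : List (X × A × X)}
    (hz : z.IsChain (Consecutive hs)) : ∀ {p s : List A}, (∀ l ∈ z.head?, φ p = l.1) →
    (∀ l ∈ z.getLast?, φ s = l.2.2) → z = bimark φ p (z.map fun l => l.2.1) s := by
  induction z with
  | nil => intros; rfl
  | cons l z ih =>
    intro p s hp hl
    obtain ⟨m, a, n⟩ := l
    obtain rfl : φ p = m := hp _ rfl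
    rcases z with _ | ⟨l', z⟩
    · obtain rfl : φ s = n := hl _ rfl
      rfl
    · obtain ⟨hcons, hz⟩ := List.isChain_cons_cons.1 hz
      have hih := ih hz (p := p ++ [a]) (s := s) (fun x hx => by
        obtain rfl : l' = x := by simpa using hx
        rw [hcons.1, valSnoc_apply h]) (fun x hx => hl x (by simpa using hx))
      rw [List.map_cons, bimark, ← hih]
      have hl' : l'.2.2 = φ (z.map (fun l => l.2.1) ++ s) := by
        rw [List.map_cons, bimark] at hih
        rw [(List.cons.inj hih).1]
      have hn : n = φ ((l' :: z).map (fun l => l.2.1) ++ s) := by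
        have := hcons.2
        simp only at this
        rw [this, hl', valCons_apply h]
        rfl
      rw [← hn]

/-- A word with consistent square is the annotation of a factor `u` of some word `p u s`. As the
value of `p` is that of `p u` and the value of `s` is that of `u s`, its powers are the annotations
of the powers of `u` in the same context. -/
theorem exists_eq_bimark (h : AperiodicInvariant φ) {z : List (X × A × X)} (hne : z ≠ [])
    (hz : (z ++ z).IsChain (Consecutive hs)) : ∃ p u s, p ≠ [] ∧ u ≠ [] ∧ s ≠ [] ∧
      z = bimark φ p u s ∧ φ (p ++ u) = φ p ∧ φ (u ++ s) = φ s := by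
  rw [List.isChain_append] at hz
  obtain ⟨hz, -, hj⟩ := hz
  have hhead := List.head?_eq_some_head hne
  have hlast := List.getLast?_eq_some_getLast hne
  have hcons := hj _ hlast _ hhead
  set l₀ := z.head hne
  set l₁ := z.getLast hne
  set u := z.map fun l => l.2.1 with hu
  have hz' : z = bimark φ (rep hs l₀.1) u (rep hs l₁.2.2) := by
    refine eq_bimark_of_isChain h hz (fun l hl => ?_) fun l hl => ?_
    · rw [hhead] at hl
      rw [apply_rep hs, ← Option.some.inj hl]
    · rw [hlast] at hl
      rw [apply_rep hs, ← Option.some.inj hl]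
  have hlen : u.length = z.length := by simp [hu]
  have hpos := List.length_pos_iff.2 hne
  have hu0 : u ≠ [] := by
    rw [← List.length_pos_iff]
    omega
  have hpu : φ (rep hs l₀.1 ++ u) = φ (rep hs l₀.1) := by
    rw [List.getLast?_eq_getElem?, hz', getElem?_bimark, length_bimark,
      Option.map_eq_some_iff] at hlast
    obtain ⟨a, ha, hl⟩ := hlast
    have := valSnoc_take (hs := hs) (p := rep hs l₀.1) h ha
    rw [show u.length - 1 + 1 = u.length by omega, List.take_length] at this
    have e := congrArg (fun l => valSnoc hs l.1 l.2.1) hl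
    simp only at e
    rw [← this, e, ← hcons.1, apply_rep hs]
  have hus : φ (u ++ rep hs l₁.2.2) = φ (rep hs l₁.2.2) := by
    rw [List.head?_eq_getElem?, hz', getElem?_bimark, Option.map_eq_some_iff] at hhead
    obtain ⟨a, ha, hl⟩ := hhead
    have := valCons_drop (hs := hs) (s := rep hs l₁.2.2) h ha
    rw [List.drop_zero] at this
    have e := congrArg (fun l => valCons hs l.2.1 l.2.2) hl
    simp only at e
    rw [← this, e, ← hcons.2, apply_rep hs]
  refine ⟨rep hs l₀.1 ++ u, u, u ++ rep hs l₁.2.2, by simp [hu0], hu0, by simp [hu0], ?_,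
    h.congr_right hpu u, h.congr_left hus u⟩
  rw [bimark_congr h hpu hus]
  exact hz'

/-- The outer copies of `z` keep the entry and the exit of the inner power in its context. -/
theorem guarded_behavior_wordPow (hg : T.Guides ψ φ) {z : List (X × A × X)} (hne : z ≠ [])
    (hz : (z ++ z).IsChain (Consecutive hs)) {m m' : ℕ}
    (hm : ∀ u v w ρ, T.IsContextPath v (wordPow u m) w ρ ↔ T.IsContextPath v (wordPow u m') w ρ)
    {x y : Side} {c f : GuardedState Q X}
    (h : (c, f) ∈ (T.guarded ψ hs).behavior x y (z ++ wordPow z m ++ z)) :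
    (c, f) ∈ (T.guarded ψ hs).behavior x y (z ++ wordPow z m' ++ z) := by
  have hpos := List.length_pos_iff.2 hne
  by_cases hc : ∀ q d m n, c ≠ run q d m n
  · refine guarded_behavior_of_not_run hc (by simp; omega) ?_ h
    obtain ⟨l, z, rfl⟩ := List.exists_cons_of_ne_nil hne
    rfl
  push Not at hc
  obtain ⟨q, d, a, b, rfl⟩ := hc
  obtain ⟨p, u, s, hp, hu, hs', rfl, hpu, hus⟩ := exists_eq_bimark hg.word hne hz
  have hw : ∀ m, bimark φ p u s ++ wordPow (bimark φ p u s) m ++ bimark φ p u s =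
      bimark φ p (u ++ wordPow u m ++ u) s := by
    intro m
    rw [← wordPow_succ, ← wordPow_succ', ← bimark_wordPow hg.word hpu hus, wordPow_succ',
      wordPow_succ]
  have hexit : ∀ m m' (q : Q), exitState φ p (u ++ wordPow u m ++ u) s q y =
      exitState φ p (u ++ wordPow u m' ++ u) s q y := by
    intro m m' q
    simp only [← wordPow_succ, ← wordPow_succ']
    cases y <;> simp only [exitState, val_wordPow_append hg.word hus,
      val_append_wordPow hg.word hpu]
  have hentry : ∀ m, 1 ≤ x.entry (u ++ wordPow u m ++ u).length := by
    intro m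
    have := List.length_pos_iff.2 hu
    cases x <;> simp [Side.entry]
    omega
  obtain ⟨l, hl⟩ : ∃ l, ∀ m, (bimark φ p (u ++ wordPow u m ++ u) s)[x.entry
      (u ++ wordPow u m ++ u).length - 1]? = some l := by
    rw [length_bimark] at hpos
    cases x with
    | left =>
      refine ⟨(bimark φ p u s)[0]'(by rwa [length_bimark]), fun m => ?_⟩
      rw [← hw, List.append_assoc, List.getElem?_append_left (by
        simpa [Side.entry, length_bimark] using hpos)]
      simp [Side.entry]
    | right =>
      refine ⟨(bimark φ p u s)[u.length - 1]'(by rw [length_bimark]; omega), fun m => ?_⟩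
      have hlen : (bimark φ p u s ++ wordPow (bimark φ p u s) m).length =
          u.length + (wordPow u m).length := by
        rw [← bimark_wordPow hg.word hpu hus]
        simp [length_bimark]
      rw [← hw, List.getElem?_append_right (by rw [hlen]; simp [Side.entry]; omega), hlen]
      rw [← List.getElem?_eq_getElem]
      congr 1
      simp [Side.entry]
      omega
  rw [hw, guarded_behavior_iff hg (hl _) (hentry _)] at h ⊢
  obtain ⟨hmatch, q', rfl, hon, hr⟩ := h
  obtain ⟨hon', hr'⟩ := within_wordPow hg.deterministic (fun v w ρ => hm u v w ρ) hu hp hs' hon hr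
  exact ⟨hmatch, q', hexit _ _ _, hon', hr'⟩

theorem guarded_isAperiodic (hg : T.Guides ψ φ) (haper : T.IsAperiodic) :
    (T.guarded ψ hs).IsAperiodic := by
  obtain ⟨n, -, hn⟩ := haper
  refine (isAperiodicMonoid_iff _).2 ⟨n + 2, fun z => ?_⟩
  by_cases hne : z = []
  · rw [hne, wordPow_nil, wordPow_nil]
    exact .rfl
  have hpow : ∀ m, wordPow z (m + 2) = z ++ wordPow z m ++ z := by
    intro m
    rw [← wordPow_succ, ← wordPow_succ']
  rw [hpow, show n + 2 + 1 = n + 1 + 2 by omega, hpow]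
  by_cases hz : (z ++ z).IsChain (Consecutive hs)
  · exact fun x y => Set.ext fun ⟨c, f⟩ =>
      ⟨guarded_behavior_wordPow hg hne hz (fun u v w ρ => hn u v w ρ),
        guarded_behavior_wordPow hg hne hz (fun u v w ρ => (hn u v w ρ).symm)⟩
  · obtain ⟨h1, h2⟩ := guarded_not_crossed (T := T) (ψ := ψ) hz
    have e1 : ∀ m, z ++ wordPow z m ++ z = z ++ z ++ wordPow z m := by
      intro m
      rw [← wordPow_succ, ← wordPow_succ', wordPow_succ, wordPow_succ, List.append_assoc]
    have e2 : ∀ m, z ++ wordPow z m ++ z = wordPow z m ++ (z ++ z) := by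
      intro m
      rw [← wordPow_succ, ← wordPow_succ', wordPow_succ', wordPow_succ', List.append_assoc]
    intro x y
    cases x with
    | left =>
      rw [e1, e1, behavior_left_append (by simp [hne]) h1, behavior_left_append (by simp [hne]) h1]
    | right =>
      rw [e2, e2, behavior_right_append (by simp [hne]) h2,
        behavior_right_append (by simp [hne]) h2]

end StarFreeTransducer

/-! ### Elimination of the look-around -/

section Annotate

variable {A : Type v} {X : Type} {φ : List A → X}

theorem map_fst_annot {S : Type*} (st : S → A → S) (s : S) (w : List A) :
    (annot st s w).map Prod.fst = w := by
  induction w generalizing s with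
  | nil => rfl
  | cons a w ih => rw [annot, List.map_cons, ih]

theorem mirrorFun_annot_cons {S : Type*} (st : S → A → S) (s : S) (a : A) (w : List A) :
    mirrorFun (annot st s) (a :: w) = (a, w.reverse.foldl st s) :: mirrorFun (annot st s) w := by
  simp [mirrorFun, annot_append, annot]

/-- The values of the contexts of the letters are computed by a pass from left to right and a pass
from right to left. -/
theorem eliminable_bimark [Finite X] (B : Type w) (h : AperiodicInvariant φ)
    (hs : Function.Surjective φ) : Eliminable.{u} B fun u => bimark φ [] u [] := by
  have h' : AperiodicInvariant fun u : List (A × X) => φ (u.map Prod.fst).reverse :=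
    h.reverse.comp_map Prod.fst
  have hs' : Function.Surjective fun u : List (A × X) => φ (u.map Prod.fst).reverse := by
    intro x
    refine ⟨(rep hs x).reverse.map fun a => (a, x), ?_⟩
    simp [Function.comp_def, apply_rep hs]
  have key : ∀ u p, (mirrorFun (annot (valSnoc hs') (φ (([] : List (A × X)).map Prod.fst).reverse))
      (annot (valSnoc hs) (φ p) u)).map (fun l => (l.1.2, l.1.1, l.2)) = bimark φ p u [] := by
    intro u
    induction u with
    | nil => exact fun p => rfl
    | cons a u ih =>
      intro p
      rw [annot, mirrorFun_annot_cons, List.map_cons, valSnoc_apply h, ih, bimark,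
        foldl_valSnoc h' hs' [], List.nil_append, List.map_reverse, List.reverse_reverse,
        map_fst_annot, List.append_nil]
  have := ((cascade_annot_valSnoc h hs).eliminable (B := B)).comp
    (((cascade_annot_valSnoc h' hs').eliminable_mirrorFun (B := B)).comp
      (eliminable_map.{u} B fun l => (l.1.2, l.1.1, l.2)))
  convert this using 1
  funext u
  exact (key u []).symm

end Annotate

theorem StarFreeTransducer.GuardedState.finite {Q X : Type*} [Finite Q] [Finite X] :
    Finite (GuardedState Q X) := by
  refine Finite.of_injective (β := Option (Option (X × X ⊕ Q × Side × X × X))) (fun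
    | dead => none
    | init => some none
    | enter m n => some (some (.inl (m, n)))
    | run q s m n => some (some (.inr (q, s, m, n)))) ?_
  intro x y h
  cases x <;> cases y <;> simp_all

theorem mainTheorem6 {Q A B : Type*} [Finite Q] [Finite A] [Finite B]
    (T : StarFreeTransducer Q A B) (hdet : T.IsDeterministic) (haper : T.IsAperiodic) :
    ∃ (P : Type) (_ : Finite P) (C : TwoWayTransducer P A B),
      C.IsAperiodic ∧ ∀ (u : List A) (v : List B), C.IsImage u v ↔ T.IsImage u v := by
  obtain ⟨Y, _, ψ, hψ, hsat⟩ := exists_common_invariant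
    (s := LookAroundTransition.pre '' T.Δ ∪ LookAroundTransition.suf '' T.Δ)
    ((T.finite_Δ.image _).union (T.finite_Δ.image _)) (by
      rintro L (⟨τ, hτ, rfl⟩ | ⟨τ, hτ, rfl⟩)
      · exact T.starFree_pre τ hτ
      · exact T.starFree_suf τ hτ)
  have hdec : T.Decides ψ := fun τ hτ =>
    ⟨hsat _ (.inl ⟨τ, hτ, rfl⟩), hsat _ (.inr ⟨τ, hτ, rfl⟩)⟩
  obtain ⟨X, _, φ, hφ, hs, htape, hvis⟩ :=
    StarFreeTransducer.exists_visit_invariant hdet haper hdec hψ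
  have hg : T.Guides ψ φ := ⟨hdet, hdec, hψ, hφ, htape, hvis⟩
  have := StarFreeTransducer.GuardedState.finite (Q := Q) (X := X)
  obtain ⟨P, _, C, hC, himg⟩ := eliminable_bimark B hφ hs _ (T.guarded ψ hs)
    (StarFreeTransducer.guarded_isAperiodic hg haper)
  refine ⟨_, inferInstance, C.mapStates (Finite.equivFin P),
    TwoWayTransducer.isAperiodic_mapStates _ hC, fun u v => ?_⟩
  rw [TwoWayTransducer.mapStates_isImage, himg, StarFreeTransducer.guarded_isImage hg]
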